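/- Let $k$ be a field, and let $R$ and $S$ be standard graded $k$-algebras, i.e. commutative noetherian $\mathbb N$-graded $k$-algebras with $R_0=k$, $S_0=k$, generated as $k$-algebras by their elements of degree $1$. Let $T=R\otimes_k S$, graded by total degree. For a standard graded $k$-algebra $A$ with graded maximal ideal $\mathfrak m$ (so that $k\cong A/\mathfrak m$), and a finitely generated graded $A$-module $M$, let $\operatorname{pd}_A M$ denote the projective dimension of $M$ and let $$\operatorname{reg}_A M=\sup\{j-i : \operatorname{Tor}^A_i(k,M)_j\neq 0\};$$ both may be $+\infty$. A proper homogeneous ideal $I\subseteq A$ is said to be of small type if for all $r\ge 1$ and all $i\ge 0$ the map $\operatorname{Tor}^A_i(k,I^r)\to \operatorname{Tor}^A_i(k,I^{r-1})$ induced by the inclusion $I^r\subseteq I^{r-1}$ is zero (where $I^0=A$). Let $I\subseteq R$ and $J\subseteq S$ be proper homogeneous ideals of small type such that $I^i\neq 0$ and $J^i\ne 0$ for all $i\ge 1$. Let $P=IT+JT\subseteq T$. Then for all $s\ge 1$, $$\operatorname{pd}_T P^s=\max_{i\in[1,s-1],\ j\in[1,s]}\left\{\operatorname{pd}_R I^{s-i}+\operatorname{pd}_S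 J^i,\ \operatorname{pd}_R I^{s-j+1}+\operatorname{pd}_S J^j+1\right\},$$ $$\operatorname{reg}_T P^s=\max_{i\in[1,s-1],\ j\in[1,s]}\left\{\operatorname{reg}_R I^{s-i}+\operatorname{reg}_S J^i,\ \operatorname{reg}_R I^{s-j+1}+\operatorname{reg}_S J^j-1\right\},$$ where $i$ and $j$ range over integers; for $s=1$ there are no terms indexed by $i$, and the maximum is taken over the terms indexed by $j$ only. -/

import Mathlib

open CategoryTheory
open scoped TensorProduct

universe u v w

/-- `𝒜` is a standard grading of the `k`-algebra `A`: the ring `A` is noetherian, the degree zero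
part is `k`, and `A` is generated as a `k`-algebra by its elements of degree one. -/
structure IsStandardGraded {k : Type u} [Field k] {A : Type v} [CommRing A] [Algebra k A]
    (𝒜 : ℕ → Submodule k A) [GradedAlgebra 𝒜] : Prop where
  nontrivial : Nontrivial A
  noetherian : IsNoetherianRing A
  degree_zero : 𝒜 0 = (⊥ : Subalgebra k A).toSubmodule
  generated : Algebra.adjoin k (𝒜 1 : Set A) = ⊤

/-- The ideal generated by the elements of positive degree. For a standard graded algebra over a
field this is the graded maximal ideal. -/
def gradedMaximalIdeal {k : Type u} [Field k] {A : Type v} [CommRing A] [Algebra k A]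
    (𝒜 : ℕ → Submodule k A) : Ideal A :=
  Ideal.span {a : A | ∃ n : ℕ, 0 < n ∧ a ∈ 𝒜 n}

/-- An ideal `I` is of small type if for all `r ≥ 1` and all `i ≥ 0` the map
`Tor_i(k, I ^ r) ⟶ Tor_i(k, I ^ (r - 1))` induced by the inclusion is zero. Here `k` is the
`A`-module `A ⧸ 𝔪`. -/
def IsSmallType {k : Type u} [Field k] {A : Type v} [CommRing A] [Algebra k A]
    (𝒜 : ℕ → Submodule k A) (I : Ideal A) : Prop :=
  ∀ r i : ℕ,
    ((Tor (ModuleCat.{v} A) i).obj (ModuleCat.of A (A ⧸ gradedMaximalIdeal 𝒜))).map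
      (ModuleCat.ofHom (Submodule.inclusion (Ideal.pow_le_pow_right (I := I) (Nat.le_succ r)))) = 0

/-- The projective dimension of an ideal, as a module over the ring. -/
noncomputable def idealProjDim {A : Type v} [CommRing A] (I : Ideal A) : WithBot ℕ∞ :=
  projectiveDimension (ModuleCat.of A I)

/-- The degree `j` part of the graded free module `⨁ e, A(-deg e)`: those `f` whose coordinate at
`e` is homogeneous of degree `j - deg e` (and zero if this number is negative). -/
noncomputable def freeGrading {k : Type u} [Field k] {A : Type v} [CommRing A] [Algebra k A]
    (𝒜 : ℕ → Submodule k A) {ι : Type v} (deg : ι → ℕ) (j : ℕ) : Submodule k (ι →₀ A) :=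
  ⨅ e : ι, (if deg e ≤ j then 𝒜 (j - deg e) else ⊥).comap
    ((Finsupp.lapply e : (ι →₀ A) →ₗ[A] A).restrictScalars k)

/-- A graded free resolution `⋯ ⟶ F₁ ⟶ F₀ ⟶ M ⟶ 0` of a graded `A`-module `M`, with
`F_i = ⨁ e, A(-deg e)` and with differentials and augmentation preserving degrees. -/
structure GradedFreeResolution {k : Type u} [Field k] {A : Type v} [CommRing A] [Algebra k A]
    (𝒜 : ℕ → Submodule k A) {M : Type v} [AddCommGroup M] [Module A M] [Module k M]
    [IsScalarTower k A M]
    (ℳ : ℕ → Submodule k M) where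
  ι : ℕ → Type v
  deg : ∀ i, ι i → ℕ
  d : ∀ i, (ι (i + 1) →₀ A) →ₗ[A] (ι i →₀ A)
  aug : (ι 0 →₀ A) →ₗ[A] M
  d_homogeneous : ∀ i e, d i (Finsupp.single e 1) ∈ freeGrading 𝒜 (deg i) (deg (i + 1) e)
  aug_homogeneous : ∀ e, aug (Finsupp.single e 1) ∈ ℳ (deg 0 e)
  exact_succ : ∀ i, Function.Exact (d (i + 1)) (d i)
  exact_zero : Function.Exact (d 0) aug
  aug_surjective : Function.Surjective aug

namespace GradedFreeResolution

variable {k : Type u} [Field k] {A : Type v} [CommRing A] [Algebra k A]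
  {𝒜 : ℕ → Submodule k A} {M : Type v} [AddCommGroup M] [Module A M] [Module k M]
    [IsScalarTower k A M]
  {ℳ : ℕ → Submodule k M}

/-- The elements of `F_i` whose class in `k ⊗ F_i = F_i / 𝔪 F_i` is a cycle of `k ⊗ F`. -/
noncomputable def cycles (F : GradedFreeResolution 𝒜 ℳ) : ∀ i, Submodule A (F.ι i →₀ A)
  | 0 => ⊤
  | i + 1 => (gradedMaximalIdeal 𝒜 • (⊤ : Submodule A (F.ι i →₀ A))).comap (F.d i)

/-- The elements of `F_i` whose class in `k ⊗ F_i = F_i / 𝔪 F_i` is a boundary of `k ⊗ F`. -/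
noncomputable def boundaries (F : GradedFreeResolution 𝒜 ℳ) (i : ℕ) : Submodule A (F.ι i →₀ A) :=
  LinearMap.range (F.d i) ⊔ gradedMaximalIdeal 𝒜 • (⊤ : Submodule A (F.ι i →₀ A))

/-- `Tor_i(k, M)_j`, the degree `j` part of the `i`-th homology of `k ⊗ F`, computed with the
graded free resolution `F` of `M`: the classes of the cycles of degree `j` modulo boundaries. -/
noncomputable def torDegree (F : GradedFreeResolution 𝒜 ℳ) (i j : ℕ) :
    Submodule k ((F.ι i →₀ A) ⧸ F.boundaries i) :=
  ((F.cycles i).restrictScalars k ⊓ freeGrading 𝒜 (F.deg i) j).map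
    ((F.boundaries i).mkQ.restrictScalars k)

end GradedFreeResolution

/-- The regularity `sup {j - i | Tor_i(k, M)_j ≠ 0}` of the graded module `M` over `A`. The spaces
`Tor_i(k, M)_j` are computed by a graded free resolution; up to isomorphism they do not depend on
it. The value is `⊤` if the set is unbounded, and `⊥` for the zero module. -/
noncomputable def regularity {k : Type u} [Field k] {A : Type v} [CommRing A] [Algebra k A]
    (𝒜 : ℕ → Submodule k A) {M : Type v} [AddCommGroup M] [Module A M] [Module k M]
    [IsScalarTower k A M]
    (ℳ : ℕ → Submodule k M) : EReal :=
  sSup {x : EReal | ∃ i j : ℕ,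
    (∃ F : GradedFreeResolution 𝒜 ℳ, F.torDegree i j ≠ ⊥) ∧
      x = (((j : ℝ) - (i : ℝ) : ℝ) : EReal)}

/-- The grading which an ideal inherits from the ring. -/
def idealGrading {k : Type u} [Field k] {A : Type v} [CommRing A] [Algebra k A]
    (𝒜 : ℕ → Submodule k A) (I : Ideal A) (j : ℕ) : Submodule k I :=
  (𝒜 j).comap ((Submodule.subtype I).restrictScalars k)

/-- The regularity of an ideal, as a graded module over the ring. -/
noncomputable def idealReg {k : Type u} [Field k] {A : Type v} [CommRing A] [Algebra k A]
    (𝒜 : ℕ → Submodule k A) (I : Ideal A) : EReal :=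
  regularity 𝒜 (idealGrading 𝒜 I)

/-- The grading of `R ⊗ S` by total degree: the part of degree `n` is `⨁ R_a ⊗ S_b` over
`a + b = n`. -/
def tensorGrading {k : Type u} [Field k] {R : Type v} [CommRing R] [Algebra k R]
    {S : Type w} [CommRing S] [Algebra k S] (𝒜 : ℕ → Submodule k R) (ℬ : ℕ → Submodule k S)
    (n : ℕ) : Submodule k (R ⊗[k] S) :=
  ⨆ p ∈ Finset.HasAntidiagonal.antidiagonal n,
    LinearMap.range (TensorProduct.map (𝒜 p.1).subtype (ℬ p.2).subtype)

/-- The mixed sum of `I` and `J`: the sum of their extensions to `R ⊗ S`. -/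
def mixedSum (k : Type u) [Field k] {R : Type v} [CommRing R] [Algebra k R]
    {S : Type w} [CommRing S] [Algebra k S] (I : Ideal R) (J : Ideal S) : Ideal (R ⊗[k] S) :=
  I.map (Algebra.TensorProduct.includeLeft : R →ₐ[k] R ⊗[k] S) ⊔
    J.map (Algebra.TensorProduct.includeRight : S →ₐ[k] R ⊗[k] S)

/-! ### Graded free modules and homogeneous maps -/

section GradedFree

variable {k : Type u} [Field k] {A : Type v} [CommRing A] [Algebra k A]

/-! The power `P ^ s` is the sum over `0 ≤ i ≤ s` of the products `I^(s-i) J^i`, extended to `T`.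
Let `Q_t` be the partial sum over `i ≤ t`. Over a field, extended ideals satisfy `IT ∩ JT = IT · JT`
(`inf_map_le_extendedProduct`). Every term of `Q_t` has `I`-exponent at least `s-t`, so `Q_t` meets
`I^(s-t-1) J^(t+1)` exactly in `I^(s-t) J^(t+1)` (`powerFiltration_inf_le`). Hence `Q_(t+1)` is
resolved by the mapping cone of a map from a resolution of `I^(s-t) J^(t+1)` to the direct sum of
resolutions of `Q_t` and of `I^(s-t-1) J^(t+1)`. Each product is resolved by the tensor product over
`k` of minimal resolutions of its factors, and this is again minimal.

Small type makes the cones minimal. A map between minimal resolutions has entries in the maximal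
ideal as soon as it induces zero on Tor (`chainMap_mem_smul_top`). The map towards `Q_t` factors
through `I^(s-t) J^t`, so it involves a lift of `J^(t+1) ⊆ J^t`; the map towards `I^(s-t-1) J^(t+1)`
involves a lift of `I^(s-t) ⊆ I^(s-t-1)`.

Induction on `t` (`exists_resolution_powerFiltration`) gives a minimal resolution of `P ^ s` whose
basis degrees are those of `I^(s-i) ⊗ J^i` for `0 ≤ i ≤ s`, together with those of `I^(s-j+1) ⊗ J^j`
for `1 ≤ j ≤ s` moved up by one homological degree. Projective dimension and regularity are suprema
over the basis degrees of any minimal resolution, so the formulas can be read off. The terms `i = 0`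
and `i = s`, where a factor is the unit ideal, are absorbed by the cone terms `j = 1` and `j = s`,
because a nonzero proper homogeneous ideal has regularity at least one. -/

theorem gradedMaximalIdeal_eq_irrelevant (𝒜 : ℕ → Submodule k A) [GradedAlgebra 𝒜] :
    gradedMaximalIdeal 𝒜 = (HomogeneousIdeal.irrelevant 𝒜).toIdeal := by
  rw [HomogeneousIdeal.irrelevant_eq_span, gradedMaximalIdeal]
  congr 1
  ext a
  simp

theorem mem_gradedMaximalIdeal_iff (𝒜 : ℕ → Submodule k A) [GradedAlgebra 𝒜] {a : A} :
    a ∈ gradedMaximalIdeal 𝒜 ↔ (DirectSum.decompose 𝒜 a 0 : A) = 0 := by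
  rw [gradedMaximalIdeal_eq_irrelevant]
  exact HomogeneousIdeal.mem_irrelevant_iff 𝒜 a

theorem mem_gradedMaximalIdeal_of_mem (𝒜 : ℕ → Submodule k A) {a : A} {n : ℕ} (hn : 0 < n)
    (ha : a ∈ 𝒜 n) : a ∈ gradedMaximalIdeal 𝒜 :=
  Ideal.subset_span ⟨n, hn, ha⟩

theorem gradedMaximalIdeal_ne_top (𝒜 : ℕ → Submodule k A) [GradedAlgebra 𝒜] [Nontrivial A] :
    gradedMaximalIdeal 𝒜 ≠ ⊤ := by
  rw [Ne, Ideal.eq_top_iff_one, mem_gradedMaximalIdeal_iff,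
    DirectSum.decompose_of_mem_same 𝒜 (SetLike.GradedOne.one_mem (A := 𝒜))]
  exact one_ne_zero

/-- Lets minimality be tested entry by entry on matrices, for free modules of any rank. -/
theorem mem_ideal_smul_finsupp_top {ι : Type*} {m : Ideal A} {x : ι →₀ A} :
    x ∈ m • (⊤ : Submodule A (ι →₀ A)) ↔ ∀ e, x e ∈ m := by
  constructor
  · intro hx e
    have h : Finsupp.lapply (R := A) e x ∈ Submodule.map (Finsupp.lapply (R := A) e)
      (m • (⊤ : Submodule A (ι →₀ A))) := Submodule.mem_map_of_mem hx
    rw [Submodule.map_smul''] at h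
    have h' : m • Submodule.map (Finsupp.lapply (R := A) e) (⊤ : Submodule A (ι →₀ A)) ≤ m := by
      rw [Submodule.smul_le]
      intro r hr n _
      exact m.mul_mem_right _ hr
    exact h' h
  · intro h
    rw [← Finsupp.sum_single x]
    refine Submodule.sum_mem _ fun e _ => ?_
    have : Finsupp.single e (x e) = x e • Finsupp.single e (1 : A) := by simp
    rw [this]
    exact Submodule.smul_mem_smul (h e) trivial

/-- The homogeneous elements of degree `j` of `A(-m)`. -/
def shiftedPart (𝒜 : ℕ → Submodule k A) (m j : ℕ) : Submodule k A :=
  if m ≤ j then 𝒜 (j - m) else ⊥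

variable {𝒜 : ℕ → Submodule k A}

theorem mem_shiftedPart_add {m n : ℕ} {a : A} (ha : a ∈ 𝒜 n) : a ∈ shiftedPart 𝒜 m (m + n) := by
  simpa [shiftedPart] using ha

theorem mem_shiftedPart_iff {m j : ℕ} {a : A} :
    a ∈ shiftedPart 𝒜 m j ↔ a = 0 ∨ ∃ n, j = m + n ∧ a ∈ 𝒜 n := by
  unfold shiftedPart
  constructor
  · intro h
    split_ifs at h with hm
    · exact Or.inr ⟨_, (Nat.add_sub_cancel' hm).symm, h⟩
    · exact Or.inl h
  · rintro (rfl | ⟨n, rfl, hn⟩)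
    · exact zero_mem _
    · simpa using hn

theorem mem_freeGrading_iff {ι : Type v} {deg : ι → ℕ} {j : ℕ} {x : ι →₀ A} :
    x ∈ freeGrading 𝒜 deg j ↔ ∀ e, x e ∈ shiftedPart 𝒜 (deg e) j := by
  simp only [freeGrading, Submodule.mem_iInf, Submodule.mem_comap]
  rfl

theorem single_mem_freeGrading {ι : Type v} {deg : ι → ℕ} {j : ℕ} {e : ι} {a : A}
    (ha : a ∈ shiftedPart 𝒜 (deg e) j) : Finsupp.single e a ∈ freeGrading 𝒜 deg j := by
  classical
  rw [mem_freeGrading_iff]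
  intro e'
  rw [Finsupp.single_apply]
  split_ifs with h
  · subst h; exact ha
  · exact zero_mem _

theorem single_one_mem_freeGrading [SetLike.GradedOne 𝒜] {ι : Type v} {deg : ι → ℕ} (e : ι) :
    Finsupp.single e 1 ∈ freeGrading 𝒜 deg (deg e) :=
  single_mem_freeGrading
    (mem_shiftedPart_add (n := 0) (SetLike.GradedOne.one_mem (A := 𝒜)))

variable (𝒜) in
/-- The map decomposing an element of a graded free module into homogeneous components. -/
noncomputable def freeDecompose [GradedAlgebra 𝒜] {ι : Type v} (deg : ι → ℕ) :
    (ι →₀ A) →ₗ[k] DirectSum ℕ fun j => freeGrading 𝒜 deg j :=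
  Finsupp.lsum k fun e =>
    (DirectSum.toModule k ℕ (DirectSum ℕ (freeGrading 𝒜 deg ·)) (fun n =>
      (DirectSum.lof k ℕ (fun j => freeGrading 𝒜 deg j) (deg e + n)) ∘ₗ
        ((Finsupp.lsingle e : A →ₗ[k] (ι →₀ A)).restrict (p := 𝒜 n)
          (q := freeGrading 𝒜 deg (deg e + n)) fun _ ha =>
            single_mem_freeGrading (mem_shiftedPart_add ha)))) ∘ₗ
      (DirectSum.decomposeLinearEquiv 𝒜).toLinearMap

theorem freeDecompose_single [GradedAlgebra 𝒜] {ι : Type v} {deg : ι → ℕ} {e : ι} {n : ℕ} {a : A}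
    (ha : a ∈ 𝒜 n) :
    freeDecompose 𝒜 deg (Finsupp.single e a) =
      DirectSum.lof k ℕ (fun j => freeGrading 𝒜 deg j) (deg e + n)
        ⟨Finsupp.single e a, single_mem_freeGrading (mem_shiftedPart_add ha)⟩ := by
  rw [freeDecompose, Finsupp.lsum_single, LinearMap.comp_apply, LinearEquiv.coe_coe,
    DirectSum.decomposeLinearEquiv_apply, DirectSum.decompose_of_mem 𝒜 ha,
    ← DirectSum.lof_eq_of k, DirectSum.toModule_lof]
  rfl

theorem freeDecompose_of_mem [GradedAlgebra 𝒜] {ι : Type v} {deg : ι → ℕ} {j : ℕ} {x : ι →₀ A}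
    (hx : x ∈ freeGrading 𝒜 deg j) :
    freeDecompose 𝒜 deg x = DirectSum.lof k ℕ (fun j => freeGrading 𝒜 deg j) j ⟨x, hx⟩ := by
  have hx' := mem_freeGrading_iff.1 hx
  have h1 : ∀ e, freeDecompose 𝒜 deg (Finsupp.single e (x e)) =
      DirectSum.lof k ℕ (fun j => freeGrading 𝒜 deg j) j
        ⟨Finsupp.single e (x e), single_mem_freeGrading (hx' e)⟩ := by
    intro e
    rcases mem_shiftedPart_iff.1 (hx' e) with h | ⟨n, rfl, hn⟩
    · have : (⟨Finsupp.single e (x e), single_mem_freeGrading (hx' e)⟩ : freeGrading 𝒜 deg j) = 0 :=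
        Subtype.ext (by simp [h])
      rw [this, map_zero, h, Finsupp.single_zero, map_zero]
    · exact freeDecompose_single hn
  have h2 : (⟨x, hx⟩ : freeGrading 𝒜 deg j) =
      ∑ e ∈ x.support, ⟨Finsupp.single e (x e), single_mem_freeGrading (hx' e)⟩ := by
    apply Subtype.ext
    rw [AddSubmonoidClass.coe_finsetSum]
    exact (Finsupp.sum_single x).symm
  rw [h2, map_sum]
  conv_lhs => rw [← Finsupp.sum_single x, Finsupp.sum, map_sum]
  exact Finset.sum_congr rfl fun e _ => h1 e

noncomputable instance freeGrading.decomposition [GradedAlgebra 𝒜] {ι : Type v} (deg : ι → ℕ) :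
    DirectSum.Decomposition (freeGrading 𝒜 deg) :=
  DirectSum.Decomposition.ofLinearMap _ (freeDecompose 𝒜 deg)
    (by
      refine Finsupp.lhom_ext fun e a => ?_
      induction a using DirectSum.Decomposition.inductionOn 𝒜 with
      | zero => simp
      | @homogeneous n a =>
        rw [LinearMap.comp_apply, freeDecompose_single a.2, DirectSum.coeLinearMap_lof]
        rfl
      | add a b ha hb => rw [Finsupp.single_add, map_add, map_add, ha, hb])
    (by
      ext j x
      simp only [LinearMap.comp_apply, DirectSum.coeLinearMap_lof, LinearMap.id_apply]
      rw [freeDecompose_of_mem x.2])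

instance freeGrading.gradedSMul [GradedAlgebra 𝒜] {ι : Type v} (deg : ι → ℕ) :
    SetLike.GradedSMul 𝒜 (freeGrading 𝒜 deg) where
  smul_mem {i j a x} ha hx := by
    rw [mem_freeGrading_iff] at hx ⊢
    intro e
    rcases mem_shiftedPart_iff.1 (hx e) with h | ⟨n, rfl, hn⟩
    · simp [h]
    · refine mem_shiftedPart_iff.2 (Or.inr ⟨i + n, ?_, SetLike.GradedMul.mul_mem ha hn⟩)
      rw [vadd_eq_add]; omega

/-! ### Homogeneous components, graded lifts and Nakayama -/

section GradedModule

variable {M : Type*} [AddCommGroup M] [Module A M] [Module k M]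
  {ℳ : ℕ → Submodule k M}

theorem map_mem_of_mem_freeGrading [SetLike.GradedSMul 𝒜 ℳ] {ι : Type v} {deg : ι → ℕ}
    {f : (ι →₀ A) →ₗ[A] M} (hf : ∀ e, f (Finsupp.single e 1) ∈ ℳ (deg e)) {j : ℕ} {x : ι →₀ A}
    (hx : x ∈ freeGrading 𝒜 deg j) : f x ∈ ℳ j := by
  rw [← Finsupp.sum_single x, Finsupp.sum, map_sum]
  refine Submodule.sum_mem _ fun e _ => ?_
  have : Finsupp.single e (x e) = x e • Finsupp.single e (1 : A) := by simp
  rw [this, map_smul]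
  rcases mem_shiftedPart_iff.1 (mem_freeGrading_iff.1 hx e) with h | ⟨n, rfl, hn⟩
  · simp [h]
  · have := SetLike.GradedSMul.smul_mem (A := 𝒜) (B := ℳ) hn (hf e)
    rwa [vadd_eq_add, add_comm] at this

variable [GradedAlgebra 𝒜] [DirectSum.Decomposition ℳ] [SetLike.GradedSMul 𝒜 ℳ]

theorem decompose_map {ι : Type v} {deg : ι → ℕ}
    {f : (ι →₀ A) →ₗ[A] M} (hf : ∀ e, f (Finsupp.single e 1) ∈ ℳ (deg e)) (x : ι →₀ A) (j : ℕ) :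
    (DirectSum.decompose ℳ (f x) j : M) =
      f (DirectSum.decompose (freeGrading 𝒜 deg) x j : ι →₀ A) := by
  induction x using DirectSum.Decomposition.inductionOn (freeGrading 𝒜 deg) with
  | zero => simp
  | @homogeneous n x =>
    have h := map_mem_of_mem_freeGrading hf x.2
    by_cases hn : n = j
    · subst hn
      rw [DirectSum.decompose_of_mem_same _ h, DirectSum.decompose_of_mem_same _ x.2]
    · rw [DirectSum.decompose_of_mem_ne _ h hn, DirectSum.decompose_of_mem_ne _ x.2 hn, map_zero]
  | add x y hx hy => simp [DirectSum.decompose_add, hx, hy]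

/-- A degree preserving map commutes with taking components, so the degree `j` component of any
preimage of `y` is still a preimage. -/
theorem exists_mem_freeGrading_map_eq {ι : Type v} {deg : ι → ℕ}
    {f : (ι →₀ A) →ₗ[A] M} (hf : ∀ e, f (Finsupp.single e 1) ∈ ℳ (deg e)) {y : M} {j : ℕ}
    (hy : y ∈ ℳ j) (hy' : y ∈ LinearMap.range f) : ∃ x ∈ freeGrading 𝒜 deg j, f x = y := by
  obtain ⟨x, rfl⟩ := hy'
  exact ⟨_, (DirectSum.decompose (freeGrading 𝒜 deg) x j).2,
    by rw [← decompose_map hf, DirectSum.decompose_of_mem_same _ hy]⟩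

theorem exists_graded_lift {ι κ : Type v} {deg : ι → ℕ} {deg' : κ → ℕ}
    {f : (ι →₀ A) →ₗ[A] M} (hf : ∀ e, f (Finsupp.single e 1) ∈ ℳ (deg e))
    {g : (κ →₀ A) →ₗ[A] M} (hg : ∀ e, g (Finsupp.single e 1) ∈ ℳ (deg' e))
    (h : LinearMap.range f ≤ LinearMap.range g) :
    ∃ φ : (ι →₀ A) →ₗ[A] (κ →₀ A), g ∘ₗ φ = f ∧
      ∀ e, φ (Finsupp.single e 1) ∈ freeGrading 𝒜 deg' (deg e) := by
  choose y hy hy' using fun e => exists_mem_freeGrading_map_eq (𝒜 := 𝒜) hg (hf e) (h ⟨_, rfl⟩)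
  refine ⟨Finsupp.linearCombination A y, ?_, fun e => ?_⟩
  · ext e
    simp [hy']
  · simpa using hy e

theorem ker_isHomogeneous {ι : Type v} {deg : ι → ℕ}
    {f : (ι →₀ A) →ₗ[A] M} (hf : ∀ e, f (Finsupp.single e 1) ∈ ℳ (deg e)) :
    (LinearMap.ker f).IsHomogeneous (freeGrading 𝒜 deg) := by
  intro j x hx
  change f _ = 0
  rw [← decompose_map hf, show f x = 0 from hx]
  simp

/-- The homogeneous components of an element of `𝔪 K` are combinations of elements of `K`
of smaller degree. -/
theorem decompose_mem_span_of_mem_smul {K : Submodule A M} (hK : K.IsHomogeneous ℳ) {x : M}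
    (hx : x ∈ gradedMaximalIdeal 𝒜 • K) (j : ℕ) :
    (DirectSum.decompose ℳ x j : M) ∈
      gradedMaximalIdeal 𝒜 • Submodule.span A {y | y ∈ K ∧ ∃ l < j, y ∈ ℳ l} := by
  classical
  induction hx using Submodule.smul_induction_on' with
  | smul a ha y hy =>
    rw [← DirectSum.sum_support_decompose 𝒜 a, Finset.sum_smul, DirectSum.decompose_sum,
      DFinsupp.finsetSum_apply, AddSubmonoidClass.coe_finsetSum]
    refine Submodule.sum_mem _ fun n _ => ?_
    rw [← DirectSum.sum_support_decompose ℳ y, Finset.smul_sum, DirectSum.decompose_sum,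
      DFinsupp.finsetSum_apply, AddSubmonoidClass.coe_finsetSum]
    refine Submodule.sum_mem _ fun l _ => ?_
    have hmem := SetLike.GradedSMul.smul_mem (A := 𝒜) (B := ℳ)
      (DirectSum.decompose 𝒜 a n).2 (DirectSum.decompose ℳ y l).2
    rw [vadd_eq_add] at hmem
    by_cases hj : n + l = j
    · subst hj
      rw [DirectSum.decompose_of_mem_same _ hmem]
      -- An element of the maximal ideal has no degree zero component, so a surviving product has `n
      -- > 0` and thus `l < j`.
      rcases Nat.eq_zero_or_pos n with rfl | hn
      · rw [(mem_gradedMaximalIdeal_iff 𝒜).1 ha, zero_smul]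
        exact zero_mem _
      · exact Submodule.smul_mem_smul
          (mem_gradedMaximalIdeal_of_mem 𝒜 hn (DirectSum.decompose 𝒜 a n).2)
          (Submodule.subset_span ⟨hK l hy, l, by omega, (DirectSum.decompose ℳ y l).2⟩)
    · rw [DirectSum.decompose_of_mem_ne _ hmem hj]
      exact zero_mem _
  | add y _ z _ hy hz =>
    rw [DirectSum.decompose_add, DirectSum.add_apply, Submodule.coe_add]
    exact add_mem hy hz

/-- Graded Nakayama lemma. -/
theorem le_of_le_sup_smul {K L : Submodule A M} (hK : K.IsHomogeneous ℳ)
    (h : ∀ j, ∀ x ∈ K, x ∈ ℳ j → ∃ y ∈ L, ∃ z ∈ gradedMaximalIdeal 𝒜 • K, z ∈ ℳ j ∧ x = y + z) :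
    K ≤ L := by
  classical
  -- Induction on the degree takes the place of finite generation: the part of `x` in `𝔪 K` is a
  -- combination of elements of `K` of strictly smaller degree, and degrees are bounded below.
  have key : ∀ j, ∀ x ∈ K, x ∈ ℳ j → x ∈ L := by
    intro j
    induction j using Nat.strong_induction_on with
    | _ j ih =>
      intro x hx hxj
      obtain ⟨y, hy, z, hz, hzj, rfl⟩ := h j x hx hxj
      refine add_mem hy ?_
      have h1 := decompose_mem_span_of_mem_smul hK hz j
      rw [DirectSum.decompose_of_mem_same _ hzj] at h1
      refine (Submodule.smul_le_right.trans (Submodule.span_le.2 ?_)) h1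
      rintro y ⟨hy, l, hl, hyl⟩
      exact ih l hl y hy hyl
  intro x hx
  rw [← DirectSum.sum_support_decompose ℳ x]
  exact Submodule.sum_mem _ fun j _ => key j _ (hK j hx) (DirectSum.decompose ℳ x j).2

theorem eq_bot_of_le_smul {K : Submodule A M} (hK : K.IsHomogeneous ℳ)
    (h : K ≤ gradedMaximalIdeal 𝒜 • K) : K = ⊥ :=
  eq_bot_iff.2 <| le_of_le_sup_smul (𝒜 := 𝒜) hK fun _ x hx hxj =>
    ⟨0, zero_mem _, x, h hx, hxj, (zero_add x).symm⟩

end GradedModule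

end GradedFree

/-! ### Minimal covers and existence of minimal resolutions -/

section MinimalCover

variable {k : Type u} [Field k] {A : Type v} [CommRing A] [Algebra k A]
  {𝒜 : ℕ → Submodule k A} [GradedAlgebra 𝒜]

theorem exists_complement_of_le {M : Type*} [AddCommGroup M] [Module k M]
    {V W : Submodule k M} (h : V ≤ W) : ∃ C : Submodule k M, V ⊓ C = ⊥ ∧ V ⊔ C = W := by
  obtain ⟨D, hD⟩ := exists_isCompl V
  refine ⟨D ⊓ W, ?_, ?_⟩
  · rw [← inf_assoc, hD.inf_eq_bot, bot_inf_eq]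
  · rw [← sup_inf_assoc_of_le D h, hD.sup_eq_top, top_inf_eq]

theorem map_mem_smul_of_mem_smul_top {m : Ideal A} {M N : Type*} [AddCommGroup M] [Module A M]
    [AddCommGroup N] [Module A N] (f : M →ₗ[A] N) {x : M} (hx : x ∈ m • (⊤ : Submodule A M)) :
    f x ∈ m • LinearMap.range f := by
  have := Submodule.mem_map_of_mem (f := f) hx
  rwa [Submodule.map_smul'', Submodule.map_top] at this

section Cover

variable {M : Type v} [AddCommGroup M] [Module A M] [Module k M] [IsScalarTower k A M]
  {ℳ : ℕ → Submodule k M}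

/-- The map from a graded free module which sends the basis to bases of given subspaces `C j`. -/
noncomputable def basisCover (A : Type v) [CommRing A] [Module A M]
    {C : ℕ → Submodule k M} {B : ℕ → Type v} (b : ∀ j, Module.Basis (B j) k (C j)) :
    ((Σ j, B j) →₀ A) →ₗ[A] M :=
  Finsupp.linearCombination A fun e => (b e.1 e.2 : M)

theorem le_range_basisCover {C : ℕ → Submodule k M} {B : ℕ → Type v}
    (b : ∀ j, Module.Basis (B j) k (C j)) (j : ℕ) {c : M} (hc : c ∈ C j) :
    c ∈ LinearMap.range (basisCover A b) := by
  have h1 : (⟨c, hc⟩ : C j) ∈ Submodule.span k (Set.range (b j)) := by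
    rw [(b j).span_eq]; trivial
  have h2 := Submodule.mem_map_of_mem (f := (C j).subtype) h1
  rw [Submodule.map_span] at h2
  have h3 : Submodule.span k ((C j).subtype '' Set.range (b j)) ≤
      (LinearMap.range (basisCover A b)).restrictScalars k := by
    rw [Submodule.span_le]
    rintro _ ⟨_, ⟨i, rfl⟩, rfl⟩
    exact ⟨Finsupp.single ⟨j, i⟩ 1, by simp [basisCover]⟩
  exact h3 h2

-- Modulo the maximal ideal only the coordinates at generators of degree exactly `n` matter, and
-- these are scalars since the degree zero part is `k`. The corresponding `k`-combination of basis
-- vectors of `C n` lies in `𝔪 K`, where `K` is the range of the cover. As `C n` meets `𝔪 K`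
-- trivially in degree `n`, linear independence kills all these scalars.
omit [GradedAlgebra 𝒜] in
theorem mem_smul_top_of_basisCover_eq_zero_of_mem [Nontrivial A]
    (h0 : 𝒜 0 = (⊥ : Subalgebra k A).toSubmodule)
    {C : ℕ → Submodule k M} {B : ℕ → Type v} (b : ∀ j, Module.Basis (B j) k (C j))
    (hCM : ∀ j, C j ≤ ℳ j)
    (hC1 : ∀ j, (gradedMaximalIdeal 𝒜 • LinearMap.range (basisCover A b)).restrictScalars k ⊓ ℳ j ⊓
      C j = ⊥) {n : ℕ} {x : (Σ j, B j) →₀ A}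
    (hx : x ∈ freeGrading 𝒜 (Sigma.fst : (Σ j, B j) → ℕ) n) (hfx : basisCover A b x = 0) :
    x ∈ gradedMaximalIdeal 𝒜 • (⊤ : Submodule A ((Σ j, B j) →₀ A)) := by
  -- A `k`-linear retraction of `A` onto `k`, which reads off the scalar behind a degree zero
  -- coordinate.
  obtain ⟨ρ, hρ⟩ := (Algebra.linearMap k A).exists_leftInverse_of_injective
    (LinearMap.ker_eq_bot.2 (algebraMap k A).injective)
  have hinj : Function.Injective (Sigma.mk n : B n → Σ j, B j) := sigma_mk_injective
  obtain ⟨y, hyx⟩ : ∃ y, y = x.comapDomain (Sigma.mk n) hinj.injOn := ⟨_, rfl⟩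
  have hy : ∀ i, y i = algebraMap k A (ρ (y i)) := by
    intro i
    have h1 := mem_freeGrading_iff.1 hx ⟨n, i⟩
    simp only [shiftedPart, le_refl, if_true, Nat.sub_self, h0] at h1
    obtain ⟨c, hc⟩ := Algebra.mem_bot.1 h1
    have hc' : algebraMap k A c = y i := by rw [hc, hyx, Finsupp.comapDomain_apply]
    have : ρ (algebraMap k A c) = c := LinearMap.congr_fun hρ c
    rw [← hc', this]
  have hx2 : x - y.mapDomain (Sigma.mk n) ∈
      gradedMaximalIdeal 𝒜 • (⊤ : Submodule A ((Σ j, B j) →₀ A)) := by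
    rw [mem_ideal_smul_finsupp_top]
    rintro ⟨n', i⟩
    by_cases h : n' = n
    · subst h
      rw [Finsupp.sub_apply, Finsupp.mapDomain_apply hinj, hyx, Finsupp.comapDomain_apply, sub_self]
      exact zero_mem _
    · rw [Finsupp.sub_apply, Finsupp.mapDomain_of_notMem_range, sub_zero]
      · rcases mem_shiftedPart_iff.1 (mem_freeGrading_iff.1 hx ⟨n', i⟩) with h' | ⟨d, hd, h'⟩
        · rw [h']; exact zero_mem _
        · exact mem_gradedMaximalIdeal_of_mem 𝒜 (by simp only at hd; omega) h'
      · rintro ⟨i', h'⟩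
        exact h (congrArg Sigma.fst h').symm
  have hfy : basisCover A b (y.mapDomain (Sigma.mk n)) =
      (Finsupp.linearCombination k (b n) (y.mapRange ρ (map_zero ρ)) : C n) := by
    rw [basisCover, Finsupp.linearCombination_mapDomain, Finsupp.linearCombination_apply,
      Finsupp.linearCombination_apply, Finsupp.sum_mapRange_index (by simp), Finsupp.sum,
      Finsupp.sum, AddSubmonoidClass.coe_finsetSum]
    refine Finset.sum_congr rfl fun i _ => ?_
    conv_lhs => rw [hy i]
    rw [algebraMap_smul]
    rfl
  have hmem := hfy ▸ Subtype.mem (Finsupp.linearCombination k (b n) (y.mapRange ρ (map_zero ρ)))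
  have hfyV : basisCover A b (y.mapDomain (Sigma.mk n)) ∈
      gradedMaximalIdeal 𝒜 • LinearMap.range (basisCover A b) := by
    have h1 := map_mem_smul_of_mem_smul_top (basisCover A b) hx2
    rw [map_sub, hfx, zero_sub] at h1
    exact (Submodule.neg_mem_iff _).1 h1
  have hzero : basisCover A b (y.mapDomain (Sigma.mk n)) = 0 := by
    rw [← Submodule.mem_bot k, ← hC1 n]
    exact ⟨⟨hfyV, hCM n hmem⟩, hmem⟩
  rw [hfy, Submodule.coe_eq_zero] at hzero
  have hc : y.mapRange ρ (map_zero ρ) = 0 :=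
    linearIndependent_iff.1 (b n).linearIndependent _ hzero
  have hy0 : y = 0 := by
    ext i
    have := DFunLike.congr_fun hc i
    rw [Finsupp.mapRange_apply] at this
    rw [hy i, this]
    simp
  rwa [hy0, Finsupp.mapDomain_zero, sub_zero] at hx2

/-- Every homogeneous submodule of a graded module has a minimal cover by a graded free module. -/
theorem exists_minimal_cover [Nontrivial A] (h0 : 𝒜 0 = (⊥ : Subalgebra k A).toSubmodule)
    [DirectSum.Decomposition ℳ] [SetLike.GradedSMul 𝒜 ℳ]
    {K : Submodule A M} (hK : K.IsHomogeneous ℳ) :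
    ∃ (ι : Type v) (deg : ι → ℕ) (f : (ι →₀ A) →ₗ[A] M),
      (∀ e, f (Finsupp.single e 1) ∈ ℳ (deg e)) ∧ LinearMap.range f = K ∧
        ∀ x, f x = 0 → x ∈ gradedMaximalIdeal 𝒜 • (⊤ : Submodule A (ι →₀ A)) := by
  classical
  have hle : (gradedMaximalIdeal 𝒜 • K).restrictScalars k ≤ K.restrictScalars k :=
    Submodule.restrictScalars_mono k Submodule.smul_le_right
  -- `C j` is a complement of the degree `j` part of `𝔪 K` in that of `K`, so a basis of it lifts a
  -- basis of the degree `j` part of `K / 𝔪 K`.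
  choose C hC1 hC2 using fun j : ℕ => exists_complement_of_le
    (V := (gradedMaximalIdeal 𝒜 • K).restrictScalars k ⊓ ℳ j) (W := K.restrictScalars k ⊓ ℳ j)
    (inf_le_inf_right _ hle)
  have hCK : ∀ j (c : C j), (c : M) ∈ K ∧ (c : M) ∈ ℳ j := fun j c =>
    (hC2 j ▸ (le_sup_right : C j ≤ _)) c.2
  obtain ⟨B, ⟨b⟩⟩ : ∃ B : ℕ → Type v, Nonempty (∀ j, Module.Basis (B j) k (C j)) :=
    ⟨_, ⟨fun j => Module.Basis.ofVectorSpace k (C j)⟩⟩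
  have hgen : ∀ e, basisCover A b (Finsupp.single e 1) = b e.1 e.2 := fun e => by
    simp [basisCover]
  have hgr : ∀ e : Σ j, B j, basisCover A b (Finsupp.single e 1) ∈ ℳ (Sigma.fst e) := fun e => by
    rw [hgen]; exact (hCK e.1 (b e.1 e.2)).2
  have hrange : LinearMap.range (basisCover A b) = K := by
    apply le_antisymm
    · rw [basisCover, Finsupp.range_linearCombination, Submodule.span_le]
      rintro _ ⟨e, rfl⟩
      exact (hCK e.1 (b e.1 e.2)).1
    · refine le_of_le_sup_smul (𝒜 := 𝒜) hK fun j x hx hxj => ?_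
      have hxW : x ∈ K.restrictScalars k ⊓ ℳ j := ⟨hx, hxj⟩
      rw [← hC2, Submodule.mem_sup] at hxW
      obtain ⟨v, hv, c, hc, rfl⟩ := hxW
      exact ⟨c, le_range_basisCover b j hc, v, hv.1, hv.2, add_comm _ _⟩
  refine ⟨Σ j, B j, Sigma.fst, basisCover A b, hgr, hrange, fun x hx => ?_⟩
  rw [← DirectSum.sum_support_decompose (freeGrading 𝒜 (Sigma.fst : (Σ j, B j) → ℕ)) x]
  refine Submodule.sum_mem _ fun n _ => mem_smul_top_of_basisCover_eq_zero_of_mem (ℳ := ℳ) h0 b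
    (fun j c hc => (hCK j ⟨c, hc⟩).2) (fun j => ?_) (SetLike.coe_mem _) ?_
  · rw [hrange]; exact hC1 j
  · rw [← decompose_map hgr, hx]
    simp

end Cover

variable (𝒜) in
/-- A graded free module with a homogeneous submodule. -/
structure HomogeneousSyzygy where
  ι : Type v
  deg : ι → ℕ
  module : Submodule A (ι →₀ A)
  isHomogeneous : module.IsHomogeneous (freeGrading 𝒜 deg)

theorem HomogeneousSyzygy.exists_next [Nontrivial A]
    (h0 : 𝒜 0 = (⊥ : Subalgebra k A).toSubmodule) (Z : HomogeneousSyzygy 𝒜) :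
    ∃ (Z' : HomogeneousSyzygy 𝒜) (f : (Z'.ι →₀ A) →ₗ[A] (Z.ι →₀ A)),
      (∀ e, f (Finsupp.single e 1) ∈ freeGrading 𝒜 Z.deg (Z'.deg e)) ∧
      LinearMap.range f = Z.module ∧ LinearMap.ker f = Z'.module ∧
      Z'.module ≤ gradedMaximalIdeal 𝒜 • ⊤ := by
  obtain ⟨ι, deg, f, h1, h2, h3⟩ := exists_minimal_cover h0 Z.isHomogeneous
  exact ⟨⟨ι, deg, LinearMap.ker f, ker_isHomogeneous h1⟩, f, h1, h2, rfl, h3⟩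

/-- The differentials of a minimal resolution have entries in the maximal ideal. -/
def GradedFreeResolution.IsMinimal {M : Type v} [AddCommGroup M] [Module A M] [Module k M]
    [IsScalarTower k A M] {ℳ : ℕ → Submodule k M} (F : GradedFreeResolution 𝒜 ℳ) : Prop :=
  ∀ i x, F.d i x ∈ gradedMaximalIdeal 𝒜 • (⊤ : Submodule A (F.ι i →₀ A))

/-- Each kernel of a minimal cover lies in `𝔪 F` and is homogeneous, so covering the successive
kernels minimally gives differentials with entries in `𝔪`. -/
theorem exists_minimal_resolution [Nontrivial A] (h0 : 𝒜 0 = (⊥ : Subalgebra k A).toSubmodule)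
    {I : Ideal A} (hI : I.IsHomogeneous 𝒜) :
    ∃ F : GradedFreeResolution 𝒜 (idealGrading 𝒜 I), F.IsMinimal := by
  -- `I` is covered as a submodule of the graded module `A`, so no decomposition of `I` itself has
  -- to be set up.
  obtain ⟨ι, deg, f, h1, h2, h3⟩ := exists_minimal_cover (𝒜 := 𝒜) (ℳ := 𝒜) (K := I) h0 hI
  let Z0 : HomogeneousSyzygy 𝒜 := ⟨ι, deg, LinearMap.ker f, ker_isHomogeneous h1⟩
  choose next d hd1 hd2 hd3 hd4 using HomogeneousSyzygy.exists_next (𝒜 := 𝒜) h0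
  let Z : ℕ → HomogeneousSyzygy 𝒜 := fun n => Nat.rec Z0 (fun _ => next) n
  have hf : ∀ x, f x ∈ I := fun x => h2 ▸ ⟨x, rfl⟩
  refine ⟨{ ι := fun n => (Z n).ι, deg := fun n => (Z n).deg, d := fun n => d (Z n)
            aug := f.codRestrict I hf
            d_homogeneous := fun n e => hd1 (Z n) e
            aug_homogeneous := h1
            exact_succ := fun n => ?_
            exact_zero := ?_
            aug_surjective := ?_ }, ?_⟩
  · rw [LinearMap.exact_iff]
    exact (hd3 (Z n)).trans (hd2 (Z (n + 1))).symm
  · rw [LinearMap.exact_iff, LinearMap.ker_codRestrict]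
    exact (hd2 Z0).symm
  · rintro ⟨y, hy⟩
    rw [← h2] at hy
    obtain ⟨x, rfl⟩ := hy
    exact ⟨x, rfl⟩
  · intro n x
    have hx : d (Z n) x ∈ (Z n).module := hd2 (Z n) ▸ ⟨x, rfl⟩
    cases n with
    | zero => exact h3 _ hx
    | succ n => exact hd4 (Z n) hx

end MinimalCover

/-! ### Comparison of resolutions and regularity -/

section Comparison

variable {k : Type u} [Field k] {A : Type v} [CommRing A] [Algebra k A]
  {𝒜 : ℕ → Submodule k A}

theorem exists_lift_of_range_le {ι : Type*} {X Y : Type*} [AddCommGroup X] [Module A X]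
    [AddCommGroup Y] [Module A Y] (f : (ι →₀ A) →ₗ[A] Y) (g : X →ₗ[A] Y)
    (h : ∀ x, f x ∈ LinearMap.range g) : ∃ φ : (ι →₀ A) →ₗ[A] X, ∀ x, g (φ x) = f x := by
  choose y hy using fun e => h (Finsupp.single e 1)
  refine ⟨Finsupp.linearCombination A y, fun x => ?_⟩
  rw [← LinearMap.comp_apply]
  congr 1
  ext e
  simp [hy]

namespace GradedFreeResolution

/-- Degree preserving maps `φ i : F_i → G_i` commuting with the differentials and augmentations. -/
structure IsChainMap {I J : Ideal A} (F : GradedFreeResolution 𝒜 (idealGrading 𝒜 I))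
    (G : GradedFreeResolution 𝒜 (idealGrading 𝒜 J))
    (φ : ∀ i, (F.ι i →₀ A) →ₗ[A] (G.ι i →₀ A)) : Prop where
  graded : ∀ i e, φ i (Finsupp.single e 1) ∈ freeGrading 𝒜 (G.deg i) (F.deg i e)
  comm : ∀ i x, G.d i (φ (i + 1) x) = φ i (F.d i x)
  aug : ∀ x, (G.aug (φ 0 x) : A) = F.aug x

variable [GradedAlgebra 𝒜]

theorem exists_isChainMap {I J : Ideal A} (hIJ : I ≤ J)
    (F : GradedFreeResolution 𝒜 (idealGrading 𝒜 I))
    (G : GradedFreeResolution 𝒜 (idealGrading 𝒜 J)) : ∃ φ, F.IsChainMap G φ := by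
  -- The second condition, that `φ ∘ d` lands in the image of the next differential, is exactly what
  -- the next lifting step needs, so it is carried along in the recursion.
  let Q : ∀ i, ((F.ι i →₀ A) →ₗ[A] (G.ι i →₀ A)) → Prop := fun i φ =>
    (∀ e, φ (Finsupp.single e 1) ∈ freeGrading 𝒜 (G.deg i) (F.deg i e)) ∧
      LinearMap.range (φ ∘ₗ F.d i) ≤ LinearMap.range (G.d i)
  have step : ∀ i (φ : {φ // Q i φ}), ∃ φ' : {φ // Q (i + 1) φ}, G.d i ∘ₗ φ'.1 = φ.1 ∘ₗ F.d i := by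
    rintro i ⟨φ, h1, h2⟩
    obtain ⟨φ', h3, h4⟩ := exists_graded_lift (𝒜 := 𝒜) (f := φ ∘ₗ F.d i) (deg := F.deg (i + 1))
      (fun e => map_mem_of_mem_freeGrading h1 (F.d_homogeneous i e)) (G.d_homogeneous i) h2
    refine ⟨⟨φ', h4, ?_⟩, h3⟩
    rintro _ ⟨x, rfl⟩
    refine (G.exact_succ i _).1 ?_
    have := LinearMap.congr_fun h3 (F.d (i + 1) x)
    simp only [LinearMap.comp_apply] at this ⊢
    rw [this, (F.exact_succ i).apply_apply_eq_zero, map_zero]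
  have h0 : ∃ φ : {φ // Q 0 φ}, ∀ x, (G.aug (φ.1 x) : A) = F.aug x := by
    obtain ⟨φ', h3, h4⟩ := exists_graded_lift (𝒜 := 𝒜) (ℳ := 𝒜) (f := I.subtype ∘ₗ F.aug)
      (g := J.subtype ∘ₗ G.aug) F.aug_homogeneous G.aug_homogeneous (by
        rintro _ ⟨x, rfl⟩
        obtain ⟨y, hy⟩ := G.aug_surjective ⟨F.aug x, hIJ (F.aug x).2⟩
        exact ⟨y, congrArg Subtype.val hy⟩)
    refine ⟨⟨φ', h4, ?_⟩, fun x => LinearMap.congr_fun h3 x⟩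
    rintro _ ⟨x, rfl⟩
    refine (G.exact_zero _).1 (Subtype.ext ?_)
    have := LinearMap.congr_fun h3 (F.d 0 x)
    simp only [LinearMap.comp_apply, Submodule.subtype_apply] at this ⊢
    rw [this, F.exact_zero.apply_apply_eq_zero]
    rfl
  obtain ⟨φ0, hφ0⟩ := h0
  choose next hnext using step
  let Φ : ∀ i, {φ // Q i φ} := fun i => Nat.rec φ0 next i
  exact ⟨fun i => (Φ i).1, fun i => (Φ i).2.1, fun i x => LinearMap.congr_fun (hnext i (Φ i)) x, hφ0⟩

omit [GradedAlgebra 𝒜] in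
/-- A chain map lifting zero is null homotopic. -/
theorem exists_homotopy {I : Ideal A} (F : GradedFreeResolution 𝒜 (idealGrading 𝒜 I))
    (ψ : ∀ i, (F.ι i →₀ A) →ₗ[A] (F.ι i →₀ A))
    (comm : ∀ i x, F.d i (ψ (i + 1) x) = ψ i (F.d i x)) (aug : ∀ x, F.aug (ψ 0 x) = 0) :
    (∃ h : (F.ι 0 →₀ A) →ₗ[A] (F.ι 1 →₀ A), ∀ x, F.d 0 (h x) = ψ 0 x) ∧
    ∀ i, ∃ (h : (F.ι (i + 1) →₀ A) →ₗ[A] (F.ι (i + 2) →₀ A))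
      (h' : (F.ι i →₀ A) →ₗ[A] (F.ι (i + 1) →₀ A)),
        ∀ x, F.d (i + 1) (h x) = (ψ (i + 1) - h' ∘ₗ F.d i) x := by
  have h0 : ∃ h : (F.ι 0 →₀ A) →ₗ[A] (F.ι 1 →₀ A), ∀ x, F.d 0 (h x) = ψ 0 x :=
    exists_lift_of_range_le (ψ 0) (F.d 0) fun x => (F.exact_zero _).1 (aug x)
  refine ⟨h0, fun i => ?_⟩
  -- At each stage only the newest homotopy and its predecessor are kept; the relation `d h = ψ - h'
  -- d` suffices to make `ψ - h d` land in cycles one degree up.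
  induction i with
  | zero =>
    obtain ⟨h, hh⟩ := h0
    obtain ⟨g, hg⟩ := exists_lift_of_range_le (ψ 1 - h ∘ₗ F.d 0) (F.d 1) fun x =>
      (F.exact_succ 0 _).1 (by
        simp only [LinearMap.sub_apply, LinearMap.comp_apply, map_sub]
        rw [comm, hh, sub_self])
    exact ⟨g, h, hg⟩
  | succ i ih =>
    obtain ⟨h, h', hh⟩ := ih
    obtain ⟨g, hg⟩ := exists_lift_of_range_le (ψ (i + 2) - h ∘ₗ F.d (i + 1)) (F.d (i + 2)) fun x =>
      (F.exact_succ (i + 1) _).1 (by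
        simp only [LinearMap.sub_apply, LinearMap.comp_apply, map_sub]
        rw [comm, hh]
        simp only [LinearMap.sub_apply, LinearMap.comp_apply]
        rw [(F.exact_succ i).apply_apply_eq_zero, map_zero, sub_zero, sub_self])
    exact ⟨g, h, hg⟩

omit [GradedAlgebra 𝒜] in
theorem map_mem_smul_top {m : Ideal A} {X Y : Type*} [AddCommGroup X] [Module A X]
    [AddCommGroup Y] [Module A Y] (f : X →ₗ[A] Y) {x : X} (hx : x ∈ m • (⊤ : Submodule A X)) :
    f x ∈ m • (⊤ : Submodule A Y) :=
  Submodule.smul_mono le_rfl le_top (map_mem_smul_of_mem_smul_top f hx)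

/-- Compare `G` with `F` and back; the composite `β α` is homotopic to the identity of `G`. If `F_i`
had no basis element of degree `j`, the image under `α` of a degree `j` element would have all
entries in the maximal ideal, and every cycle of degree `j` would be a boundary modulo `𝔪`. -/
theorem exists_deg_eq_of_torDegree_ne_bot {I : Ideal A}
    (F G : GradedFreeResolution 𝒜 (idealGrading 𝒜 I)) {i j : ℕ}
    (h : G.torDegree i j ≠ ⊥) : ∃ e : F.ι i, F.deg i e = j := by
  by_contra! hne
  obtain ⟨α, hα⟩ := exists_isChainMap le_rfl G F
  obtain ⟨β, hβ⟩ := exists_isChainMap le_rfl F G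
  apply h
  rw [torDegree, eq_bot_iff]
  rintro _ ⟨z, ⟨hz, hzj⟩, rfl⟩
  have hα' : α i z ∈ gradedMaximalIdeal 𝒜 • (⊤ : Submodule A (F.ι i →₀ A)) := by
    have h1 := mem_freeGrading_iff.1 (map_mem_of_mem_freeGrading (hα.graded i) hzj)
    rw [mem_ideal_smul_finsupp_top]
    intro e
    rcases mem_shiftedPart_iff.1 (h1 e) with h2 | ⟨n, hn, h2⟩
    · rw [h2]; exact zero_mem _
    · refine mem_gradedMaximalIdeal_of_mem 𝒜 (Nat.pos_of_ne_zero ?_) h2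
      rintro rfl
      exact hne e hn.symm
  have hβα := map_mem_smul_top (β i) hα'
  obtain ⟨H0, H1⟩ := exists_homotopy G (fun i => LinearMap.id - β i ∘ₗ α i)
    (fun i x => by simp [hα.comm, hβ.comm])
    (fun x => Subtype.ext (by simp [hα.aug, hβ.aug]))
  change (G.boundaries i).mkQ z = 0
  rw [Submodule.mkQ_apply, Submodule.Quotient.mk_eq_zero, boundaries]
  cases i with
  | zero =>
    obtain ⟨g, hg⟩ := H0
    have : z = G.d 0 (g z) + β 0 (α 0 z) := by rw [hg]; simp
    rw [this]
    exact Submodule.add_mem_sup ⟨_, rfl⟩ hβα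
  | succ i =>
    obtain ⟨g, g', hg⟩ := H1 i
    have : z = G.d (i + 1) (g z) + (g' (G.d i z) + β (i + 1) (α (i + 1) z)) := by
      rw [hg]
      simp only [LinearMap.sub_apply, LinearMap.comp_apply, LinearMap.id_apply]
      abel
    rw [this]
    exact Submodule.add_mem_sup ⟨_, rfl⟩ (add_mem (map_mem_smul_top g' hz) hβα)

/-- The basis vector `e` itself is a nonzero class: under minimality everything is a cycle modulo
`𝔪`, and boundaries have entries in `𝔪`. -/
theorem IsMinimal.torDegree_ne_bot [Nontrivial A] {I : Ideal A}
    {F : GradedFreeResolution 𝒜 (idealGrading 𝒜 I)} (hF : F.IsMinimal) (i : ℕ) (e : F.ι i) :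
    F.torDegree i (F.deg i e) ≠ ⊥ := by
  intro h
  have h1 : (F.boundaries i).mkQ (Finsupp.single e 1) ∈ F.torDegree i (F.deg i e) := by
    refine ⟨_, ⟨?_, single_one_mem_freeGrading e⟩, rfl⟩
    cases i with
    | zero => trivial
    | succ i => exact hF i _
  rw [h, Submodule.mem_bot, Submodule.mkQ_apply, Submodule.Quotient.mk_eq_zero] at h1
  have h2 : F.boundaries i ≤ gradedMaximalIdeal 𝒜 • ⊤ := by
    refine sup_le ?_ le_rfl
    rintro _ ⟨x, rfl⟩
    exact hF i x
  have h3 := mem_ideal_smul_finsupp_top.1 (h2 h1) e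
  rw [Finsupp.single_eq_same] at h3
  exact gradedMaximalIdeal_ne_top 𝒜 (Ideal.eq_top_iff_one _ |>.2 h3)

theorem IsMinimal.idealReg_eq [Nontrivial A] {I : Ideal A}
    {F : GradedFreeResolution 𝒜 (idealGrading 𝒜 I)} (hF : F.IsMinimal) :
    idealReg 𝒜 I = sSup {x : EReal | ∃ (i : ℕ) (e : F.ι i),
      x = (((F.deg i e : ℝ) - (i : ℝ) : ℝ) : EReal)} := by
  rw [idealReg, regularity]
  congr 1
  ext x
  constructor
  · rintro ⟨i, j, ⟨G, hG⟩, rfl⟩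
    obtain ⟨e, rfl⟩ := exists_deg_eq_of_torDegree_ne_bot F G hG
    exact ⟨i, e, rfl⟩
  · rintro ⟨i, e, rfl⟩
    exact ⟨i, _, ⟨F, hF.torDegree_ne_bot i e⟩, rfl⟩

end GradedFreeResolution

end Comparison

/-! ### Projective dimension from a minimal resolution -/

section ProjDim

/-- Dimension shifting along `0 → L → X → N → 0` with `X` projective. The kernel is passed as a
separate `L` so that it can be the image of a differential. -/
theorem hasProjectiveDimensionLT_iff_ker {A : Type v} [CommRing A] {X : Type v} [AddCommGroup X]
    [Module A X] [Module.Projective A X] {N : ModuleCat.{v} A} (p : X →ₗ[A] N)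
    (hp : Function.Surjective p) {L : Submodule A X} (hL : LinearMap.ker p = L) (n : ℕ) :
    HasProjectiveDimensionLT N (n + 2) ↔
      HasProjectiveDimensionLT (ModuleCat.of A L) (n + 1) := by
  let S : ShortComplex (ModuleCat.{v} A) := ShortComplex.mk (ModuleCat.ofHom L.subtype)
    (ModuleCat.ofHom p) (by
      ext x
      have : (x : X) ∈ LinearMap.ker p := hL ▸ x.2
      exact this)
  have hS : S.ShortExact :=
    { exact := by
        rw [ShortComplex.moduleCat_exact_iff]
        intro x hx
        exact ⟨⟨x, hL ▸ (hx : x ∈ LinearMap.ker p)⟩, rfl⟩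
      mono_f := (ModuleCat.mono_iff_injective _).2 L.injective_subtype
      epi_g := (ModuleCat.epi_iff_surjective _).2 hp }
  exact hS.hasProjectiveDimensionLT_X₃_iff n (inferInstanceAs (Projective (ModuleCat.of A X)))

variable {k : Type u} [Field k] {A : Type v} [CommRing A] [Algebra k A]
  {𝒜 : ℕ → Submodule k A}

namespace GradedFreeResolution

variable {I : Ideal A} (F : GradedFreeResolution 𝒜 (idealGrading 𝒜 I))

/-- The syzygies of a resolution. -/
noncomputable def syzygy : ℕ → ModuleCat.{v} A
  | 0 => ModuleCat.of A I
  | i + 1 => ModuleCat.of A (LinearMap.range (F.d i))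

/-- The surjection from a term of the resolution to the syzygy. -/
noncomputable def toSyzygy : ∀ i, (F.ι i →₀ A) →ₗ[A] F.syzygy i
  | 0 => F.aug
  | i + 1 => (F.d i).rangeRestrict

theorem toSyzygy_surjective : ∀ i, Function.Surjective (F.toSyzygy i)
  | 0 => F.aug_surjective
  | i + 1 => (F.d i).surjective_rangeRestrict

theorem ker_toSyzygy : ∀ i, LinearMap.ker (F.toSyzygy i) = LinearMap.range (F.d i)
  | 0 => LinearMap.exact_iff.1 F.exact_zero
  | i + 1 => (LinearMap.ker_rangeRestrict _).trans (LinearMap.exact_iff.1 (F.exact_succ i))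

theorem hasProjectiveDimensionLT_syzygy_iff (i n : ℕ) :
    HasProjectiveDimensionLT (F.syzygy i) (n + 1) ↔ Projective (F.syzygy (i + n)) := by
  induction n generalizing i with
  | zero => exact projective_iff_hasProjectiveDimensionLT_one.symm
  | succ n ih =>
    rw [hasProjectiveDimensionLT_iff_ker (F.toSyzygy i) (F.toSyzygy_surjective i)
      (F.ker_toSyzygy i) n, show i + (n + 1) = i + 1 + n by omega, ← ih]
    rfl

theorem projective_syzygy_of_isEmpty {n : ℕ} (h : IsEmpty (F.ι (n + 1))) :
    Projective (F.syzygy n) := by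
  have h1 : LinearMap.ker (F.toSyzygy n) = ⊥ := by
    rw [ker_toSyzygy, LinearMap.range_eq_bot]
    exact Subsingleton.elim _ _
  have e := LinearEquiv.ofBijective (F.toSyzygy n)
    ⟨LinearMap.ker_eq_bot.1 h1, F.toSyzygy_surjective n⟩
  have := Module.Projective.of_equiv e
  exact (IsProjective.iff_projective (R := A) (F.syzygy n)).1 this

variable {F} [GradedAlgebra 𝒜]

/-- If the syzygy is projective, then the image of `d n` is a direct summand of `F_n` with projector
`π`. It also lies in `𝔪 F_n`, so applying `π` puts it inside `𝔪` times itself, and Nakayama makes it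
zero. Then `d (n + 1)` is onto `F_(n+1)`, which for a minimal resolution forces the basis to be
empty. -/
theorem IsMinimal.isEmpty_of_projective [Nontrivial A] (hF : F.IsMinimal) {n : ℕ}
    (h : Projective (F.syzygy n)) : IsEmpty (F.ι (n + 1)) := by
  have : Module.Projective A (F.syzygy n) := (IsProjective.iff_projective (R := A) (F.syzygy n)).2 h
  obtain ⟨s, hs⟩ := Module.projective_lifting_property (F.toSyzygy n) LinearMap.id
    (F.toSyzygy_surjective n)
  let π := LinearMap.id - s ∘ₗ F.toSyzygy n
  have hπ : LinearMap.range π ≤ LinearMap.range (F.d n) := by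
    rw [← ker_toSyzygy]
    rintro _ ⟨x, rfl⟩
    have := LinearMap.congr_fun hs (F.toSyzygy n x)
    simp only [LinearMap.comp_apply, LinearMap.id_apply] at this
    simp [π, this]
  have hK : (LinearMap.range (F.d n)).IsHomogeneous (freeGrading 𝒜 (F.deg n)) := by
    rintro j _ ⟨x, rfl⟩
    rw [decompose_map (𝒜 := 𝒜) (F.d_homogeneous n)]
    exact ⟨_, rfl⟩
  have hbot : LinearMap.range (F.d n) = ⊥ := by
    refine eq_bot_of_le_smul (𝒜 := 𝒜) hK fun x hx => ?_
    have h1 : π x = x := by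
      rw [← ker_toSyzygy] at hx
      simp [π, LinearMap.mem_ker.1 hx]
    rw [← h1]
    obtain ⟨y, rfl⟩ := hx
    exact Submodule.smul_mono le_rfl hπ (map_mem_smul_of_mem_smul_top π (hF n y))
  refine ⟨fun e => ?_⟩
  have h2 : Finsupp.single e 1 ∈ LinearMap.range (F.d (n + 1)) := by
    refine (F.exact_succ n _).1 ?_
    rw [LinearMap.range_eq_bot.1 hbot]
    rfl
  obtain ⟨y, hy⟩ := h2
  have h3 := mem_ideal_smul_finsupp_top.1 (hF (n + 1) y) e
  rw [hy, Finsupp.single_eq_same] at h3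
  exact gradedMaximalIdeal_ne_top 𝒜 ((Ideal.eq_top_iff_one _).2 h3)

theorem IsMinimal.idealProjDim_le_iff [Nontrivial A] (hF : F.IsMinimal) (n : ℕ) :
    idealProjDim I ≤ n ↔ ∀ i (_ : F.ι i), i ≤ n := by
  rw [idealProjDim, projectiveDimension_le_iff, HasProjectiveDimensionLE]
  constructor
  · intro h i e
    by_contra! hi
    have h1 := hasProjectiveDimensionLT_of_ge (ModuleCat.of A I) (n + 1) i hi
    obtain ⟨i, rfl⟩ := Nat.exists_eq_succ_of_ne_zero (Nat.ne_zero_of_lt hi)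
    have h2 := (F.hasProjectiveDimensionLT_syzygy_iff 0 i).1 h1
    rw [zero_add] at h2
    exact (hF.isEmpty_of_projective h2).false e
  · intro h
    refine (F.hasProjectiveDimensionLT_syzygy_iff 0 n).2 ?_
    rw [zero_add]
    exact F.projective_syzygy_of_isEmpty ⟨fun e => absurd (h _ e) (by omega)⟩

end GradedFreeResolution

end ProjDim

/-! ### Zero maps on Tor and entries of chain maps -/

section TorMaps

/-- With zero differentials, cycles and homology both coincide with the terms of the complex, so a
map is determined by its effect on homology. -/
theorem homologicalComplex_hom_f_eq_zero {C : Type*} [Category* C] [Abelian C] {c : ComplexShape ℕ}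
    {K L : HomologicalComplex C c} (φ : K ⟶ L) (hK : ∀ i j, K.d i j = 0) (hL : ∀ i j, L.d i j = 0)
    (n : ℕ) (h : HomologicalComplex.homologyMap φ n = 0) : φ.f n = 0 := by
  have h1 := K.isIso_iCycles n _ rfl (hK _ _)
  have h2 := L.isIso_homologyπ _ n rfl (hL _ _)
  have h3 := HomologicalComplex.homologyπ_naturality φ n
  rw [h, Limits.comp_zero] at h3
  have h4 : HomologicalComplex.cyclesMap φ n = 0 := by
    rw [← cancel_mono (L.homologyπ n), ← h3, Limits.zero_comp]
  have h5 := HomologicalComplex.cyclesMap_i φ n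
  rw [h4, Limits.zero_comp] at h5
  rw [← cancel_epi (K.iCycles n), ← h5, Limits.comp_zero]

variable {k : Type u} [Field k] {A : Type v} [CommRing A] [Algebra k A]
  {𝒜 : ℕ → Submodule k A}

namespace GradedFreeResolution

variable {I : Ideal A} (F : GradedFreeResolution 𝒜 (idealGrading 𝒜 I))

/-- The chain complex of a graded free resolution. -/
noncomputable def complex : ChainComplex (ModuleCat.{v} A) ℕ :=
  ChainComplex.of (fun i => ModuleCat.of A (F.ι i →₀ A)) (fun i => ModuleCat.ofHom (F.d i))
    fun i => by
      ext1
      exact (F.exact_succ i).linearMap_comp_eq_zero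

theorem complex_d (i : ℕ) : F.complex.d (i + 1) i = ModuleCat.ofHom (F.d i) :=
  ChainComplex.of_d (fun i => ModuleCat.of A (F.ι i →₀ A)) (fun i => ModuleCat.ofHom (F.d i)) i

/-- The augmentation of the chain complex of a graded free resolution. -/
noncomputable def complexAug : F.complex.X 0 ⟶ ModuleCat.of A I :=
  ModuleCat.ofHom F.aug

theorem complex_d_comp_aug : F.complex.d 1 0 ≫ F.complexAug = 0 := by
  rw [complex_d]
  ext1
  exact F.exact_zero.linearMap_comp_eq_zero

instance (i : ℕ) : Projective (F.complex.X i) :=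
  inferInstanceAs (Projective (ModuleCat.of A (F.ι i →₀ A)))

theorem complex_exactAt_succ (n : ℕ) : F.complex.ExactAt (n + 1) := by
  rw [HomologicalComplex.exactAt_iff' _ (n + 1 + 1) (n + 1) n (by simp) (by simp)]
  rw [ShortComplex.moduleCat_exact_iff]
  intro x hx
  change F.complex.d (n + 1) n x = 0 at hx
  change ∃ y, F.complex.d (n + 2) (n + 1) y = x
  rw [complex_d] at hx
  rw [complex_d]
  exact (F.exact_succ n x).1 hx

/-- A graded free resolution as a projective resolution. -/
noncomputable def projectiveResolution : ProjectiveResolution (ModuleCat.of A I) where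
  complex := F.complex
  π := (ChainComplex.toSingle₀Equiv _ _).symm ⟨F.complexAug, F.complex_d_comp_aug⟩
  quasiIso := ⟨fun n => by
    cases n with
    | zero =>
      rw [ChainComplex.quasiIsoAt₀_iff, ShortComplex.quasiIso_iff_of_zeros']
      · refine (ShortComplex.exact_and_epi_g_iff_of_iso
          (S₂ := ShortComplex.mk (F.complex.d 1 0) F.complexAug F.complex_d_comp_aug) ?_).2 ⟨?_, ?_⟩
        · exact ShortComplex.isoMk (Iso.refl _) (Iso.refl _) (Iso.refl _)
            ((Category.id_comp _).trans (Category.comp_id _).symm)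
            ((Category.id_comp _).trans (Category.comp_id _).symm)
        · rw [ShortComplex.moduleCat_exact_iff]
          intro x hx
          change ∃ y, F.complex.d 1 0 y = x
          rw [complex_d]
          exact (F.exact_zero x).1 hx
        · exact (ModuleCat.epi_iff_surjective _).2 F.aug_surjective
      all_goals rfl
    | succ n =>
      rw [quasiIsoAt_iff_exactAt']
      · exact F.complex_exactAt_succ n
      · exact ChainComplex.exactAt_succ_single_obj _ _⟩

variable {F} {J : Ideal A} {G : GradedFreeResolution 𝒜 (idealGrading 𝒜 J)}
  {φ : ∀ i, (F.ι i →₀ A) →ₗ[A] (G.ι i →₀ A)}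

/-- The morphism of complexes given by a chain map. -/
noncomputable def IsChainMap.hom (hφ : F.IsChainMap G φ) : F.complex ⟶ G.complex :=
  ChainComplex.ofHom (fun i => ModuleCat.ofHom (φ i)) fun i => by
    rw [complex_d, complex_d]
    ext1
    exact LinearMap.ext (hφ.comm i)

theorem quotient_tensor_eq_zero_iff {m : Ideal A} {M N : Type v} [AddCommGroup M] [Module A M]
    [AddCommGroup N] [Module A N] (f : M →ₗ[A] N) :
    f.lTensor (A ⧸ m) = 0 ↔ ∀ x, f x ∈ m • (⊤ : Submodule A N) := by
  constructor
  · intro h x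
    have h1 := LinearMap.congr_fun h (1 ⊗ₜ x)
    rw [LinearMap.lTensor_tmul, LinearMap.zero_apply] at h1
    have h2 := congrArg (TensorProduct.quotTensorEquivQuotSMul N m) h1
    rw [TensorProduct.quotTensorEquivQuotSMul_mk_one_tmul, map_zero,
      Submodule.Quotient.mk_eq_zero] at h2
    exact h2
  · intro h
    refine TensorProduct.ext' fun a x => ?_
    obtain ⟨a, rfl⟩ := Ideal.Quotient.mk_surjective a
    rw [LinearMap.lTensor_tmul, LinearMap.zero_apply,
      ← (TensorProduct.quotTensorEquivQuotSMul N m).map_eq_zero_iff,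
      TensorProduct.quotTensorEquivQuotSMul_mk_tmul, Submodule.Quotient.mk_eq_zero]
    exact Submodule.smul_mem _ _ (h x)

theorem map_tensoringLeft_eq_zero_iff {m : Ideal A} {M N : ModuleCat.{v} A} (f : M ⟶ N) :
    ((MonoidalCategory.tensoringLeft (ModuleCat.{v} A)).obj (ModuleCat.of A (A ⧸ m))).map f = 0 ↔
      ∀ x, f.hom x ∈ m • (⊤ : Submodule A N) := by
  rw [← quotient_tensor_eq_zero_iff]
  constructor
  · exact fun h => congrArg ModuleCat.Hom.hom h
  · exact fun h => ModuleCat.hom_ext h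

theorem complex_d_eq_zero {i j : ℕ} (h : i ≠ j + 1) : F.complex.d i j = 0 :=
  F.complex.shape i j fun h' => h h'.symm

/-- A chain map between minimal resolutions which induces zero on `Tor` has entries in the
maximal ideal. -/
theorem IsMinimal.chainMap_mem_smul_top (hF : F.IsMinimal) (hG : G.IsMinimal)
    (hφ : F.IsChainMap G φ) (hIJ : I ≤ J) (i : ℕ)
    (h : ((Tor (ModuleCat.{v} A) i).obj (ModuleCat.of A (A ⧸ gradedMaximalIdeal 𝒜))).map
      (ModuleCat.ofHom (Submodule.inclusion hIJ)) = 0) (x : F.ι i →₀ A) :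
    φ i x ∈ gradedMaximalIdeal 𝒜 • (⊤ : Submodule A (G.ι i →₀ A)) := by
  let T := (MonoidalCategory.tensoringLeft (ModuleCat.{v} A)).obj
    (ModuleCat.of A (A ⧸ gradedMaximalIdeal 𝒜))
  -- Minimality says that the complexes `A ⧸ 𝔪 ⊗ F` have zero differentials, so their terms are
  -- their Tor modules.
  have hzero : ∀ {I : Ideal A} {F : GradedFreeResolution 𝒜 (idealGrading 𝒜 I)}, F.IsMinimal →
      ∀ i j, ((T.mapHomologicalComplex _).obj F.complex).d i j = 0 := by
    intro I F hF i j
    change T.map (F.complex.d i j) = 0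
    by_cases hij : i = j + 1
    · subst hij
      rw [complex_d]
      exact (map_tensoringLeft_eq_zero_iff _).2 (hF j)
    · rw [complex_d_eq_zero hij, Functor.map_zero]
  have hcomm : hφ.hom.f 0 ≫ G.projectiveResolution.π.f 0 = F.projectiveResolution.π.f 0 ≫
      ModuleCat.ofHom (Submodule.inclusion hIJ) := by
    change hφ.hom.f 0 ≫ ((ChainComplex.toSingle₀Equiv _ _).symm _).f 0 =
      ((ChainComplex.toSingle₀Equiv _ _).symm _).f 0 ≫ _
    rw [ChainComplex.toSingle₀Equiv_symm_apply_f_zero,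
      ChainComplex.toSingle₀Equiv_symm_apply_f_zero]
    ext1
    exact LinearMap.ext fun x => Subtype.ext (hφ.aug x)
  have h1 := ProjectiveResolution.isoLeftDerivedObj_hom_naturality _ F.projectiveResolution
    G.projectiveResolution hφ.hom hcomm T i
  have h2 : (T.leftDerived i).map (ModuleCat.ofHom (Submodule.inclusion hIJ)) = 0 := h
  rw [h2, Limits.zero_comp, eq_comm, ← Limits.comp_zero, cancel_epi] at h1
  have h3 := homologicalComplex_hom_f_eq_zero ((T.mapHomologicalComplex _).map hφ.hom)
    (hzero hF) (hzero hG) i h1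
  exact (map_tensoringLeft_eq_zero_iff (hφ.hom.f i)).1 h3 x

end GradedFreeResolution

end TorMaps

/-! ### The sign automorphism -/

section SignMap

/-- The automorphism of a free module which multiplies `e` by the sign `(-1) ^ hdeg e`. -/
noncomputable def signMap (A : Type v) [CommRing A] {ι : Type*} (hdeg : ι → ℕ) :
    (ι →₀ A) →ₗ[A] (ι →₀ A) :=
  Finsupp.linearCombination A fun e => Finsupp.single e ((-1) ^ hdeg e)

variable {A : Type v} [CommRing A] {ι : Type*} (hdeg : ι → ℕ)

theorem signMap_single (e : ι) (a : A) :
    signMap A hdeg (Finsupp.single e a) = (-1 : A) ^ hdeg e • Finsupp.single e a := by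
  simp [signMap, mul_comm]

theorem signMap_apply (x : ι →₀ A) (e : ι) : signMap A hdeg x e = (-1) ^ hdeg e * x e := by
  classical
  induction x using Finsupp.induction_linear with
  | zero => simp
  | add x y hx hy => rw [map_add, Finsupp.add_apply, hx, hy, Finsupp.add_apply, mul_add]
  | single f a =>
    rw [signMap_single, Finsupp.smul_apply, Finsupp.single_apply]
    split_ifs with h
    · rw [h, smul_eq_mul]
    · simp

end SignMap

/-! ### Minimal resolutions as one free module with a differential -/

section Total

variable {k : Type u} [Field k] {A : Type v} [CommRing A] [Algebra k A]

/-- A minimal graded free resolution of an ideal, written as a single free module with a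
differential. The basis element `e` sits in homological degree `hdeg e` and in internal
degree `deg e`. -/
structure TotalResolution (𝒜 : ℕ → Submodule k A) (K : Ideal A) where
  ι : Type v
  hdeg : ι → ℕ
  deg : ι → ℕ
  d : (ι →₀ A) →ₗ[A] (ι →₀ A)
  aug : (ι →₀ A) →ₗ[A] A
  d_mem : ∀ e, d (Finsupp.single e 1) ∈ freeGrading 𝒜 deg (deg e)
  d_minimal : ∀ e e', d (Finsupp.single e 1) e' ∈ gradedMaximalIdeal 𝒜
  d_hdeg : ∀ e e', d (Finsupp.single e 1) e' ≠ 0 → hdeg e = hdeg e' + 1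
  aug_mem : ∀ e, aug (Finsupp.single e 1) ∈ 𝒜 (deg e)
  aug_hdeg : ∀ e, aug (Finsupp.single e 1) ≠ 0 → hdeg e = 0
  d_d : ∀ x, d (d x) = 0
  aug_d : ∀ x, aug (d x) = 0
  exact : ∀ x, d x = 0 → aug x = 0 → ∃ y, d y = x
  aug_mem_ideal : ∀ x, aug x ∈ K
  exists_cycle : ∀ c ∈ K, ∃ z, d z = 0 ∧ aug z = c

namespace TotalResolution

variable {𝒜 : ℕ → Submodule k A}

section Pieces

variable {K : Ideal A} (X : TotalResolution 𝒜 K)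

/-- The pairs (homological degree, internal degree) of the basis elements. -/
def shape : Set (ℕ × ℕ) := Set.range fun e => (X.hdeg e, X.deg e)

/-- The inclusion of the part of homological degree `i`. -/
noncomputable def embed (i : ℕ) : ({e // X.hdeg e = i} →₀ A) →ₗ[A] (X.ι →₀ A) :=
  Finsupp.lmapDomain A A Subtype.val

/-- The projection to the part of homological degree `i`. -/
noncomputable def restrict (i : ℕ) : (X.ι →₀ A) →ₗ[A] ({e // X.hdeg e = i} →₀ A) :=
  Finsupp.lsubtypeDomain {e | X.hdeg e = i}

@[simp]
theorem restrict_apply (i : ℕ) (x : X.ι →₀ A) (e : {e // X.hdeg e = i}) :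
    X.restrict i x e = x e := rfl

@[simp]
theorem embed_single (i : ℕ) (e : {e // X.hdeg e = i}) (a : A) :
    X.embed i (Finsupp.single e a) = Finsupp.single e.1 a :=
  Finsupp.mapDomain_single

theorem embed_apply (i : ℕ) (x : {e // X.hdeg e = i} →₀ A) (e : {e // X.hdeg e = i}) :
    X.embed i x e = x e :=
  Finsupp.mapDomain_apply Subtype.val_injective _ _

@[simp]
theorem restrict_embed (i : ℕ) (x : {e // X.hdeg e = i} →₀ A) : X.restrict i (X.embed i x) = x := by
  ext e
  exact X.embed_apply i x e

theorem embed_restrict {i : ℕ} {x : X.ι →₀ A} (h : ∀ e, x e ≠ 0 → X.hdeg e = i) :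
    X.embed i (X.restrict i x) = x := by
  ext e
  by_cases he : X.hdeg e = i
  · exact X.embed_apply i _ ⟨e, he⟩
  · rw [not_imp_comm.1 (h e) he]
    exact Finsupp.mapDomain_of_notMem_range _ _ fun ⟨e', h'⟩ => he (h' ▸ e'.2)

/-- The differential in a fixed homological degree. -/
noncomputable def gradedD (i : ℕ) :
    ({e // X.hdeg e = i + 1} →₀ A) →ₗ[A] ({e // X.hdeg e = i} →₀ A) :=
  X.restrict i ∘ₗ X.d ∘ₗ X.embed (i + 1)

theorem d_embed_succ (i : ℕ) (x : {e // X.hdeg e = i + 1} →₀ A) :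
    X.d (X.embed (i + 1) x) = X.embed i (X.gradedD i x) := by
  rw [← LinearMap.comp_apply, ← LinearMap.comp_apply]
  congr 1
  ext1 e
  ext1
  simp only [LinearMap.comp_apply, Finsupp.lsingle_apply, gradedD, embed_single]
  rw [embed_restrict]
  intro e' he'
  have := X.d_hdeg e.1 e' he'
  have := e.2
  omega

theorem d_embed_zero (x : {e // X.hdeg e = 0} →₀ A) : X.d (X.embed 0 x) = 0 := by
  rw [← LinearMap.comp_apply, show X.d ∘ₗ X.embed 0 = 0 from ?_, LinearMap.zero_apply]
  ext1 e
  ext1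
  simp only [LinearMap.comp_apply, Finsupp.lsingle_apply, embed_single, LinearMap.zero_apply]
  ext e'
  by_contra h
  have := X.d_hdeg e.1 e' h
  have := e.2
  omega

theorem aug_embed_succ (i : ℕ) (x : {e // X.hdeg e = i + 1} →₀ A) :
    X.aug (X.embed (i + 1) x) = 0 := by
  rw [← LinearMap.comp_apply, show X.aug ∘ₗ X.embed (i + 1) = 0 from ?_, LinearMap.zero_apply]
  ext1 e
  ext1
  simp only [LinearMap.comp_apply, Finsupp.lsingle_apply, embed_single, LinearMap.zero_apply]
  by_contra h
  have := X.aug_hdeg e.1 h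
  have := e.2
  omega

/-- A preimage supplied by exactness of the total module may mix homological degrees; this identity
lets it be projected to the right one. -/
theorem restrict_d (i : ℕ) (x : X.ι →₀ A) :
    X.restrict i (X.d x) = X.gradedD i (X.restrict (i + 1) x) := by
  rw [← LinearMap.comp_apply, ← LinearMap.comp_apply]
  congr 1
  ext1 e
  ext1
  simp only [LinearMap.comp_apply, Finsupp.lsingle_apply, gradedD]
  by_cases he : X.hdeg e = i + 1
  · rw [embed_restrict]
    intro e' he'
    by_contra hne
    exact he' (Finsupp.single_eq_of_ne fun h => hne (h ▸ he))
  · have h1 : X.restrict (i + 1) (Finsupp.single e 1) = 0 := by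
      ext e'
      exact Finsupp.single_eq_of_ne fun h => he (h ▸ e'.2)
    rw [h1, map_zero, map_zero, map_zero]
    ext e'
    by_contra h
    have := X.d_hdeg e e' h
    have := e'.2
    omega

theorem aug_embed_restrict (x : X.ι →₀ A) : X.aug (X.embed 0 (X.restrict 0 x)) = X.aug x := by
  rw [← LinearMap.comp_apply, ← LinearMap.comp_apply]
  congr 1
  ext1 e
  ext1
  simp only [LinearMap.comp_apply, Finsupp.lsingle_apply]
  by_cases he : X.hdeg e = 0
  · rw [embed_restrict]
    intro e' he'
    by_contra hne
    exact he' (Finsupp.single_eq_of_ne fun h => hne (h ▸ he))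
  · have h1 : X.restrict 0 (Finsupp.single e 1) = 0 := by
      ext e'
      exact Finsupp.single_eq_of_ne fun h => he (h ▸ e'.2)
    rw [h1, map_zero, map_zero]
    by_contra h
    exact he (X.aug_hdeg e fun h' => h h'.symm)

/-- The underlying graded free resolution. -/
noncomputable def toGraded : GradedFreeResolution 𝒜 (idealGrading 𝒜 K) where
  ι i := {e // X.hdeg e = i}
  deg _ e := X.deg e.1
  d := X.gradedD
  aug := (X.aug ∘ₗ X.embed 0).codRestrict K fun _ => X.aug_mem_ideal _
  d_homogeneous i e := by
    rw [mem_freeGrading_iff]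
    intro e'
    have := mem_freeGrading_iff.1 (X.d_mem e.1) e'.1
    simpa [gradedD] using this
  aug_homogeneous e := by
    change X.aug (X.embed 0 (Finsupp.single e 1)) ∈ 𝒜 (X.deg e.1)
    rw [embed_single]
    exact X.aug_mem e.1
  exact_succ i x := by
    constructor
    · intro hx
      obtain ⟨y, hy⟩ := X.exact (X.embed (i + 1) x) (by rw [d_embed_succ, hx, map_zero])
        (X.aug_embed_succ i x)
      exact ⟨X.restrict (i + 2) y, by rw [← restrict_d, hy, restrict_embed]⟩
    · rintro ⟨y, rfl⟩
      rw [← X.restrict_embed i (X.gradedD i _), ← d_embed_succ, ← d_embed_succ, X.d_d, map_zero]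
  exact_zero x := by
    constructor
    · intro hx
      obtain ⟨y, hy⟩ := X.exact (X.embed 0 x) (X.d_embed_zero x) (congrArg Subtype.val hx)
      exact ⟨X.restrict 1 y, by rw [← restrict_d, hy, restrict_embed]⟩
    · rintro ⟨y, rfl⟩
      refine Subtype.ext ?_
      change X.aug (X.embed 0 _) = 0
      rw [← d_embed_succ, X.aug_d]
  aug_surjective := by
    rintro ⟨c, hc⟩
    obtain ⟨z, -, hz⟩ := X.exists_cycle c hc
    exact ⟨X.restrict 0 z, Subtype.ext ((X.aug_embed_restrict z).trans hz)⟩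

theorem apply_mem_of_single_mem {ι κ : Type*} {m : Ideal A} (f : (ι →₀ A) →ₗ[A] (κ →₀ A))
    (h : ∀ e e', f (Finsupp.single e 1) e' ∈ m) (x : ι →₀ A) (e' : κ) : f x e' ∈ m := by
  induction x using Finsupp.induction_linear with
  | zero => simp
  | add x y hx hy => rw [map_add]; exact m.add_mem hx hy
  | single e a =>
    have : Finsupp.single e a = a • Finsupp.single e (1 : A) := by simp
    rw [this, map_smul]
    exact m.mul_mem_left _ (h e e')

theorem toGraded_isMinimal : X.toGraded.IsMinimal := fun i x => by
  rw [mem_ideal_smul_finsupp_top]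
  exact fun e => apply_mem_of_single_mem X.d X.d_minimal _ _

end Pieces

/-- Maps of resolutions lifting an inclusion of ideals. -/
structure IsHom {K L : Ideal A} (X : TotalResolution 𝒜 K) (Y : TotalResolution 𝒜 L)
    (φ : (X.ι →₀ A) →ₗ[A] (Y.ι →₀ A)) : Prop where
  mem : ∀ e, φ (Finsupp.single e 1) ∈ freeGrading 𝒜 Y.deg (X.deg e)
  hdeg : ∀ e e', φ (Finsupp.single e 1) e' ≠ 0 → X.hdeg e = Y.hdeg e'
  comm : ∀ x, Y.d (φ x) = φ (X.d x)
  aug : ∀ x, Y.aug (φ x) = X.aug x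

theorem IsHom.comp [GradedAlgebra 𝒜] {K L M : Ideal A} {X : TotalResolution 𝒜 K}
    {Y : TotalResolution 𝒜 L} {Z : TotalResolution 𝒜 M} {φ : (X.ι →₀ A) →ₗ[A] (Y.ι →₀ A)}
    {ψ : (Y.ι →₀ A) →ₗ[A] (Z.ι →₀ A)} (hψ : Y.IsHom Z ψ) (hφ : X.IsHom Y φ) :
    X.IsHom Z (ψ ∘ₗ φ) where
  mem e := map_mem_of_mem_freeGrading hψ.mem (hφ.mem e)
  hdeg e e' h := by
    by_contra hne
    refine h ?_
    change ψ (φ (Finsupp.single e 1)) e' = 0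
    rw [← Finsupp.sum_single (φ (Finsupp.single e 1)), Finsupp.sum, map_sum,
      Finsupp.finsetSum_apply]
    refine Finset.sum_eq_zero fun f hf => ?_
    have : Finsupp.single f (φ (Finsupp.single e 1) f) =
      φ (Finsupp.single e 1) f • Finsupp.single f (1 : A) := by simp
    rw [this, map_smul, Finsupp.smul_apply]
    by_contra h'
    have h1 := hφ.hdeg e f (Finsupp.mem_support_iff.1 hf)
    have h2 := hψ.hdeg f e' fun h0 => h' (by rw [h0, smul_zero])
    exact hne (h1.trans h2)
  comm x := by simp [hψ.comm, hφ.comm]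
  aug x := by simp [hψ.aug, hφ.aug]

section Sign

variable {K : Ideal A} (X : TotalResolution 𝒜 K)

/-- The automorphism with the sign of the homological degree. -/
noncomputable abbrev sign : (X.ι →₀ A) →ₗ[A] (X.ι →₀ A) := signMap A X.hdeg

/-- The differential lowers homological degree by one, so it changes the sign. This anticommutation
makes the tensor differential square to zero. -/
theorem sign_d (x : X.ι →₀ A) : X.sign (X.d x) = -X.d (X.sign x) := by
  induction x using Finsupp.induction_linear with
  | zero => simp
  | add x y hx hy => rw [map_add, map_add, hx, hy, map_add, map_add]; abel
  | single e a =>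
    have : Finsupp.single e a = a • Finsupp.single e (1 : A) := by simp
    rw [this]
    simp only [map_smul, signMap_single]
    rw [← smul_neg]
    congr 1
    ext f
    rw [signMap_apply, Finsupp.neg_apply, Finsupp.smul_apply, smul_eq_mul]
    by_cases h : X.d (Finsupp.single e 1) f = 0
    · rw [h]; simp
    · rw [X.d_hdeg e f h, pow_succ]
      ring

theorem aug_sign (x : X.ι →₀ A) : X.aug (X.sign x) = X.aug x := by
  induction x using Finsupp.induction_linear with
  | zero => simp
  | add x y hx hy => rw [map_add, map_add, hx, hy, map_add]
  | single e a =>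
    have : Finsupp.single e a = a • Finsupp.single e (1 : A) := by simp
    rw [this]
    simp only [map_smul, signMap_single]
    by_cases h : X.aug (Finsupp.single e 1) = 0
    · rw [h]; simp
    · rw [X.aug_hdeg e h]; simp

/-- A `k`-linear contraction of a resolution. -/
structure Contraction where
  h : (X.ι →₀ A) →ₗ[k] (X.ι →₀ A)
  η : A →ₗ[k] (X.ι →₀ A)
  homotopy : ∀ x, X.d (h x) + h (X.d x) = x - η (X.aug x)
  sign_h : ∀ x, X.sign (h x) = -h (X.sign x)
  d_η : ∀ a, X.d (η a) = 0
  sign_η : ∀ a, X.sign (η a) = η a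

end Sign

end TotalResolution

end Total

/-! ### Linear splittings over the field -/

section GeneralizedInverse

/-- Over a field the image of `f` is a direct summand, and `f` has a linear section over it; `g` is
the projection followed by the section. -/
theorem exists_generalizedInverse {k : Type*} [Field k] {V W : Type*} [AddCommGroup V] [Module k V]
    [AddCommGroup W] [Module k W] (f : V →ₗ[k] W) :
    ∃ g : W →ₗ[k] V, ∀ x, f (g (f x)) = f x := by
  obtain ⟨s, hs⟩ := f.rangeRestrict.exists_rightInverse_of_surjective f.range_rangeRestrict
  obtain ⟨p, hp⟩ := (LinearMap.range f).subtype.exists_leftInverse_of_injective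
    (LinearMap.range f).ker_subtype
  refine ⟨s ∘ₗ p, fun x => ?_⟩
  have h1 : p (f x) = ⟨f x, x, rfl⟩ := LinearMap.congr_fun hp ⟨f x, x, rfl⟩
  have h2 := congrArg Subtype.val (LinearMap.congr_fun hs ⟨f x, x, rfl⟩)
  rw [LinearMap.comp_apply, h1]
  exact h2

end GeneralizedInverse

/-! ### From graded resolutions to total resolutions with contractions -/

section ToTotal

variable {k : Type u} [Field k] {A : Type v} [CommRing A] [Algebra k A]
  {𝒜 : ℕ → Submodule k A}

namespace GradedFreeResolution

section

variable {K : Ideal A} (F : GradedFreeResolution 𝒜 (idealGrading 𝒜 K))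

/-- The inclusion of a term of the resolution into the sum of all terms. -/
noncomputable def incl (i : ℕ) : (F.ι i →₀ A) →ₗ[A] ((Σ i, F.ι i) →₀ A) :=
  Finsupp.lmapDomain A A (Sigma.mk i)

@[simp]
theorem incl_single (i : ℕ) (e : F.ι i) (a : A) :
    F.incl i (Finsupp.single e a) = Finsupp.single ⟨i, e⟩ a :=
  Finsupp.mapDomain_single

theorem incl_apply (i : ℕ) (x : F.ι i →₀ A) (e : F.ι i) : F.incl i x ⟨i, e⟩ = x e :=
  Finsupp.mapDomain_apply sigma_mk_injective _ _

theorem incl_apply_ne {i j : ℕ} (h : j ≠ i) (x : F.ι i →₀ A) (e : F.ι j) : F.incl i x ⟨j, e⟩ = 0 :=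
  Finsupp.mapDomain_of_notMem_range _ _ fun ⟨_, h'⟩ => h (congrArg Sigma.fst h').symm

theorem total_induction {p : ((Σ i, F.ι i) →₀ A) → Prop} (add : ∀ x y, p x → p y → p (x + y))
    (incl : ∀ i x, p (F.incl i x)) (x : (Σ i, F.ι i) →₀ A) : p x := by
  induction x using Finsupp.induction_linear with
  | zero => simpa using incl 0 0
  | add x y hx hy => exact add x y hx hy
  | single e a => simpa using incl e.1 (Finsupp.single e.2 a)

/-- The linear map on the sum of all terms which is given on each term. -/
noncomputable def totalLift (B : Type*) [Semiring B] [Module B A] {N : Type*} [AddCommGroup N]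
    [Module B N] (f : ∀ i, (F.ι i →₀ A) →ₗ[B] N) : ((Σ i, F.ι i) →₀ A) →ₗ[B] N :=
  Finsupp.lsum ℕ fun e => f e.1 ∘ₗ Finsupp.lsingle e.2

@[simp]
theorem totalLift_incl (B : Type*) [Semiring B] [Module B A] {N : Type*} [AddCommGroup N]
    [Module B N] (f : ∀ i, (F.ι i →₀ A) →ₗ[B] N) (i : ℕ) (x : F.ι i →₀ A) :
    F.totalLift B f (F.incl i x) = f i x := by
  induction x using Finsupp.induction_linear with
  | zero => simp
  | add x y hx hy => rw [map_add, map_add, hx, hy, map_add]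
  | single e a => simp [totalLift]

theorem totalLift_single (B : Type*) [Semiring B] [Module B A] {N : Type*} [AddCommGroup N]
    [Module B N] (f : ∀ i, (F.ι i →₀ A) →ₗ[B] N) (e : Σ i, F.ι i) (a : A) :
    F.totalLift B f (Finsupp.single e a) = f e.1 (Finsupp.single e.2 a) := by
  simp [totalLift]

/-- The differential on the sum of all terms. -/
noncomputable def totalD : ((Σ i, F.ι i) →₀ A) →ₗ[A] ((Σ i, F.ι i) →₀ A) :=
  F.totalLift A fun
    | 0 => 0
    | i + 1 => F.incl i ∘ₗ F.d i

/-- The augmentation on the sum of all terms. -/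
noncomputable def totalAug : ((Σ i, F.ι i) →₀ A) →ₗ[A] A :=
  F.totalLift A fun
    | 0 => K.subtype ∘ₗ F.aug
    | _ + 1 => 0

@[simp]
theorem totalD_incl_zero (x : F.ι 0 →₀ A) : F.totalD (F.incl 0 x) = 0 := by
  simp [totalD]

@[simp]
theorem totalD_incl_succ (i : ℕ) (x : F.ι (i + 1) →₀ A) :
    F.totalD (F.incl (i + 1) x) = F.incl i (F.d i x) := by
  simp [totalD]

@[simp]
theorem totalAug_incl_zero (x : F.ι 0 →₀ A) : F.totalAug (F.incl 0 x) = F.aug x := by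
  simp [totalAug]

@[simp]
theorem totalAug_incl_succ (i : ℕ) (x : F.ι (i + 1) →₀ A) : F.totalAug (F.incl (i + 1) x) = 0 := by
  simp [totalAug]

theorem incl_mem_freeGrading {i j : ℕ} {x : F.ι i →₀ A} (hx : x ∈ freeGrading 𝒜 (F.deg i) j) :
    F.incl i x ∈ freeGrading 𝒜 (fun e : Σ i, F.ι i => F.deg e.1 e.2) j := by
  rw [mem_freeGrading_iff] at hx ⊢
  rintro ⟨i', e⟩
  by_cases h : i' = i
  · subst h
    rw [incl_apply]
    exact hx e
  · rw [incl_apply_ne _ h]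
    exact zero_mem _

theorem incl_mem {m : Ideal A} {i : ℕ} {x : F.ι i →₀ A} (hx : x ∈ m • (⊤ : Submodule A (F.ι i →₀ A)))
    (e) : F.incl i x e ∈ m :=
  mem_ideal_smul_finsupp_top.1 (map_mem_smul_top (F.incl i) hx) e

theorem eq_of_incl_apply_ne_zero {i : ℕ} {x : F.ι i →₀ A} {e : Σ i, F.ι i} (h : F.incl i x e ≠ 0) :
    e.1 = i := by
  by_contra hne
  exact h (F.incl_apply_ne hne x e.2)

/-- There is a `k`-linear contraction of every graded free resolution. -/
theorem exists_contraction : ∃ (h : ∀ i, (F.ι i →₀ A) →ₗ[k] (F.ι (i + 1) →₀ A))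
    (η : A →ₗ[k] (F.ι 0 →₀ A)), (∀ x, F.d 0 (h 0 x) = x - η (F.aug x)) ∧
      ∀ i x, F.d (i + 1) (h (i + 1) x) + h i (F.d i x) = x := by
  choose s hs using fun i => exists_generalizedInverse ((F.d i).restrictScalars k)
  obtain ⟨η, hη⟩ := exists_generalizedInverse ((K.subtype ∘ₗ F.aug).restrictScalars k)
  simp only [LinearMap.coe_restrictScalars] at hs
  have hη' : ∀ x, F.aug (η (F.aug x)) = F.aug x := fun x => Subtype.ext (hη x)
  -- With `s` inverting `d` on its image, `x - s (d x)` is a cycle, hence a boundary, on which the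
  -- next `s` is a right inverse of `d`. Subtracting the correction before applying `s` gives the
  -- homotopy; in degree zero `η ∘ aug` plays the role of `s ∘ d`.
  refine ⟨fun
    | 0 => s 0 ∘ₗ (LinearMap.id - η ∘ₗ (K.subtype ∘ₗ F.aug).restrictScalars k)
    | i + 1 => s (i + 1) ∘ₗ (LinearMap.id - s i ∘ₗ (F.d i).restrictScalars k), η, ?_, ?_⟩
  · intro x
    obtain ⟨y, hy⟩ := (F.exact_zero (x - η (F.aug x))).1 (by rw [map_sub, hη', sub_self])
    simp only [LinearMap.comp_apply, LinearMap.sub_apply, LinearMap.id_apply,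
      LinearMap.coe_restrictScalars, Submodule.subtype_apply]
    rw [← hy, hs]
  · intro i x
    obtain ⟨y, hy⟩ := (F.exact_succ i (x - s i (F.d i x))).1 (by rw [map_sub, hs, sub_self])
    simp only [LinearMap.comp_apply, LinearMap.sub_apply, LinearMap.id_apply,
      LinearMap.coe_restrictScalars]
    rw [← hy, hs, hy]
    -- On the boundary `d x` the correction term vanishes because the composite of consecutive maps
    -- is zero, so the homotopy takes `d x` to `s (d x)`.
    cases i with
    | zero => simp [F.exact_zero.apply_apply_eq_zero]
    | succ i => simp [(F.exact_succ i).apply_apply_eq_zero]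

theorem totalD_totalD (x : (Σ i, F.ι i) →₀ A) : F.totalD (F.totalD x) = 0 := by
  induction x using F.total_induction with
  | add x y hx hy => simp [hx, hy]
  | incl i x =>
    rcases i with - | - | i
    · simp
    · simp
    · simp [(F.exact_succ i).apply_apply_eq_zero]

theorem totalAug_totalD (x : (Σ i, F.ι i) →₀ A) : F.totalAug (F.totalD x) = 0 := by
  induction x using F.total_induction with
  | add x y hx hy => simp [hx, hy]
  | incl i x =>
    rcases i with - | - | i
    · simp
    · simp [F.exact_zero.apply_apply_eq_zero]
    · simp

theorem signMap_incl (i : ℕ) (x : F.ι i →₀ A) :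
    signMap A (fun e : Σ i, F.ι i => e.1) (F.incl i x) = (-1 : A) ^ i • F.incl i x := by
  induction x using Finsupp.induction_linear with
  | zero => simp
  | add x y hx hy => rw [map_add, map_add, hx, hy, smul_add]
  | single e a => rw [incl_single, signMap_single]

theorem exists_totalContraction :
    ∃ (h : ((Σ i, F.ι i) →₀ A) →ₗ[k] ((Σ i, F.ι i) →₀ A)) (η : A →ₗ[k] ((Σ i, F.ι i) →₀ A)),
      (∀ x, F.totalD (h x) + h (F.totalD x) = x - η (F.totalAug x)) ∧
      (∀ x, signMap A (fun e : Σ i, F.ι i => e.1) (h x) =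
        -h (signMap A (fun e : Σ i, F.ι i => e.1) x)) ∧
      (∀ a, F.totalD (η a) = 0) ∧
      (∀ a, signMap A (fun e : Σ i, F.ι i => e.1) (η a) = η a) := by
  obtain ⟨h, η, h0, h1⟩ := F.exists_contraction
  refine ⟨F.totalLift k fun i => (F.incl (i + 1)).restrictScalars k ∘ₗ h i,
    (F.incl 0).restrictScalars k ∘ₗ η, fun x => ?_, fun x => ?_, fun a => by simp,
    fun a => by simp [signMap_incl]⟩
  · induction x using F.total_induction with
    | add x y hx hy =>
      simp only [map_add]
      rw [add_add_add_comm, hx, hy]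
      abel
    | incl i x =>
      cases i with
      | zero => simp [h0]
      | succ i =>
        simp only [totalLift_incl, LinearMap.comp_apply, LinearMap.coe_restrictScalars,
          totalD_incl_succ, totalAug_incl_succ, map_zero, sub_zero]
        rw [← map_add, h1]
  · induction x using F.total_induction with
    | add x y hx hy => simp only [map_add, hx, hy, neg_add]
    | incl i x =>
      rw [signMap_incl, ← map_smul, totalLift_incl, totalLift_incl]
      simp only [LinearMap.comp_apply, LinearMap.coe_restrictScalars, signMap_incl]
      rcases neg_one_pow_eq_or A i with h | h <;> simp [h, pow_succ]

variable {F} {L : Ideal A} {G : GradedFreeResolution 𝒜 (idealGrading 𝒜 L)}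

/-- The map of total resolutions given by a chain map. -/
noncomputable def totalMap (φ : ∀ i, (F.ι i →₀ A) →ₗ[A] (G.ι i →₀ A)) :
    ((Σ i, F.ι i) →₀ A) →ₗ[A] ((Σ i, G.ι i) →₀ A) :=
  F.totalLift A fun i => G.incl i ∘ₗ φ i

theorem totalMap_single (φ : ∀ i, (F.ι i →₀ A) →ₗ[A] (G.ι i →₀ A)) (e : Σ i, F.ι i) (a : A) :
    totalMap φ (Finsupp.single e a) = G.incl e.1 (φ e.1 (Finsupp.single e.2 a)) :=
  F.totalLift_single A _ e a

theorem totalMap_mem {m : Ideal A} {φ : ∀ i, (F.ι i →₀ A) →ₗ[A] (G.ι i →₀ A)}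
    (hφ : ∀ i x, φ i x ∈ m • (⊤ : Submodule A (G.ι i →₀ A))) (e e') :
    totalMap φ (Finsupp.single e 1) e' ∈ m := by
  rw [totalMap_single]
  exact G.incl_mem (hφ _ _) e'

theorem IsChainMap.totalD_totalMap {φ : ∀ i, (F.ι i →₀ A) →ₗ[A] (G.ι i →₀ A)}
    (hφ : F.IsChainMap G φ) (x : (Σ i, F.ι i) →₀ A) :
    G.totalD (totalMap φ x) = totalMap φ (F.totalD x) := by
  induction x using F.total_induction with
  | add x y hx hy => simp only [map_add, hx, hy]
  | incl i x =>
    cases i with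
    | zero => simp [totalMap]
    | succ i => simp [totalMap, hφ.comm]

theorem IsChainMap.totalAug_totalMap {φ : ∀ i, (F.ι i →₀ A) →ₗ[A] (G.ι i →₀ A)}
    (hφ : F.IsChainMap G φ) (x : (Σ i, F.ι i) →₀ A) :
    G.totalAug (totalMap φ x) = F.totalAug x := by
  induction x using F.total_induction with
  | add x y hx hy => simp only [map_add, hx, hy]
  | incl i x =>
    cases i with
    | zero => simp [totalMap, hφ.aug]
    | succ i => simp [totalMap]

end

variable {K L : Ideal A} {F : GradedFreeResolution 𝒜 (idealGrading 𝒜 K)}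
  {G : GradedFreeResolution 𝒜 (idealGrading 𝒜 L)}

/-- The total resolution of a minimal graded free resolution. -/
noncomputable def IsMinimal.toTotal (hF : F.IsMinimal) : TotalResolution 𝒜 K where
  ι := Σ i, F.ι i
  hdeg e := e.1
  deg e := F.deg e.1 e.2
  d := F.totalD
  aug := F.totalAug
  d_mem := by
    rintro ⟨i, e⟩
    rw [← F.incl_single]
    cases i with
    | zero => rw [totalD_incl_zero]; exact zero_mem _
    | succ i =>
      rw [totalD_incl_succ]
      exact F.incl_mem_freeGrading (F.d_homogeneous i e)
  d_minimal := by
    rintro ⟨i, e⟩ e'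
    rw [← F.incl_single]
    cases i with
    | zero => rw [totalD_incl_zero]; exact zero_mem _
    | succ i =>
      rw [totalD_incl_succ]
      exact F.incl_mem (hF i _) e'
  d_hdeg := by
    rintro ⟨i, e⟩ e' h
    rw [← F.incl_single] at h
    cases i with
    | zero => exact absurd (by rw [totalD_incl_zero]; rfl) h
    | succ i =>
      rw [totalD_incl_succ] at h
      rw [F.eq_of_incl_apply_ne_zero h]
  aug_mem := by
    rintro ⟨i, e⟩
    rw [← F.incl_single]
    cases i with
    | zero => rw [totalAug_incl_zero]; exact F.aug_homogeneous e
    | succ i => rw [totalAug_incl_succ]; exact zero_mem _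
  aug_hdeg := by
    rintro ⟨i, e⟩ h
    rw [← F.incl_single] at h
    cases i with
    | zero => rfl
    | succ i => exact absurd (totalAug_incl_succ F i _) h
  d_d := F.totalD_totalD
  aug_d := F.totalAug_totalD
  exact x hx hx' := by
    -- The contraction identity itself shows exactness: a cycle `x` with zero augmentation equals `d
    -- (h x)`.
    obtain ⟨h, η, hh, -⟩ := F.exists_totalContraction
    refine ⟨h x, ?_⟩
    have := hh x
    rwa [hx, hx', map_zero, map_zero, add_zero, sub_zero] at this
  aug_mem_ideal x := by
    induction x using F.total_induction with
    | add x y hx hy => rw [map_add]; exact add_mem hx hy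
    | incl i x =>
      cases i with
      | zero => rw [totalAug_incl_zero]; exact Subtype.mem _
      | succ i => rw [totalAug_incl_succ]; exact zero_mem _
  exists_cycle c hc := by
    obtain ⟨z, hz⟩ := F.aug_surjective ⟨c, hc⟩
    exact ⟨F.incl 0 z, F.totalD_incl_zero z, by rw [totalAug_incl_zero, hz]⟩

theorem IsMinimal.nonempty_contraction (hF : F.IsMinimal) : Nonempty hF.toTotal.Contraction := by
  obtain ⟨h, η, h1, h2, h3, h4⟩ := F.exists_totalContraction
  exact ⟨⟨h, η, h1, h2, h3, h4⟩⟩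

theorem IsChainMap.isHom_totalMap {φ : ∀ i, (F.ι i →₀ A) →ₗ[A] (G.ι i →₀ A)}
    (hφ : F.IsChainMap G φ) (hF : F.IsMinimal) (hG : G.IsMinimal) :
    hF.toTotal.IsHom hG.toTotal (totalMap φ) where
  mem e := (totalMap_single φ e 1).symm ▸ G.incl_mem_freeGrading (hφ.graded e.1 e.2)
  hdeg e e' h := (G.eq_of_incl_apply_ne_zero
    (fun h' => h ((DFunLike.congr_fun (totalMap_single φ e 1) e').trans h'))).symm
  comm := hφ.totalD_totalMap
  aug := hφ.totalAug_totalMap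

end GradedFreeResolution

end ToTotal

/-! ### The total degree grading on `R ⊗ S` -/

section TensorGrading

variable {k : Type u} [Field k] {R : Type v} [CommRing R] [Algebra k R]
  {S : Type w} [CommRing S] [Algebra k S] {𝒜 : ℕ → Submodule k R} {ℬ : ℕ → Submodule k S}

theorem tmul_mem_tensorGrading {p q : ℕ} {a : R} {b : S} (ha : a ∈ 𝒜 p) (hb : b ∈ ℬ q) :
    a ⊗ₜ[k] b ∈ tensorGrading 𝒜 ℬ (p + q) := by
  have h : (p, q) ∈ Finset.HasAntidiagonal.antidiagonal (p + q) :=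
    Finset.HasAntidiagonal.mem_antidiagonal.2 rfl
  exact Submodule.mem_iSup_of_mem (p, q) (Submodule.mem_iSup_of_mem h
    ⟨(⟨a, ha⟩ : 𝒜 p) ⊗ₜ (⟨b, hb⟩ : ℬ q), rfl⟩)

theorem tensorGrading_le {n : ℕ} {P : Submodule k (R ⊗[k] S)}
    (h : ∀ p q, p + q = n → ∀ a ∈ 𝒜 p, ∀ b ∈ ℬ q, a ⊗ₜ b ∈ P) : tensorGrading 𝒜 ℬ n ≤ P := by
  refine iSup₂_le fun p hp => ?_
  rw [Finset.HasAntidiagonal.mem_antidiagonal] at hp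
  rintro _ ⟨z, rfl⟩
  induction z using TensorProduct.induction_on with
  | zero => simp
  | add x y hx hy => rw [map_add]; exact add_mem hx hy
  | tmul a b => exact h p.1 p.2 hp a a.2 b b.2

variable [GradedAlgebra 𝒜] [GradedAlgebra ℬ]

instance tensorGrading.gradedMonoid : SetLike.GradedMonoid (tensorGrading 𝒜 ℬ) where
  one_mem := tmul_mem_tensorGrading (p := 0) (q := 0) SetLike.GradedOne.one_mem
    SetLike.GradedOne.one_mem
  mul_mem {i j x y} hx hy := by
    revert x
    change tensorGrading 𝒜 ℬ i ≤ (tensorGrading 𝒜 ℬ (i + j)).comap (LinearMap.mulRight k y)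
    refine tensorGrading_le fun p q hpq a ha b hb => ?_
    revert y
    change tensorGrading 𝒜 ℬ j ≤
      (tensorGrading 𝒜 ℬ (i + j)).comap (LinearMap.mulLeft k (a ⊗ₜ[k] b))
    refine tensorGrading_le fun p' q' hpq' a' ha' b' hb' => ?_
    rw [Submodule.mem_comap, LinearMap.mulLeft_apply, Algebra.TensorProduct.tmul_mul_tmul,
      ← hpq, ← hpq', add_add_add_comm]
    exact tmul_mem_tensorGrading (SetLike.GradedMul.mul_mem ha ha')
      (SetLike.GradedMul.mul_mem hb hb')

variable (𝒜 ℬ) in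
/-- The map decomposing an element of the tensor product into homogeneous components. -/
noncomputable def tensorDecompose : R ⊗[k] S →ₗ[k] DirectSum ℕ (tensorGrading 𝒜 ℬ ·) :=
  (DirectSum.toModule k (ℕ × ℕ) (DirectSum ℕ (tensorGrading 𝒜 ℬ ·)) (fun p =>
    DirectSum.lof k ℕ (tensorGrading 𝒜 ℬ ·) (p.1 + p.2) ∘ₗ
      (TensorProduct.map (𝒜 p.1).subtype (ℬ p.2).subtype).codRestrict
        (tensorGrading 𝒜 ℬ (p.1 + p.2)) fun z => by
          induction z using TensorProduct.induction_on with
          | zero => simp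
          | add x y hx hy => rw [map_add]; exact add_mem hx hy
          | tmul a b => exact tmul_mem_tensorGrading a.2 b.2)) ∘ₗ
    (TensorProduct.directSum k k (𝒜 ·) (ℬ ·)).toLinearMap ∘ₗ
      TensorProduct.map (DirectSum.decomposeLinearEquiv 𝒜).toLinearMap
        (DirectSum.decomposeLinearEquiv ℬ).toLinearMap

theorem tensorDecompose_tmul {p q : ℕ} {a : R} {b : S} (ha : a ∈ 𝒜 p) (hb : b ∈ ℬ q) :
    tensorDecompose 𝒜 ℬ (a ⊗ₜ b) = DirectSum.lof k ℕ (tensorGrading 𝒜 ℬ ·) (p + q)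
      ⟨a ⊗ₜ b, tmul_mem_tensorGrading ha hb⟩ := by
  simp only [tensorDecompose, LinearMap.comp_apply, TensorProduct.map_tmul, LinearEquiv.coe_coe,
    DirectSum.decomposeLinearEquiv_apply]
  rw [DirectSum.decompose_of_mem 𝒜 ha, DirectSum.decompose_of_mem ℬ hb, ← DirectSum.lof_eq_of k,
    ← DirectSum.lof_eq_of k, TensorProduct.directSum_lof_tmul_lof, DirectSum.toModule_lof]
  rfl

theorem tensorDecompose_of_mem {n : ℕ} {z : R ⊗[k] S} (hz : z ∈ tensorGrading 𝒜 ℬ n) :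
    tensorDecompose 𝒜 ℬ z = DirectSum.lof k ℕ (tensorGrading 𝒜 ℬ ·) n ⟨z, hz⟩ := by
  -- The equalizer of the two maps is pushed forward to a subspace of `R ⊗ S`, so that equality can
  -- be checked on homogeneous pure tensors alone.
  have h : tensorGrading 𝒜 ℬ n ≤ Submodule.map (tensorGrading 𝒜 ℬ n).subtype
      (LinearMap.eqLocus (tensorDecompose 𝒜 ℬ ∘ₗ (tensorGrading 𝒜 ℬ n).subtype)
        (DirectSum.lof k ℕ (tensorGrading 𝒜 ℬ ·) n)) := by
    refine tensorGrading_le fun p q hpq a ha b hb => ?_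
    subst hpq
    exact ⟨⟨_, tmul_mem_tensorGrading ha hb⟩, tensorDecompose_tmul ha hb, rfl⟩
  obtain ⟨y, hy, rfl⟩ := h hz
  exact hy

noncomputable instance tensorGrading.decomposition :
    DirectSum.Decomposition (tensorGrading 𝒜 ℬ) :=
  DirectSum.Decomposition.ofLinearMap _ (tensorDecompose 𝒜 ℬ)
    (by
      refine TensorProduct.ext' fun a b => ?_
      induction a using DirectSum.Decomposition.inductionOn 𝒜 with
      | zero => simp
      | add a a' h h' => rw [TensorProduct.add_tmul, map_add, map_add, h, h']
      | homogeneous a =>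
        induction b using DirectSum.Decomposition.inductionOn ℬ with
        | zero => simp
        | add b b' h h' => rw [TensorProduct.tmul_add, map_add, map_add, h, h']
        | homogeneous b =>
          rw [LinearMap.comp_apply, tensorDecompose_tmul a.2 b.2, DirectSum.coeLinearMap_lof]
          rfl)
    (by
      ext n z
      simp only [LinearMap.comp_apply, DirectSum.coeLinearMap_lof, LinearMap.id_apply]
      rw [tensorDecompose_of_mem z.2])

noncomputable instance tensorGrading.gradedAlgebra : GradedAlgebra (tensorGrading 𝒜 ℬ) where

omit [GradedAlgebra 𝒜] [GradedAlgebra ℬ] in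
theorem tmul_mem_shiftedPart {p p' q q' : ℕ} {a : R} {b : S} (ha : a ∈ shiftedPart 𝒜 p p')
    (hb : b ∈ shiftedPart ℬ q q') :
    a ⊗ₜ[k] b ∈ shiftedPart (tensorGrading 𝒜 ℬ) (p + q) (p' + q') := by
  rcases mem_shiftedPart_iff.1 ha with rfl | ⟨n, rfl, hn⟩
  · rw [TensorProduct.zero_tmul]; exact zero_mem _
  rcases mem_shiftedPart_iff.1 hb with rfl | ⟨m, rfl, hm⟩
  · rw [TensorProduct.tmul_zero]; exact zero_mem _
  rw [add_add_add_comm]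
  exact mem_shiftedPart_add (tmul_mem_tensorGrading hn hm)

omit [GradedAlgebra 𝒜] in
theorem tmul_mem_gradedMaximalIdeal_left {a : R} (ha : a ∈ gradedMaximalIdeal 𝒜) (b : S) :
    a ⊗ₜ[k] b ∈ gradedMaximalIdeal (tensorGrading 𝒜 ℬ) := by
  have h : gradedMaximalIdeal 𝒜 ≤ (gradedMaximalIdeal (tensorGrading 𝒜 ℬ)).comap
      (Algebra.TensorProduct.includeLeft : R →ₐ[k] R ⊗[k] S) := by
    refine Ideal.span_le.2 ?_
    rintro a ⟨n, hn, ha⟩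
    exact mem_gradedMaximalIdeal_of_mem _ (Nat.add_pos_left hn 0)
      (tmul_mem_tensorGrading (q := 0) ha SetLike.GradedOne.one_mem)
  have h1 : (1 ⊗ₜ[k] b) * (a ⊗ₜ[k] 1) ∈ gradedMaximalIdeal (tensorGrading 𝒜 ℬ) :=
    Ideal.mul_mem_left _ _ (h ha)
  simpa using h1

omit [GradedAlgebra ℬ] in
theorem tmul_mem_gradedMaximalIdeal_right (a : R) {b : S} (hb : b ∈ gradedMaximalIdeal ℬ) :
    a ⊗ₜ[k] b ∈ gradedMaximalIdeal (tensorGrading 𝒜 ℬ) := by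
  have h : gradedMaximalIdeal ℬ ≤ (gradedMaximalIdeal (tensorGrading 𝒜 ℬ)).comap
      (Algebra.TensorProduct.includeRight : S →ₐ[k] R ⊗[k] S) := by
    refine Ideal.span_le.2 ?_
    rintro b ⟨n, hn, hb⟩
    exact mem_gradedMaximalIdeal_of_mem _ (Nat.add_pos_right 0 hn)
      (tmul_mem_tensorGrading (p := 0) SetLike.GradedOne.one_mem hb)
  have h1 : (a ⊗ₜ[k] 1) * (1 ⊗ₜ[k] b) ∈ gradedMaximalIdeal (tensorGrading 𝒜 ℬ) :=
    Ideal.mul_mem_left _ _ (h hb)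
  simpa using h1

end TensorGrading

/-! ### Free modules over `R ⊗ S` from tensor products over `k` -/

section TensorLift

variable {k : Type u} [Field k] {R : Type v} [CommRing R] [Algebra k R]
  {S : Type w} [CommRing S] [Algebra k S] {ι : Type*} {κ : Type*}

theorem finsuppTensorFinsupp_smul_tmul_smul (r : R) (s : S) (x : ι →₀ R) (y : κ →₀ S) :
    finsuppTensorFinsupp k k R S ι κ ((r • x) ⊗ₜ (s • y)) =
      (r ⊗ₜ[k] s) • finsuppTensorFinsupp k k R S ι κ (x ⊗ₜ y) := by
  ext p
  rw [Finsupp.smul_apply, finsuppTensorFinsupp_apply, finsuppTensorFinsupp_apply, smul_eq_mul,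
    Algebra.TensorProduct.tmul_mul_tmul]
  rfl

variable {N : Type*} [AddCommGroup N] [Module (R ⊗[k] S) N] [Module k N]

/-- The `R ⊗ S`-linear map which corresponds to a `k`-linear map on the tensor product of free
modules. -/
noncomputable def tensorLift (g : (ι →₀ R) ⊗[k] (κ →₀ S) →ₗ[k] N) :
    (ι × κ →₀ R ⊗[k] S) →ₗ[R ⊗[k] S] N :=
  Finsupp.linearCombination _ fun p => g (Finsupp.single p.1 1 ⊗ₜ Finsupp.single p.2 1)

theorem tensorLift_single (g : (ι →₀ R) ⊗[k] (κ →₀ S) →ₗ[k] N) (p : ι × κ) :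
    tensorLift g (Finsupp.single p 1) = g (Finsupp.single p.1 1 ⊗ₜ Finsupp.single p.2 1) := by
  simp [tensorLift]

/-- The condition `hg` is `R ⊗ S`-linearity on pure tensors, so both sides are determined by basis
vectors. It transfers computations on the tensor product over `k` to the free module on the product
basis. -/
theorem tensorLift_apply {g : (ι →₀ R) ⊗[k] (κ →₀ S) →ₗ[k] N}
    (hg : ∀ (r : R) (s : S) x y, g ((r • x) ⊗ₜ (s • y)) = (r ⊗ₜ[k] s) • g (x ⊗ₜ y))
    (z : (ι →₀ R) ⊗[k] (κ →₀ S)) :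
    tensorLift g (finsuppTensorFinsupp k k R S ι κ z) = g z := by
  induction z using TensorProduct.induction_on with
  | zero => simp
  | add x y hx hy => rw [map_add, map_add, map_add, hx, hy]
  | tmul x y =>
    induction x using Finsupp.induction_linear with
    | zero => simp
    | add x x' hx hx' => rw [TensorProduct.add_tmul, map_add, map_add, map_add, hx, hx']
    | single e a =>
      induction y using Finsupp.induction_linear with
      | zero => simp
      | add y y' hy hy' => rw [TensorProduct.tmul_add, map_add, map_add, map_add, hy, hy']
      | single f b =>
        have h1 : Finsupp.single e a = a • Finsupp.single e (1 : R) := by simp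
        have h2 : Finsupp.single f b = b • Finsupp.single f (1 : S) := by simp
        rw [h1, h2, hg, finsuppTensorFinsupp_smul_tmul_smul, map_smul, finsuppTensorFinsupp_single,
          ← Algebra.TensorProduct.one_def, tensorLift_single]

theorem smul_tmul_smul_of_linear {ι' κ' : Type*} (f : (ι →₀ R) →ₗ[R] (ι' →₀ R))
    (g : (κ →₀ S) →ₗ[S] (κ' →₀ S)) (r : R) (s : S) (x : ι →₀ R) (y : κ →₀ S) :
    finsuppTensorFinsupp k k R S ι' κ' (f (r • x) ⊗ₜ g (s • y)) =
      (r ⊗ₜ[k] s) • finsuppTensorFinsupp k k R S ι' κ' (f x ⊗ₜ g y) := by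
  rw [map_smul, map_smul, finsuppTensorFinsupp_smul_tmul_smul]

end TensorLift

/-! ### Tensor products of resolutions -/

section TensorResolution

variable {k : Type u} [Field k] {R : Type v} [CommRing R] [Algebra k R]
  {S : Type w} [CommRing S] [Algebra k S] {𝒜 : ℕ → Submodule k R} {ℬ : ℕ → Submodule k S}

/-- The product `I T · J T` of the extensions of two ideals to `T = R ⊗ S`. -/
def extendedProduct (k : Type u) [Field k] {R : Type v} [CommRing R] [Algebra k R]
    {S : Type w} [CommRing S] [Algebra k S] (I : Ideal R) (J : Ideal S) : Ideal (R ⊗[k] S) :=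
  I.map (Algebra.TensorProduct.includeLeft : R →ₐ[k] R ⊗[k] S) *
    J.map (Algebra.TensorProduct.includeRight : S →ₐ[k] R ⊗[k] S)

theorem tmul_mem_extendedProduct {I : Ideal R} {J : Ideal S} {a : R} {b : S} (ha : a ∈ I)
    (hb : b ∈ J) : a ⊗ₜ[k] b ∈ extendedProduct k I J := by
  have := Ideal.mul_mem_mul
    (Ideal.mem_map_of_mem (Algebra.TensorProduct.includeLeft : R →ₐ[k] R ⊗[k] S) ha)
    (Ideal.mem_map_of_mem (Algebra.TensorProduct.includeRight : S →ₐ[k] R ⊗[k] S) hb)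
  simpa [extendedProduct] using this

theorem extendedProduct_le {I : Ideal R} {J : Ideal S} {P : Ideal (R ⊗[k] S)}
    (h : ∀ a ∈ I, ∀ b ∈ J, a ⊗ₜ[k] b ∈ P) : extendedProduct k I J ≤ P := by
  rw [extendedProduct, Ideal.map, Ideal.map, Ideal.span_mul_span', Ideal.span_le]
  rintro _ ⟨_, ⟨a, ha, rfl⟩, _, ⟨b, hb, rfl⟩, rfl⟩
  simpa using h a ha b hb

namespace TotalResolution

variable {I : Ideal R} {J : Ideal S} (X : TotalResolution 𝒜 I) (Y : TotalResolution ℬ J)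

/-- The differential of the tensor product, on the tensor product over the field. -/
noncomputable def tensorD : (X.ι →₀ R) ⊗[k] (Y.ι →₀ S) →ₗ[k] (X.ι →₀ R) ⊗[k] (Y.ι →₀ S) :=
  TensorProduct.map (X.d.restrictScalars k) LinearMap.id +
    TensorProduct.map (X.sign.restrictScalars k) (Y.d.restrictScalars k)

/-- The augmentation of the tensor product, on the tensor product over the field. -/
noncomputable def tensorAug : (X.ι →₀ R) ⊗[k] (Y.ι →₀ S) →ₗ[k] R ⊗[k] S :=
  TensorProduct.map (X.aug.restrictScalars k) (Y.aug.restrictScalars k)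

theorem tensorD_tmul (x : X.ι →₀ R) (y : Y.ι →₀ S) :
    X.tensorD Y (x ⊗ₜ y) = X.d x ⊗ₜ y + X.sign x ⊗ₜ Y.d y := rfl

theorem tensorAug_tmul (x : X.ι →₀ R) (y : Y.ι →₀ S) :
    X.tensorAug Y (x ⊗ₜ y) = X.aug x ⊗ₜ Y.aug y := rfl

theorem tensorD_tensorD (z : (X.ι →₀ R) ⊗[k] (Y.ι →₀ S)) : X.tensorD Y (X.tensorD Y z) = 0 := by
  induction z using TensorProduct.induction_on with
  | zero => simp
  | add x y hx hy => rw [map_add, map_add, hx, hy, add_zero]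
  | tmul x y =>
    simp only [tensorD_tmul, map_add, X.d_d, Y.d_d, TensorProduct.zero_tmul,
      TensorProduct.tmul_zero, X.sign_d, TensorProduct.neg_tmul]
    abel

theorem tensorAug_tensorD (z : (X.ι →₀ R) ⊗[k] (Y.ι →₀ S)) :
    X.tensorAug Y (X.tensorD Y z) = 0 := by
  induction z using TensorProduct.induction_on with
  | zero => simp
  | add x y hx hy => rw [map_add, map_add, hx, hy, add_zero]
  | tmul x y =>
    simp only [tensorD_tmul, tensorAug_tmul, map_add, X.aug_d, Y.aug_d, TensorProduct.zero_tmul,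
      TensorProduct.tmul_zero, add_zero]

variable {X Y}

/-- The map `H = h ⊗ 1 + η ε ⊗ h'`, with `ε` the first augmentation, contracts the tensor complex.
The mixed terms `h (sign x) ⊗ d y` cancel because `h` anticommutes with the sign, and what remains
telescopes to `1 - η ε ⊗ η' ε'`. This replaces a Künneth argument. -/
theorem Contraction.tensor_exact (hX : X.Contraction) (hY : Y.Contraction)
    {z : (X.ι →₀ R) ⊗[k] (Y.ι →₀ S)} (hz : X.tensorD Y z = 0) (hz' : X.tensorAug Y z = 0) :
    ∃ y, X.tensorD Y y = z := by
  let H : (X.ι →₀ R) ⊗[k] (Y.ι →₀ S) →ₗ[k] (X.ι →₀ R) ⊗[k] (Y.ι →₀ S) :=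
    TensorProduct.map hX.h LinearMap.id +
      TensorProduct.map (hX.η ∘ₗ X.aug.restrictScalars k) hY.h
  have hH : ∀ x y, H (x ⊗ₜ y) = hX.h x ⊗ₜ y + hX.η (X.aug x) ⊗ₜ hY.h y := fun _ _ => rfl
  have key : ∀ z, X.tensorD Y (H z) + H (X.tensorD Y z) =
      z - TensorProduct.map hX.η hY.η (X.tensorAug Y z) := by
    intro z
    induction z using TensorProduct.induction_on with
    | zero => simp
    | add x y hx hy =>
      simp only [map_add]
      rw [add_add_add_comm, hx, hy]
      abel
    | tmul x y =>
      have h1 : X.tensorD Y (H (x ⊗ₜ y)) + H (X.tensorD Y (x ⊗ₜ y)) =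
          (X.d (hX.h x) + hX.h (X.d x)) ⊗ₜ y +
            hX.η (X.aug x) ⊗ₜ (Y.d (hY.h y) + hY.h (Y.d y)) := by
        simp only [hH, tensorD_tmul, map_add, X.aug_d, hX.d_η, hX.sign_η, hX.sign_h, X.aug_sign,
          map_zero, TensorProduct.zero_tmul, TensorProduct.neg_tmul, TensorProduct.add_tmul,
          TensorProduct.tmul_add]
        abel
      rw [h1, hX.homotopy, hY.homotopy, tensorAug_tmul, TensorProduct.map_tmul,
        TensorProduct.sub_tmul, TensorProduct.tmul_sub]
      abel
  refine ⟨H z, ?_⟩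
  have := key z
  rw [hz, hz', map_zero, map_zero, add_zero] at this
  exact this.trans (sub_zero z)

theorem tensorLift_tensorD_apply (z : (X.ι →₀ R) ⊗[k] (Y.ι →₀ S)) :
    tensorLift ((finsuppTensorFinsupp k k R S X.ι Y.ι).toLinearMap ∘ₗ X.tensorD Y)
      (finsuppTensorFinsupp k k R S X.ι Y.ι z) =
        finsuppTensorFinsupp k k R S X.ι Y.ι (X.tensorD Y z) := by
  refine tensorLift_apply (fun r s x y => ?_) z
  simp only [LinearMap.comp_apply, LinearEquiv.coe_coe, tensorD_tmul, map_add, smul_add]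
  exact congrArg₂ (· + ·) (smul_tmul_smul_of_linear X.d LinearMap.id r s x y)
    (smul_tmul_smul_of_linear X.sign Y.d r s x y)

theorem tensorLift_tensorAug_apply (z : (X.ι →₀ R) ⊗[k] (Y.ι →₀ S)) :
    tensorLift (X.tensorAug Y) (finsuppTensorFinsupp k k R S X.ι Y.ι z) = X.tensorAug Y z := by
  refine tensorLift_apply (fun r s x y => ?_) z
  rw [tensorAug_tmul, tensorAug_tmul, map_smul, map_smul, smul_eq_mul, smul_eq_mul, smul_eq_mul,
    Algebra.TensorProduct.tmul_mul_tmul]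

theorem tensorD_entry (p q : X.ι × Y.ι) :
    tensorLift ((finsuppTensorFinsupp k k R S X.ι Y.ι).toLinearMap ∘ₗ X.tensorD Y)
      (Finsupp.single p 1) q =
      X.d (Finsupp.single p.1 1) q.1 ⊗ₜ (Finsupp.single p.2 (1 : S)) q.2 +
        ((-1 : R) ^ X.hdeg p.1 * (Finsupp.single p.1 (1 : R)) q.1) ⊗ₜ
          Y.d (Finsupp.single p.2 1) q.2 := by
  rw [tensorLift_single, LinearMap.comp_apply, tensorD_tmul, LinearEquiv.coe_coe, map_add,
    Finsupp.add_apply]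
  rw [show q = (q.1, q.2) from rfl, finsuppTensorFinsupp_apply, finsuppTensorFinsupp_apply,
    signMap_single]
  rfl

theorem eq_of_single_apply_ne_zero {ι M : Type*} [Zero M] {e f : ι} {a : M}
    (h : Finsupp.single e a f ≠ 0) : e = f := by
  by_contra hne
  exact h (Finsupp.single_eq_of_ne (Ne.symm hne))

variable [GradedAlgebra 𝒜] [GradedAlgebra ℬ]

/-- The tensor product of two resolutions over a field is a resolution. -/
noncomputable def tensor (X : TotalResolution 𝒜 I) (Y : TotalResolution ℬ J) (hX : X.Contraction)
    (hY : Y.Contraction) : TotalResolution (tensorGrading 𝒜 ℬ) (extendedProduct k I J) where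
  ι := X.ι × Y.ι
  hdeg p := X.hdeg p.1 + Y.hdeg p.2
  deg p := X.deg p.1 + Y.deg p.2
  d := tensorLift ((finsuppTensorFinsupp k k R S X.ι Y.ι).toLinearMap ∘ₗ X.tensorD Y)
  aug := tensorLift (X.tensorAug Y)
  d_mem p := by
    rw [mem_freeGrading_iff]
    intro q
    rw [tensorD_entry]
    have h1 : (-1 : R) ^ X.hdeg p.1 * (Finsupp.single p.1 (1 : R)) q.1 ∈
        shiftedPart 𝒜 (X.deg q.1) (X.deg p.1) := by
      have := mem_freeGrading_iff.1 (single_one_mem_freeGrading (𝒜 := 𝒜) (deg := X.deg) p.1) q.1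
      rcases neg_one_pow_eq_or R (X.hdeg p.1) with h | h
      · rwa [h, one_mul]
      · rw [h, neg_one_mul]
        exact neg_mem this
    exact add_mem (tmul_mem_shiftedPart (mem_freeGrading_iff.1 (X.d_mem p.1) q.1)
        (mem_freeGrading_iff.1 (single_one_mem_freeGrading (𝒜 := ℬ) p.2) q.2))
      (tmul_mem_shiftedPart h1 (mem_freeGrading_iff.1 (Y.d_mem p.2) q.2))
  d_minimal p q := by
    rw [tensorD_entry]
    exact add_mem (tmul_mem_gradedMaximalIdeal_left (X.d_minimal p.1 q.1) _)
      (tmul_mem_gradedMaximalIdeal_right _ (Y.d_minimal p.2 q.2))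
  d_hdeg p q h := by
    rw [tensorD_entry] at h
    -- A nonzero first summand forces equal second indices and a drop of one in `X`; otherwise the
    -- second summand is nonzero, with equal first indices and a drop of one in `Y`.
    by_cases h1 : X.d (Finsupp.single p.1 1) q.1 ⊗ₜ[k] (Finsupp.single p.2 (1 : S)) q.2 = 0
    · rw [h1, zero_add] at h
      have h3 : p.1 = q.1 := eq_of_single_apply_ne_zero (a := (1 : R)) fun h0 =>
        h (by rw [h0, mul_zero, TensorProduct.zero_tmul])
      have h4 := Y.d_hdeg p.2 q.2 fun h0 => h (by rw [h0, TensorProduct.tmul_zero])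
      rw [h3, h4, add_assoc]
    · have h3 : p.2 = q.2 := eq_of_single_apply_ne_zero (a := (1 : S)) fun h0 =>
        h1 (by rw [h0, TensorProduct.tmul_zero])
      have h4 := X.d_hdeg p.1 q.1 fun h0 => h1 (by rw [h0, TensorProduct.zero_tmul])
      rw [h3, h4]
      ring
  aug_mem p := by
    rw [tensorLift_single]
    exact tmul_mem_tensorGrading (X.aug_mem p.1) (Y.aug_mem p.2)
  aug_hdeg p h := by
    rw [tensorLift_single, tensorAug_tmul] at h
    rw [X.aug_hdeg p.1 fun h0 => h (by rw [h0, TensorProduct.zero_tmul]),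
      Y.aug_hdeg p.2 fun h0 => h (by rw [h0, TensorProduct.tmul_zero])]
  d_d x := by
    obtain ⟨z, rfl⟩ := (finsuppTensorFinsupp k k R S X.ι Y.ι).surjective x
    rw [tensorLift_tensorD_apply, tensorLift_tensorD_apply, tensorD_tensorD, map_zero]
  aug_d x := by
    obtain ⟨z, rfl⟩ := (finsuppTensorFinsupp k k R S X.ι Y.ι).surjective x
    rw [tensorLift_tensorD_apply, tensorLift_tensorAug_apply, tensorAug_tensorD]
  exact x hx hx' := by
    obtain ⟨z, rfl⟩ := (finsuppTensorFinsupp k k R S X.ι Y.ι).surjective x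
    rw [tensorLift_tensorD_apply, LinearEquiv.map_eq_zero_iff] at hx
    rw [tensorLift_tensorAug_apply] at hx'
    obtain ⟨y, hy⟩ := hX.tensor_exact hY hx hx'
    exact ⟨finsuppTensorFinsupp k k R S X.ι Y.ι y, by rw [tensorLift_tensorD_apply, hy]⟩
  aug_mem_ideal x := by
    obtain ⟨z, rfl⟩ := (finsuppTensorFinsupp k k R S X.ι Y.ι).surjective x
    rw [tensorLift_tensorAug_apply]
    induction z using TensorProduct.induction_on with
    | zero => simp
    | add x y hx hy => rw [map_add]; exact add_mem hx hy
    | tmul x y => exact tmul_mem_extendedProduct (X.aug_mem_ideal x) (Y.aug_mem_ideal y)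
  exists_cycle c hc := by
    -- The augmentations of cycles form an ideal, so it is enough to reach the generators `a ⊗ b`,
    -- which come from tensors of cycles.
    have h : extendedProduct k I J ≤ Submodule.map (tensorLift (X.tensorAug Y)) (LinearMap.ker
        (tensorLift ((finsuppTensorFinsupp k k R S X.ι Y.ι).toLinearMap ∘ₗ X.tensorD Y))) := by
      refine extendedProduct_le fun a ha b hb => ?_
      obtain ⟨x, hx, rfl⟩ := X.exists_cycle a ha
      obtain ⟨y, hy, rfl⟩ := Y.exists_cycle b hb
      refine ⟨finsuppTensorFinsupp k k R S X.ι Y.ι (x ⊗ₜ y), ?_, tensorLift_tensorAug_apply _⟩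
      rw [SetLike.mem_coe, LinearMap.mem_ker, tensorLift_tensorD_apply, tensorD_tmul, hx, hy]
      simp
    exact h hc

/-- The tensor product of two maps of resolutions. -/
noncomputable def tensorMap {I' : Ideal R} {J' : Ideal S} {X' : TotalResolution 𝒜 I'}
    {Y' : TotalResolution ℬ J'} (φ : (X.ι →₀ R) →ₗ[R] (X'.ι →₀ R))
    (ψ : (Y.ι →₀ S) →ₗ[S] (Y'.ι →₀ S)) :
    (X.ι × Y.ι →₀ R ⊗[k] S) →ₗ[R ⊗[k] S] (X'.ι × Y'.ι →₀ R ⊗[k] S) :=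
  tensorLift ((finsuppTensorFinsupp k k R S X'.ι Y'.ι).toLinearMap ∘ₗ
    TensorProduct.map (φ.restrictScalars k) (ψ.restrictScalars k))

section TensorMap

variable {I' : Ideal R} {J' : Ideal S} {X' : TotalResolution 𝒜 I'} {Y' : TotalResolution ℬ J'}
  {φ : (X.ι →₀ R) →ₗ[R] (X'.ι →₀ R)} {ψ : (Y.ι →₀ S) →ₗ[S] (Y'.ι →₀ S)}

omit [GradedAlgebra 𝒜] [GradedAlgebra ℬ]

theorem tensorMap_apply (z : (X.ι →₀ R) ⊗[k] (Y.ι →₀ S)) :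
    tensorMap φ ψ (finsuppTensorFinsupp k k R S X.ι Y.ι z) =
      finsuppTensorFinsupp k k R S X'.ι Y'.ι
        (TensorProduct.map (φ.restrictScalars k) (ψ.restrictScalars k) z) :=
  tensorLift_apply (fun r s x y => smul_tmul_smul_of_linear φ ψ r s x y) z

theorem tensorMap_entry (p : X.ι × Y.ι) (q : X'.ι × Y'.ι) :
    tensorMap φ ψ (Finsupp.single p 1) q =
      φ (Finsupp.single p.1 1) q.1 ⊗ₜ[k] ψ (Finsupp.single p.2 1) q.2 := by
  rw [tensorMap, tensorLift_single]
  exact finsuppTensorFinsupp_apply _ _ _ _ _ _ _ _ _ _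

theorem IsHom.sign {A : Type v} [CommRing A] [Algebra k A] {𝒜 : ℕ → Submodule k A} {K L : Ideal A}
    {X : TotalResolution 𝒜 K} {Y : TotalResolution 𝒜 L} {φ : (X.ι →₀ A) →ₗ[A] (Y.ι →₀ A)}
    (hφ : X.IsHom Y φ) (x : X.ι →₀ A) : Y.sign (φ x) = φ (X.sign x) := by
  induction x using Finsupp.induction_linear with
  | zero => simp
  | add x y hx hy => simp only [map_add, hx, hy]
  | single e a =>
    have : Finsupp.single e a = a • Finsupp.single e (1 : A) := by simp
    rw [this]
    simp only [map_smul, signMap_single]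
    congr 1
    ext f
    rw [signMap_apply, Finsupp.smul_apply, smul_eq_mul]
    by_cases h : φ (Finsupp.single e 1) f = 0
    · rw [h]; simp
    · rw [hφ.hdeg e f h]

end TensorMap

theorem IsHom.tensor {I' : Ideal R} {J' : Ideal S} {X' : TotalResolution 𝒜 I'}
    {Y' : TotalResolution ℬ J'}
    {φ : (X.ι →₀ R) →ₗ[R] (X'.ι →₀ R)} {ψ : (Y.ι →₀ S) →ₗ[S] (Y'.ι →₀ S)} (hφ : X.IsHom X' φ)
    (hψ : Y.IsHom Y' ψ) (hX : X.Contraction) (hY : Y.Contraction) (hX' : X'.Contraction)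
    (hY' : Y'.Contraction) :
    (X.tensor Y hX hY).IsHom (X'.tensor Y' hX' hY') (tensorMap φ ψ) where
  mem p := by
    rw [mem_freeGrading_iff]
    intro q
    exact (tensorMap_entry p q).symm ▸ tmul_mem_shiftedPart (mem_freeGrading_iff.1 (hφ.mem p.1) q.1)
      (mem_freeGrading_iff.1 (hψ.mem p.2) q.2)
  hdeg p q h := by
    have h' := fun h0 => h ((tensorMap_entry p q).trans h0)
    exact congrArg₂ (· + ·)
      (hφ.hdeg p.1 q.1 fun h0 => h' (by rw [h0, TensorProduct.zero_tmul]))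
      (hψ.hdeg p.2 q.2 fun h0 => h' (by rw [h0, TensorProduct.tmul_zero]))
  comm x := by
    obtain ⟨z, rfl⟩ := (finsuppTensorFinsupp k k R S X.ι Y.ι).surjective x
    have h : ∀ z, X'.tensorD Y' (TensorProduct.map (φ.restrictScalars k) (ψ.restrictScalars k) z) =
        TensorProduct.map (φ.restrictScalars k) (ψ.restrictScalars k) (X.tensorD Y z) := by
      intro z
      induction z using TensorProduct.induction_on with
      | zero => simp
      | add x y hx hy => simp only [map_add, hx, hy]
      | tmul x y =>
        simp only [TensorProduct.map_tmul, tensorD_tmul, map_add, LinearMap.coe_restrictScalars,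
          hφ.comm, hψ.comm, hφ.sign]
    change tensorLift _ (tensorMap φ ψ _) = tensorMap φ ψ (tensorLift _ _)
    rw [tensorMap_apply, tensorLift_tensorD_apply, tensorLift_tensorD_apply, tensorMap_apply, h]
  aug x := by
    obtain ⟨z, rfl⟩ := (finsuppTensorFinsupp k k R S X.ι Y.ι).surjective x
    change tensorLift _ (tensorMap φ ψ _) = tensorLift _ _
    rw [tensorMap_apply, tensorLift_tensorAug_apply, tensorLift_tensorAug_apply]
    induction z using TensorProduct.induction_on with
    | zero => simp
    | add x y hx hy => simp only [map_add, hx, hy]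
    | tmul x y =>
      simp only [TensorProduct.map_tmul, tensorAug_tmul, LinearMap.coe_restrictScalars, hφ.aug,
        hψ.aug]

theorem isHom_id {A : Type v} [CommRing A] [Algebra k A] {𝒜 : ℕ → Submodule k A} [GradedAlgebra 𝒜]
    {K : Ideal A} (X : TotalResolution 𝒜 K) : X.IsHom X LinearMap.id where
  mem e := single_one_mem_freeGrading e
  hdeg e e' h := by rw [eq_of_single_apply_ne_zero h]
  comm _ := rfl
  aug _ := rfl

end TotalResolution

end TensorResolution

/-! ### The mapping cone for a sum of two ideals -/

section Cone

variable {k : Type u} [Field k] {A : Type v} [CommRing A] [Algebra k A] {𝒜 : ℕ → Submodule k A}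

section SumEquiv

variable (A) (α β γ : Type*)

/-- Splitting a free module along a decomposition of its basis into three parts. -/
noncomputable def finsuppSumSum :
    (α ⊕ (β ⊕ γ) →₀ A) ≃ₗ[A] (α →₀ A) × ((β →₀ A) × (γ →₀ A)) :=
  Finsupp.sumFinsuppLEquivProdFinsupp A ≪≫ₗ
    LinearEquiv.prodCongr (LinearEquiv.refl A _) (Finsupp.sumFinsuppLEquivProdFinsupp A)

variable {A α β γ}

@[simp]
theorem finsuppSumSum_symm_inl (p : (α →₀ A) × ((β →₀ A) × (γ →₀ A))) (e : α) :
    (finsuppSumSum A α β γ).symm p (Sum.inl e) = p.1 e := rfl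

@[simp]
theorem finsuppSumSum_symm_inr_inl (p : (α →₀ A) × ((β →₀ A) × (γ →₀ A))) (e : β) :
    (finsuppSumSum A α β γ).symm p (Sum.inr (Sum.inl e)) = p.2.1 e := rfl

@[simp]
theorem finsuppSumSum_symm_inr_inr (p : (α →₀ A) × ((β →₀ A) × (γ →₀ A))) (e : γ) :
    (finsuppSumSum A α β γ).symm p (Sum.inr (Sum.inr e)) = p.2.2 e := rfl

@[simp]
theorem finsuppSumSum_single_inl (e : α) (a : A) :
    finsuppSumSum A α β γ (Finsupp.single (Sum.inl e) a) = (Finsupp.single e a, 0, 0) := by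
  classical
  rw [← LinearEquiv.eq_symm_apply]
  ext (f | f | f) <;> simp [Finsupp.single_apply]

@[simp]
theorem finsuppSumSum_single_inr_inl (e : β) (a : A) :
    finsuppSumSum A α β γ (Finsupp.single (Sum.inr (Sum.inl e)) a) =
      (0, Finsupp.single e a, 0) := by
  classical
  rw [← LinearEquiv.eq_symm_apply]
  ext (f | f | f) <;> simp [Finsupp.single_apply]

@[simp]
theorem finsuppSumSum_single_inr_inr (e : γ) (a : A) :
    finsuppSumSum A α β γ (Finsupp.single (Sum.inr (Sum.inr e)) a) =
      (0, 0, Finsupp.single e a) := by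
  classical
  rw [← LinearEquiv.eq_symm_apply]
  ext (f | f | f) <;> simp [Finsupp.single_apply]

end SumEquiv

namespace TotalResolution

variable {K L M : Ideal A} {X : TotalResolution 𝒜 K} {Y : TotalResolution 𝒜 L}
  {Z : TotalResolution 𝒜 M}

/-- The differential of the mapping cone of `(α, -β) : Z → X ⊕ Y`. -/
noncomputable def coneD (α : (Z.ι →₀ A) →ₗ[A] (X.ι →₀ A)) (β : (Z.ι →₀ A) →ₗ[A] (Y.ι →₀ A)) :
    (Z.ι →₀ A) × ((X.ι →₀ A) × (Y.ι →₀ A)) →ₗ[A] (Z.ι →₀ A) × ((X.ι →₀ A) × (Y.ι →₀ A)) :=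
  ((-Z.d) ∘ₗ LinearMap.fst A _ _).prod
    ((α ∘ₗ LinearMap.fst A _ _ + X.d ∘ₗ LinearMap.fst A _ _ ∘ₗ LinearMap.snd A _ _).prod
      (-β ∘ₗ LinearMap.fst A _ _ + Y.d ∘ₗ LinearMap.snd A _ _ ∘ₗ LinearMap.snd A _ _))

theorem coneD_apply (α : (Z.ι →₀ A) →ₗ[A] (X.ι →₀ A)) (β : (Z.ι →₀ A) →ₗ[A] (Y.ι →₀ A)) (z x y) :
    coneD α β (z, x, y) = (-Z.d z, α z + X.d x, -β z + Y.d y) := rfl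

/-- The augmentation of the mapping cone. -/
noncomputable def coneAug (X : TotalResolution 𝒜 K) (Y : TotalResolution 𝒜 L)
    (Z : TotalResolution 𝒜 M) : (Z.ι →₀ A) × ((X.ι →₀ A) × (Y.ι →₀ A)) →ₗ[A] A :=
  X.aug ∘ₗ LinearMap.fst A _ _ ∘ₗ LinearMap.snd A _ _ +
    Y.aug ∘ₗ LinearMap.snd A _ _ ∘ₗ LinearMap.snd A _ _

theorem coneAug_apply (z x y) : coneAug X Y Z (z, x, y) = X.aug x + Y.aug y := rfl

/-- Mayer–Vietoris chase. First `z` is a boundary `d w`; then `x + α w` and `y - β w` are cycles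
with opposite augmentations, which therefore lie in `K ⊓ L`. A cycle `z'` of `Z` with the
augmentation of `x + α w` corrects both to boundaries. The reverse inclusion `M ≤ K ⊓ L` is already
implied by the maps `α` and `β`. -/
theorem coneD_exact {α : (Z.ι →₀ A) →ₗ[A] (X.ι →₀ A)} {β : (Z.ι →₀ A) →ₗ[A] (Y.ι →₀ A)}
    (hα : Z.IsHom X α) (hβ : Z.IsHom Y β) (hM : K ⊓ L ≤ M) {z x y}
    (h : coneD α β (z, x, y) = 0) (h' : coneAug X Y Z (z, x, y) = 0) :
    ∃ p, coneD α β p = (z, x, y) := by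
  rw [coneD_apply, Prod.mk_eq_zero, Prod.mk_eq_zero, neg_eq_zero] at h
  obtain ⟨hz, hx, hy⟩ := h
  rw [coneAug_apply] at h'
  have hz' : Z.aug z = 0 := by
    have := congrArg X.aug hx
    rwa [map_add, X.aug_d, add_zero, map_zero, hα.aug] at this
  obtain ⟨w, rfl⟩ := Z.exact z hz hz'
  have h1 : X.aug (x + α w) + Y.aug (y - β w) = 0 := by
    rw [map_add, map_sub, hα.aug, hβ.aug, ← h']
    ring
  have hc : X.aug (x + α w) ∈ M := hM ⟨X.aug_mem_ideal _, by
    rw [eq_neg_of_add_eq_zero_left h1]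
    exact neg_mem (Y.aug_mem_ideal _)⟩
  obtain ⟨z', hz', hc'⟩ := Z.exists_cycle _ hc
  obtain ⟨x', hx'⟩ := X.exact (x + α w - α z')
    (by rw [map_sub, map_add, hα.comm, hα.comm, hz', map_zero, sub_zero, add_comm, hx])
    (by rw [map_sub, hα.aug, hc', sub_self])
  obtain ⟨y', hy'⟩ := Y.exact (y - β w + β z')
    (by rw [map_add, map_sub, hβ.comm, hβ.comm, hz', map_zero, add_zero, ← hy]; abel)
    (by rw [map_add, hβ.aug, hc', add_comm, h1])
  refine ⟨(z' - w, x', y'), ?_⟩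
  rw [coneD_apply, hx', hy', map_sub, map_sub, map_sub, hz']
  congr 1
  · abel
  · congr 1 <;> abel

/-- The mapping cone: a resolution of the sum of two ideals from resolutions of the ideals and of
their intersection. -/
noncomputable def cone {α : (Z.ι →₀ A) →ₗ[A] (X.ι →₀ A)} {β : (Z.ι →₀ A) →ₗ[A] (Y.ι →₀ A)}
    (hα : Z.IsHom X α) (hβ : Z.IsHom Y β)
    (hα' : ∀ e e', α (Finsupp.single e 1) e' ∈ gradedMaximalIdeal 𝒜)
    (hβ' : ∀ e e', β (Finsupp.single e 1) e' ∈ gradedMaximalIdeal 𝒜) (hM : K ⊓ L ≤ M) :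
    TotalResolution 𝒜 (K ⊔ L) where
  ι := Z.ι ⊕ (X.ι ⊕ Y.ι)
  hdeg := Sum.elim (fun e => Z.hdeg e + 1) (Sum.elim X.hdeg Y.hdeg)
  deg := Sum.elim Z.deg (Sum.elim X.deg Y.deg)
  d := (finsuppSumSum A Z.ι X.ι Y.ι).symm.toLinearMap ∘ₗ coneD α β ∘ₗ
    (finsuppSumSum A Z.ι X.ι Y.ι).toLinearMap
  aug := coneAug X Y Z ∘ₗ (finsuppSumSum A Z.ι X.ι Y.ι).toLinearMap
  d_mem := by
    rintro (e | e | e) <;> rw [mem_freeGrading_iff] <;> rintro (f | f | f) <;>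
      simp only [LinearMap.comp_apply, LinearEquiv.coe_coe, finsuppSumSum_single_inl,
        finsuppSumSum_single_inr_inl, finsuppSumSum_single_inr_inr, coneD_apply,
        finsuppSumSum_symm_inl, finsuppSumSum_symm_inr_inl, finsuppSumSum_symm_inr_inr, map_zero,
        neg_zero, add_zero, zero_add, Finsupp.coe_zero, Pi.zero_apply, zero_mem, Finsupp.neg_apply,
        neg_mem_iff, Sum.elim_inl, Sum.elim_inr]
    · exact mem_freeGrading_iff.1 (Z.d_mem e) f
    · exact mem_freeGrading_iff.1 (hα.mem e) f
    · exact mem_freeGrading_iff.1 (hβ.mem e) f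
    · exact mem_freeGrading_iff.1 (X.d_mem e) f
    · exact mem_freeGrading_iff.1 (Y.d_mem e) f
  d_minimal := by
    rintro (e | e | e) (f | f | f) <;>
      simp only [LinearMap.comp_apply, LinearEquiv.coe_coe, finsuppSumSum_single_inl,
        finsuppSumSum_single_inr_inl, finsuppSumSum_single_inr_inr, coneD_apply,
        finsuppSumSum_symm_inl, finsuppSumSum_symm_inr_inl, finsuppSumSum_symm_inr_inr, map_zero,
        neg_zero, add_zero, zero_add, Finsupp.coe_zero, Pi.zero_apply, zero_mem, Finsupp.neg_apply,
        neg_mem_iff]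
    · exact Z.d_minimal e f
    · exact hα' e f
    · exact hβ' e f
    · exact X.d_minimal e f
    · exact Y.d_minimal e f
  d_hdeg := by
    rintro (e | e | e) (f | f | f) <;>
      simp only [LinearMap.comp_apply, LinearEquiv.coe_coe, finsuppSumSum_single_inl,
        finsuppSumSum_single_inr_inl, finsuppSumSum_single_inr_inr, coneD_apply,
        finsuppSumSum_symm_inl, finsuppSumSum_symm_inr_inl, finsuppSumSum_symm_inr_inr, map_zero,
        neg_zero, add_zero, zero_add, Finsupp.coe_zero, Pi.zero_apply, ne_eq, not_true_eq_false,
        Finsupp.neg_apply, neg_eq_zero, Sum.elim_inl, Sum.elim_inr, Nat.add_right_cancel_iff,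
        IsEmpty.forall_iff]
    · exact Z.d_hdeg e f
    · exact hα.hdeg e f
    · exact hβ.hdeg e f
    · exact X.d_hdeg e f
    · exact Y.d_hdeg e f
  aug_mem := by
    rintro (e | e | e) <;>
      simp only [LinearMap.comp_apply, LinearEquiv.coe_coe, finsuppSumSum_single_inl,
        finsuppSumSum_single_inr_inl, finsuppSumSum_single_inr_inr, coneAug_apply, map_zero,
        add_zero, zero_add, zero_mem, Sum.elim_inl, Sum.elim_inr]
    · exact X.aug_mem e
    · exact Y.aug_mem e
  aug_hdeg := by
    rintro (e | e | e) <;>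
      simp only [LinearMap.comp_apply, LinearEquiv.coe_coe, finsuppSumSum_single_inl,
        finsuppSumSum_single_inr_inl, finsuppSumSum_single_inr_inr, coneAug_apply, map_zero,
        add_zero, zero_add, Sum.elim_inl, Sum.elim_inr, ne_eq, not_true_eq_false,
        IsEmpty.forall_iff]
    · exact X.aug_hdeg e
    · exact Y.aug_hdeg e
  d_d x := by
    obtain ⟨⟨z, x, y⟩, rfl⟩ := (finsuppSumSum A Z.ι X.ι Y.ι).symm.surjective x
    simp [coneD_apply, hα.comm, hβ.comm, Z.d_d, X.d_d, Y.d_d]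
  aug_d x := by
    obtain ⟨⟨z, x, y⟩, rfl⟩ := (finsuppSumSum A Z.ι X.ι Y.ι).symm.surjective x
    simp [coneD_apply, coneAug_apply, hα.aug, hβ.aug, X.aug_d, Y.aug_d]
  exact x hx hx' := by
    obtain ⟨⟨z, x, y⟩, rfl⟩ := (finsuppSumSum A Z.ι X.ι Y.ι).symm.surjective x
    simp only [LinearMap.comp_apply, LinearEquiv.coe_coe, LinearEquiv.apply_symm_apply,
      LinearEquiv.map_eq_zero_iff] at hx hx'
    obtain ⟨p, hp⟩ := coneD_exact hα hβ hM hx hx'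
    exact ⟨(finsuppSumSum A Z.ι X.ι Y.ι).symm p, by simp [hp]⟩
  aug_mem_ideal x := by
    obtain ⟨⟨z, x, y⟩, rfl⟩ := (finsuppSumSum A Z.ι X.ι Y.ι).symm.surjective x
    simp only [LinearMap.comp_apply, LinearEquiv.coe_coe, LinearEquiv.apply_symm_apply,
      coneAug_apply]
    exact Submodule.add_mem_sup (X.aug_mem_ideal x) (Y.aug_mem_ideal y)
  exists_cycle c hc := by
    obtain ⟨a, ha, b, hb, rfl⟩ := Submodule.mem_sup.1 hc
    obtain ⟨x, hx, rfl⟩ := X.exists_cycle a ha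
    obtain ⟨y, hy, rfl⟩ := Y.exists_cycle b hb
    refine ⟨(finsuppSumSum A Z.ι X.ι Y.ι).symm (0, x, y), ?_, ?_⟩
    · simp [coneD_apply, hx, hy]
    · simp [coneAug_apply]

section

variable {α : (Z.ι →₀ A) →ₗ[A] (X.ι →₀ A)} {β : (Z.ι →₀ A) →ₗ[A] (Y.ι →₀ A)}
  (hα : Z.IsHom X α) (hβ : Z.IsHom Y β)
  (hα' : ∀ e e', α (Finsupp.single e 1) e' ∈ gradedMaximalIdeal 𝒜)
  (hβ' : ∀ e e', β (Finsupp.single e 1) e' ∈ gradedMaximalIdeal 𝒜) (hM : K ⊓ L ≤ M)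

theorem mem_shape_cone {σ : ℕ × ℕ} : σ ∈ (cone hα hβ hα' hβ' hM).shape ↔
    (∃ τ ∈ Z.shape, σ = τ + (1, 0)) ∨ σ ∈ X.shape ∨ σ ∈ Y.shape := by
  constructor
  · rintro ⟨e | e | e, rfl⟩
    · exact Or.inl ⟨_, ⟨e, rfl⟩, rfl⟩
    · exact Or.inr (Or.inl ⟨e, rfl⟩)
    · exact Or.inr (Or.inr ⟨e, rfl⟩)
  · rintro (⟨_, ⟨e, rfl⟩, rfl⟩ | ⟨e, rfl⟩ | ⟨e, rfl⟩)
    · exact ⟨Sum.inl e, rfl⟩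
    · exact ⟨Sum.inr (Sum.inl e), rfl⟩
    · exact ⟨Sum.inr (Sum.inr e), rfl⟩

/-- The inclusion of the last summand. In the inductive construction `Y` resolves the newest product
`I^(s-t) J^t`, through which the next connecting map has to factor. -/
theorem exists_isHom_cone [GradedAlgebra 𝒜] : ∃ χ, Y.IsHom (cone hα hβ hα' hβ' hM) χ := by
  refine ⟨(finsuppSumSum A Z.ι X.ι Y.ι).symm.toLinearMap ∘ₗ LinearMap.inr A _ _ ∘ₗ
    LinearMap.inr A _ _, ?_, ?_, fun x => ?_, fun x => ?_⟩
  · intro e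
    rw [mem_freeGrading_iff]
    rintro (f | f | f)
    · exact zero_mem _
    · exact zero_mem _
    · exact mem_freeGrading_iff.1 (single_one_mem_freeGrading (𝒜 := 𝒜) (deg := Y.deg) e) f
  · rintro e (f | f | f) h
    · exact absurd rfl h
    · exact absurd rfl h
    · have h' : Finsupp.single e (1 : A) f ≠ 0 := h
      rw [eq_of_single_apply_ne_zero h']
      rfl
  · change (finsuppSumSum A Z.ι X.ι Y.ι).symm (coneD α β (finsuppSumSum A Z.ι X.ι Y.ι
      ((finsuppSumSum A Z.ι X.ι Y.ι).symm (0, 0, x)))) =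
        (finsuppSumSum A Z.ι X.ι Y.ι).symm (0, 0, Y.d x)
    rw [LinearEquiv.apply_symm_apply, coneD_apply]
    simp
  · change coneAug X Y Z (finsuppSumSum A Z.ι X.ι Y.ι
      ((finsuppSumSum A Z.ι X.ι Y.ι).symm (0, 0, x))) = Y.aug x
    rw [LinearEquiv.apply_symm_apply, coneAug_apply]
    simp

end

end TotalResolution

end Cone

/-! ### Intersections of extended ideals and powers of the mixed sum -/

section ExtendedIdeals

variable {k : Type u} [Field k] {R : Type v} [CommRing R] [Algebra k R]
  {S : Type w} [CommRing S] [Algebra k S]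

theorem exists_projection (I : Ideal R) :
    ∃ p : R →ₗ[k] R, (∀ x, p x ∈ I) ∧ ∀ x ∈ I, p x = x := by
  obtain ⟨g, hg⟩ := (I.subtype.restrictScalars k).exists_leftInverse_of_injective
    (LinearMap.ker_eq_bot.2 Subtype.val_injective)
  exact ⟨I.subtype.restrictScalars k ∘ₗ g, fun x => (g x).2,
    fun x hx => congrArg Subtype.val (LinearMap.congr_fun hg ⟨x, hx⟩)⟩

theorem map_left_eq_self_of_mem {I : Ideal R} {p : R →ₗ[k] R} (hp : ∀ x ∈ I, p x = x)
    {z : R ⊗[k] S} (hz : z ∈ I.map (Algebra.TensorProduct.includeLeft : R →ₐ[k] R ⊗[k] S)) :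
    TensorProduct.map p LinearMap.id z = z := by
  -- `p ⊗ 1` is only `k`-linear on the first factor, so the claim is strengthened to all multiples
  -- of `z` to survive the induction over the span.
  suffices h : ∀ t : R ⊗[k] S, TensorProduct.map p LinearMap.id (t * z) = t * z by
    simpa using h 1
  refine Submodule.span_induction ?_ (by simp) (fun x y _ _ hx hy t => ?_) (fun r x _ hx t => ?_) hz
  · rintro _ ⟨a, ha, rfl⟩ t
    induction t using TensorProduct.induction_on with
    | zero => simp
    | add x y hx hy => rw [add_mul, map_add, hx, hy]
    | tmul r s => simp [hp _ (I.mul_mem_left r ha)]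
  · rw [mul_add, map_add, hx, hy]
  · rw [smul_eq_mul, ← mul_assoc, hx]

theorem map_right_eq_self_of_mem {J : Ideal S} {q : S →ₗ[k] S} (hq : ∀ x ∈ J, q x = x)
    {z : R ⊗[k] S} (hz : z ∈ J.map (Algebra.TensorProduct.includeRight : S →ₐ[k] R ⊗[k] S)) :
    TensorProduct.map LinearMap.id q z = z := by
  suffices h : ∀ t : R ⊗[k] S, TensorProduct.map LinearMap.id q (t * z) = t * z by
    simpa using h 1
  refine Submodule.span_induction ?_ (by simp) (fun x y _ _ hx hy t => ?_) (fun r x _ hx t => ?_) hz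
  · rintro _ ⟨a, ha, rfl⟩ t
    induction t using TensorProduct.induction_on with
    | zero => simp
    | add x y hx hy => rw [add_mul, map_add, hx, hy]
    | tmul r s => simp [hq _ (J.mul_mem_left s ha)]
  · rw [mul_add, map_add, hx, hy]
  · rw [smul_eq_mul, ← mul_assoc, hx]

/-- Take `k`-linear projections `p` onto `I` and `q` onto `J`. Then `p ⊗ q` maps everything into the
product and fixes every element lying in both extensions. -/
theorem inf_map_le_extendedProduct (I : Ideal R) (J : Ideal S) :
    I.map (Algebra.TensorProduct.includeLeft : R →ₐ[k] R ⊗[k] S) ⊓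
      J.map (Algebra.TensorProduct.includeRight : S →ₐ[k] R ⊗[k] S) ≤ extendedProduct k I J := by
  rintro z ⟨h1, h2⟩
  obtain ⟨p, hp, hp'⟩ := exists_projection (k := k) I
  obtain ⟨q, hq, hq'⟩ := exists_projection (k := k) J
  have h : ∀ z : R ⊗[k] S, TensorProduct.map p LinearMap.id (TensorProduct.map LinearMap.id q z) ∈
      extendedProduct k I J := by
    intro z
    induction z using TensorProduct.induction_on with
    | zero => simp
    | add x y hx hy => rw [map_add, map_add]; exact add_mem hx hy
    | tmul a b => exact tmul_mem_extendedProduct (hp a) (hq b)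
  have := h z
  rwa [map_right_eq_self_of_mem hq' h2, map_left_eq_self_of_mem hp' h1] at this

/-- The partial sums `∑ i ≤ t, I ^ (s - i) J ^ i` of the power `(I + J) ^ s`. -/
def powerFiltration (k : Type u) [Field k] {R : Type v} [CommRing R] [Algebra k R]
    {S : Type w} [CommRing S] [Algebra k S] (I : Ideal R) (J : Ideal S) (s : ℕ) :
    ℕ → Ideal (R ⊗[k] S)
  | 0 => extendedProduct k (I ^ s) (J ^ 0)
  | t + 1 => powerFiltration k I J s t ⊔ extendedProduct k (I ^ (s - (t + 1))) (J ^ (t + 1))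

variable (I : Ideal R) (J : Ideal S)

theorem le_powerFiltration (s : ℕ) {t i : ℕ} (h : i ≤ t) :
    extendedProduct k (I ^ (s - i)) (J ^ i) ≤ powerFiltration k I J s t := by
  induction t with
  | zero => obtain rfl := Nat.le_zero.1 h; exact le_rfl
  | succ t ih =>
    rcases Nat.lt_or_eq_of_le h with h | rfl
    · exact (ih (Nat.lt_succ_iff.1 h)).trans le_sup_left
    · exact le_sup_right

theorem powerFiltration_le {s t : ℕ} {P : Ideal (R ⊗[k] S)}
    (h : ∀ i ≤ t, extendedProduct k (I ^ (s - i)) (J ^ i) ≤ P) : powerFiltration k I J s t ≤ P := by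
  induction t with
  | zero => exact h 0 le_rfl
  | succ t ih => exact sup_le (ih fun i hi => h i (by omega)) (h _ le_rfl)

theorem extendedProduct_pow (a b : ℕ) : extendedProduct k (I ^ a) (J ^ b) =
    I.map (Algebra.TensorProduct.includeLeft : R →ₐ[k] R ⊗[k] S) ^ a *
      J.map (Algebra.TensorProduct.includeRight : S →ₐ[k] R ⊗[k] S) ^ b := by
  rw [extendedProduct, Ideal.map_pow, Ideal.map_pow]

theorem powerFiltration_mul_le {s t : ℕ} {P Q : Ideal (R ⊗[k] S)}
    (h : ∀ i ≤ t, extendedProduct k (I ^ (s - i)) (J ^ i) * Q ≤ P) :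
    powerFiltration k I J s t * Q ≤ P := by
  induction t with
  | zero => exact h 0 le_rfl
  | succ t ih =>
    rw [powerFiltration, Ideal.sup_mul]
    exact sup_le (ih fun i hi => h i (by omega)) (h _ le_rfl)

/-- Multiplying `I^(s-i) J^i` by `I` or by `J` gives the terms of index `i` and `i + 1` for the
exponent `s + 1`. -/
theorem mixedSum_pow (s : ℕ) : mixedSum k I J ^ s = powerFiltration k I J s s := by
  apply le_antisymm
  · induction s with
    | zero =>
      rw [powerFiltration, extendedProduct_pow]
      simp
    | succ s ih =>
      refine (pow_succ (mixedSum k I J) s).le.trans ?_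
      refine le_trans (Ideal.mul_mono_left ih) ?_
      apply powerFiltration_mul_le I J
      intro i hi
      have h1 := le_powerFiltration (k := k) I J (s + 1) (t := s + 1) (i := i) (by omega)
      have h2 := le_powerFiltration (k := k) I J (s + 1) (t := s + 1) (i := i + 1) (by omega)
      rw [extendedProduct_pow, show s + 1 - i = s - i + 1 by omega, pow_succ] at h1
      rw [extendedProduct_pow, show s + 1 - (i + 1) = s - i by omega, pow_succ, ← mul_assoc] at h2
      rw [mixedSum, Ideal.mul_sup, extendedProduct_pow, mul_right_comm]
      exact sup_le h1 h2
  · refine powerFiltration_le I J fun i hi => ?_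
    rw [extendedProduct_pow]
    conv_rhs => rw [← Nat.sub_add_cancel hi, pow_add]
    exact Ideal.mul_mono (Ideal.pow_right_mono le_sup_left _) (Ideal.pow_right_mono le_sup_right _)

theorem extendedProduct_le_left (I : Ideal R) (J : Ideal S) : extendedProduct k I J ≤
    I.map (Algebra.TensorProduct.includeLeft : R →ₐ[k] R ⊗[k] S) :=
  Ideal.mul_le.2 fun _ hr s _ => Ideal.mul_mem_right s _ hr

theorem extendedProduct_le_right (I : Ideal R) (J : Ideal S) : extendedProduct k I J ≤
    J.map (Algebra.TensorProduct.includeRight : S →ₐ[k] R ⊗[k] S) :=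
  Ideal.mul_le.2 fun r _ _ hs => Ideal.mul_mem_left _ r hs

/-- Every term of the partial sum up to `t` has `I`-exponent at least `s - t`, so that sum lies in
the extension of `I^(s-t)`, while the new product lies in the extension of `J^(t+1)`. -/
theorem powerFiltration_inf_le (s t : ℕ) :
    powerFiltration k I J s t ⊓ extendedProduct k (I ^ (s - (t + 1))) (J ^ (t + 1)) ≤
      extendedProduct k (I ^ (s - t)) (J ^ (t + 1)) := by
  refine le_trans (inf_le_inf (powerFiltration_le I J fun i hi => ?_)
    (extendedProduct_le_right _ _)) (inf_map_le_extendedProduct _ _)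
  have h : I ^ (s - i) ≤ I ^ (s - t) := Ideal.pow_le_pow_right (by omega)
  exact (extendedProduct_le_left _ _).trans (Ideal.map_mono h)

end ExtendedIdeals

/-! ### Minimal resolutions along the filtration -/

section Filtration

variable {k : Type u} [Field k] {R : Type v} [CommRing R] [Algebra k R]
  {S : Type w} [CommRing S] [Algebra k S] {𝒜 : ℕ → Submodule k R} {ℬ : ℕ → Submodule k S}
  [GradedAlgebra 𝒜] [GradedAlgebra ℬ] {I : Ideal R} {J : Ideal S}

namespace TotalResolution

theorem mem_shape_tensor {X : TotalResolution 𝒜 I} {Y : TotalResolution ℬ J} (hX : X.Contraction)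
    (hY : Y.Contraction) {σ : ℕ × ℕ} : σ ∈ (X.tensor Y hX hY).shape ↔
      ∃ τ ∈ X.shape, ∃ ρ ∈ Y.shape, σ = τ + ρ := by
  constructor
  · rintro ⟨⟨e, f⟩, rfl⟩
    exact ⟨_, ⟨e, rfl⟩, _, ⟨f, rfl⟩, rfl⟩
  · rintro ⟨_, ⟨e, rfl⟩, _, ⟨f, rfl⟩, rfl⟩
    exact ⟨(e, f), rfl⟩

/-- Iterated mapping cones. Besides the resolution `Q`, the induction carries a map into it from the
resolution of the last product, since the next connecting map must visibly factor through that
product in order to be minimal. -/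
theorem exists_resolution_powerFiltration (X : ∀ a, TotalResolution 𝒜 (I ^ a))
    (Y : ∀ b, TotalResolution ℬ (J ^ b)) (hX : ∀ a, (X a).Contraction)
    (hY : ∀ b, (Y b).Contraction)
    (hφ : ∀ a, ∃ φ, (X (a + 1)).IsHom (X a) φ ∧
      ∀ e e', φ (Finsupp.single e 1) e' ∈ gradedMaximalIdeal 𝒜)
    (hψ : ∀ b, ∃ ψ, (Y (b + 1)).IsHom (Y b) ψ ∧
      ∀ e e', ψ (Finsupp.single e 1) e' ∈ gradedMaximalIdeal ℬ) (s t : ℕ) (ht : t ≤ s) :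
    ∃ (Q : TotalResolution (tensorGrading 𝒜 ℬ) (powerFiltration k I J s t)),
      (∃ χ, ((X (s - t)).tensor (Y t) (hX _) (hY _)).IsHom Q χ) ∧
      ∀ σ, σ ∈ Q.shape ↔
        (∃ i ≤ t, ∃ τ ∈ (X (s - i)).shape, ∃ ρ ∈ (Y i).shape, σ = τ + ρ) ∨
        ∃ j < t, ∃ τ ∈ (X (s - j)).shape, ∃ ρ ∈ (Y (j + 1)).shape, σ = τ + ρ + (1, 0) := by
  induction t with
  | zero =>
    refine ⟨(X s).tensor (Y 0) (hX s) (hY 0), ⟨_, isHom_id _⟩, fun σ => ?_⟩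
    refine (mem_shape_tensor (hX s) (hY 0)).trans ?_
    simp
  | succ t ih =>
    obtain ⟨Q, ⟨χ, hχ⟩, hQ⟩ := ih (by omega)
    obtain ⟨φ, hφ1, hφ2⟩ : ∃ φ, (X (s - t)).IsHom (X (s - (t + 1))) φ ∧
        ∀ e e', φ (Finsupp.single e 1) e' ∈ gradedMaximalIdeal 𝒜 := by
      rw [show s - t = s - (t + 1) + 1 by omega]
      exact hφ _
    obtain ⟨ψ, hψ1, hψ2⟩ := hψ t
    -- The connecting map into `Q` lifts `I^(s-t) J^(t+1) ⊆ I^(s-t) J^t` and then follows `χ`; the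
    -- other one lifts `I^(s-t) J^(t+1) ⊆ I^(s-t-1) J^(t+1)`. Each contains a factor, `ψ` or `φ`,
    -- with entries in a maximal ideal.
    have hα := hχ.comp ((isHom_id (X (s - t))).tensor hψ1 (hX _) (hY _) (hX _) (hY _))
    have hβ := hφ1.tensor (isHom_id (Y (t + 1))) (hX _) (hY _) (hX _) (hY _)
    have hα' : ∀ e e', (χ ∘ₗ tensorMap LinearMap.id ψ) (Finsupp.single e 1) e' ∈
        gradedMaximalIdeal (tensorGrading 𝒜 ℬ) := by
      intro e e'
      refine mem_ideal_smul_finsupp_top.1 (GradedFreeResolution.map_mem_smul_top χ ?_) e'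
      rw [mem_ideal_smul_finsupp_top]
      intro q
      exact (tensorMap_entry e q).symm ▸ tmul_mem_gradedMaximalIdeal_right _ (hψ2 e.2 q.2)
    have hβ' : ∀ e e', tensorMap (Y := Y (t + 1)) (Y' := Y (t + 1)) φ LinearMap.id
        (Finsupp.single e 1) e' ∈ gradedMaximalIdeal (tensorGrading 𝒜 ℬ) := by
      intro e q
      exact (tensorMap_entry e q).symm ▸ tmul_mem_gradedMaximalIdeal_left (hφ2 e.1 q.1) _
    refine ⟨cone hα hβ hα' hβ' (powerFiltration_inf_le I J s t), exists_isHom_cone _ _ _ _ _,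
      fun σ => ?_⟩
    refine (mem_shape_cone hα hβ hα' hβ' (powerFiltration_inf_le I J s t)).trans ?_
    rw [hQ, mem_shape_tensor]
    constructor
    · rintro (⟨τ, hτ, rfl⟩ | (⟨i, hi, h⟩ | ⟨j, hj, h⟩) | h)
      · obtain ⟨τ, hτ', ρ, hρ, rfl⟩ := (mem_shape_tensor _ _).1 hτ
        exact Or.inr ⟨t, by omega, τ, hτ', ρ, hρ, rfl⟩
      · exact Or.inl ⟨i, by omega, h⟩
      · exact Or.inr ⟨j, by omega, h⟩
      · exact Or.inl ⟨t + 1, le_rfl, h⟩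
    · rintro (⟨i, hi, h⟩ | ⟨j, hj, h⟩)
      · rcases Nat.lt_or_eq_of_le hi with hi | rfl
        · exact Or.inr (Or.inl (Or.inl ⟨i, by omega, h⟩))
        · exact Or.inr (Or.inr h)
      · rcases Nat.lt_or_eq_of_le (Nat.lt_succ_iff.1 hj) with hj | rfl
        · exact Or.inr (Or.inl (Or.inr ⟨j, hj, h⟩))
        · obtain ⟨τ, hτ, ρ, hρ, rfl⟩ := h
          exact Or.inl ⟨_, (mem_shape_tensor _ _).2 ⟨τ, hτ, ρ, hρ, rfl⟩, rfl⟩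

end TotalResolution

end Filtration

/-! ### Reading invariants off the shape of a resolution -/

section Invariants

variable {k : Type u} [Field k] {A : Type v} [CommRing A] [Algebra k A]
  {𝒜 : ℕ → Submodule k A} {K : Ideal A}

theorem idealProjDim_nonneg {A : Type v} [CommRing A] {K : Ideal A} (hK : K ≠ ⊥) :
    0 ≤ idealProjDim K := by
  rw [idealProjDim, ← Nat.cast_zero, projectiveDimension_ge_iff,
    hasProjectiveDimensionLT_zero_iff_isZero, ModuleCat.isZero_iff_subsingleton]
  exact fun h => hK (Submodule.subsingleton_iff_eq_bot.1 h)

namespace TotalResolution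

variable (X : TotalResolution 𝒜 K)

theorem exists_aug_ne_zero (hK : K ≠ ⊥) : ∃ e, X.aug (Finsupp.single e 1) ≠ 0 := by
  by_contra! h
  have h0 : X.aug = 0 := by ext e; simpa using h e
  refine hK ((Submodule.eq_bot_iff K).2 fun c hc => ?_)
  obtain ⟨z, -, rfl⟩ := X.exists_cycle c hc
  rw [h0, LinearMap.zero_apply]

theorem shape_nonempty (hK : K ≠ ⊥) : X.shape.Nonempty := by
  obtain ⟨e, -⟩ := X.exists_aug_ne_zero hK
  exact ⟨_, e, rfl⟩

/-- Some basis element has nonzero augmentation, hence homological degree zero. If its internal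
degree were zero, its image would be a nonzero scalar, that is, a unit in `K`. -/
theorem exists_mem_shape_one_le (h0 : 𝒜 0 = (⊥ : Subalgebra k A).toSubmodule) (hK : K ≠ ⊥)
    (hK' : K ≠ ⊤) : ∃ σ ∈ X.shape, (1 : ℝ) ≤ (σ.2 : ℝ) - σ.1 := by
  obtain ⟨e, he⟩ := X.exists_aug_ne_zero hK
  refine ⟨_, ⟨e, rfl⟩, ?_⟩
  have h1 : X.deg e ≠ 0 := by
    intro h
    have h2 := X.aug_mem e
    rw [h, h0] at h2
    obtain ⟨c, hc⟩ := Algebra.mem_bot.1 h2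
    have hc0 : c ≠ 0 := by
      rintro rfl
      exact he (by rw [← hc, map_zero])
    refine hK' (Ideal.eq_top_of_isUnit_mem K (X.aug_mem_ideal (Finsupp.single e 1)) ?_)
    rw [← hc]
    exact (Ne.isUnit hc0).map _
  simp only [X.aug_hdeg e he, Nat.cast_zero, sub_zero]
  exact_mod_cast Nat.one_le_iff_ne_zero.2 h1

variable [GradedAlgebra 𝒜]

theorem idealProjDim_le_iff [Nontrivial A] (n : ℕ) :
    idealProjDim K ≤ n ↔ ∀ σ ∈ X.shape, σ.1 ≤ n := by
  rw [X.toGraded_isMinimal.idealProjDim_le_iff]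
  constructor
  · rintro h _ ⟨e, rfl⟩
    exact h _ ⟨e, rfl⟩
  · rintro h i ⟨e, rfl⟩
    exact h _ ⟨e, rfl⟩

theorem idealReg_eq [Nontrivial A] : idealReg 𝒜 K =
    sSup ((fun σ : ℕ × ℕ => (((σ.2 : ℝ) - (σ.1 : ℝ) : ℝ) : EReal)) '' X.shape) := by
  rw [X.toGraded_isMinimal.idealReg_eq]
  congr 1
  ext x
  constructor
  · rintro ⟨i, ⟨e, rfl⟩, rfl⟩
    exact ⟨_, ⟨e, rfl⟩, rfl⟩
  · rintro ⟨_, ⟨e, rfl⟩, rfl⟩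
    exact ⟨_, ⟨e, rfl⟩, rfl⟩

theorem natCast_le_idealProjDim_iff [Nontrivial A] (hK : K ≠ ⊥) (n : ℕ) :
    (n : WithBot ℕ∞) ≤ idealProjDim K ↔ ∃ σ ∈ X.shape, n ≤ σ.1 := by
  cases n with
  | zero =>
    obtain ⟨σ, hσ⟩ := X.shape_nonempty hK
    exact iff_of_true (idealProjDim_nonneg hK) ⟨σ, hσ, Nat.zero_le _⟩
  | succ n =>
    rw [idealProjDim, projectiveDimension_ge_iff, ← not_iff_not, not_not]
    refine (projectiveDimension_le_iff _ n).symm.trans ((X.idealProjDim_le_iff n).trans ?_)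
    push Not
    simp only [Nat.lt_succ_iff]

/-- The resolution of the unit ideal by a free module of rank one. -/
noncomputable def unit : TotalResolution 𝒜 (⊤ : Ideal A) where
  ι := PUnit
  hdeg _ := 0
  deg _ := 0
  d := 0
  aug := Finsupp.lapply PUnit.unit
  d_mem e := by simp
  d_minimal e e' := by simp
  d_hdeg e e' h := (h rfl).elim
  aug_mem e := by simpa using SetLike.GradedOne.one_mem
  aug_hdeg _ _ := rfl
  d_d _ := rfl
  aug_d _ := by simp
  exact x _ h := ⟨0, by ext; simpa using h.symm⟩
  aug_mem_ideal _ := trivial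
  exists_cycle c _ := ⟨Finsupp.single PUnit.unit c, rfl, by simp⟩

/-- The given resolution need not be the rank one resolution, but the two have the same projective
dimension and regularity, which bound the shape. -/
theorem mem_shape_of_eq_top [Nontrivial A] (hK : K = ⊤) {σ : ℕ × ℕ} (hσ : σ ∈ X.shape) :
    σ.1 = 0 ∧ (σ.2 : ℝ) - σ.1 ≤ 0 := by
  subst hK
  have h1 := (X.idealProjDim_le_iff 0).1 (((unit (𝒜 := 𝒜)).idealProjDim_le_iff 0).2 (by
    rintro _ ⟨e, rfl⟩; exact le_rfl)) σ hσ
  refine ⟨Nat.le_zero.1 h1, ?_⟩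
  have h2 : idealReg 𝒜 (⊤ : Ideal A) ≤ 0 := by
    rw [(unit (𝒜 := 𝒜)).idealReg_eq]
    refine sSup_le ?_
    rintro _ ⟨_, ⟨e, rfl⟩, rfl⟩
    simp [unit]
  rw [X.idealReg_eq] at h2
  exact_mod_cast (le_sSup (Set.mem_image_of_mem _ hσ)).trans h2

end TotalResolution

/-- This is where small type enters: it makes the lifts of `I^(a+1) ⊆ I^a` have entries in the
maximal ideal. -/
theorem exists_totalResolution_pow [GradedAlgebra 𝒜] [Nontrivial A] {I : Ideal A}
    (h0 : 𝒜 0 = (⊥ : Subalgebra k A).toSubmodule) (hI : I.IsHomogeneous 𝒜)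
    (hsmall : IsSmallType 𝒜 I) : ∃ X : ∀ a, TotalResolution 𝒜 (I ^ a),
      (∀ a, Nonempty (X a).Contraction) ∧ ∀ a, ∃ φ, (X (a + 1)).IsHom (X a) φ ∧
        ∀ e e', φ (Finsupp.single e 1) e' ∈ gradedMaximalIdeal 𝒜 := by
  have hpow : ∀ a, (I ^ a).IsHomogeneous 𝒜 := by
    intro a
    induction a with
    | zero => rw [pow_zero, Ideal.one_eq_top]; exact Ideal.IsHomogeneous.top 𝒜
    | succ a ih => rw [pow_succ]; exact ih.mul hI
  choose F hF using fun a => exists_minimal_resolution h0 (hpow a)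
  refine ⟨fun a => (hF a).toTotal, fun a => (hF a).nonempty_contraction, fun a => ?_⟩
  obtain ⟨φ, hφ⟩ := (F (a + 1)).exists_isChainMap (Ideal.pow_le_pow_right (Nat.le_succ a)) (F a)
  exact ⟨_, hφ.isHom_totalMap (hF _) (hF _), GradedFreeResolution.totalMap_mem fun i x =>
    (hF _).chainMap_mem_smul_top (hF _) hφ _ i (hsmall a i) x⟩

end Invariants

/-! ### Order arithmetic for the two maxima -/

/-- Natural upper bounds cannot tell `⊥` from `0`, which is why nonnegativity is assumed. -/
theorem WithBot.eq_of_forall_le_natCast_iff {x y : WithBot ℕ∞} (hx : 0 ≤ x) (hy : 0 ≤ y)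
    (h : ∀ n : ℕ, x ≤ n ↔ y ≤ n) : x = y := by
  lift x to ℕ∞ using (WithBot.bot_lt_coe _ |>.trans_le hx).ne'
  lift y to ℕ∞ using (WithBot.bot_lt_coe _ |>.trans_le hy).ne'
  refine congrArg _ (eq_of_forall_ge_iff fun c => ?_)
  cases c with
  | top => simp
  | coe n => exact WithBot.coe_le_coe.symm.trans ((h n).trans WithBot.coe_le_coe)

theorem WithBot.add_add_natCast_le_iff {x y : WithBot ℕ∞} (hx : 0 ≤ x) (hy : 0 ≤ y) (c n : ℕ) :
    x + y + c ≤ n ↔ ∀ a b : ℕ, a ≤ x → b ≤ y → a + b + c ≤ n := by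
  constructor
  · intro h a b ha hb
    have := (add_le_add_left (add_le_add ha hb) (c : WithBot ℕ∞)).trans h
    exact_mod_cast this
  · intro h
    lift x to ℕ∞ using (WithBot.bot_lt_coe _ |>.trans_le hx).ne'
    lift y to ℕ∞ using (WithBot.bot_lt_coe _ |>.trans_le hy).ne'
    have h' : ∀ a b : ℕ, (a : ℕ∞) ≤ x → (b : ℕ∞) ≤ y → a + b + c ≤ n := fun a b ha hb =>
      h a b (WithBot.coe_le_coe.2 ha) (WithBot.coe_le_coe.2 hb)
    cases x with
    -- An infinite value admits `n + 1` as a lower bound, which contradicts the bound `n`.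
    | top => have := h' (n + 1) 0 le_top (by simp); omega
    | coe x =>
      cases y with
      | top => have := h' 0 (n + 1) (by simp) le_top; omega
      | coe y => 
        have := h' x y le_rfl le_rfl
        exact_mod_cast this

theorem EReal.sSup_add_sSup_add_coe_le_iff {s t : Set EReal} {c : ℝ} {z : EReal} :
    sSup s + sSup t + c ≤ z ↔ ∀ a ∈ s, ∀ b ∈ t, a + b + c ≤ z := by
  constructor
  · intro h a ha b hb
    exact (add_le_add_left (add_le_add (le_sSup ha) (le_sSup hb)) _).trans h
  · intro h
    have h1 : ∀ x : EReal, x + c ≤ z ↔ x ≤ z - c := fun x =>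
      (EReal.le_sub_iff_add_le (Or.inl (EReal.coe_ne_bot c)) (Or.inl (EReal.coe_ne_top c))).symm
    rw [h1]
    refine EReal.add_le_of_forall_lt fun a ha b hb => ?_
    obtain ⟨a', ha', h2⟩ := lt_sSup_iff.1 ha
    obtain ⟨b', hb', h3⟩ := lt_sSup_iff.1 hb
    exact (add_le_add h2.le h3.le).trans ((h1 _).1 (h a' ha' b' hb'))

/-- The terms of the resolution of a power of a mixed sum which involve the unit ideal do not
contribute to the bounds for an additive function of the degrees. -/
theorem forall_shape_powerFiltration_iff {Q : Set (ℕ × ℕ)} {A B : ℕ → Set (ℕ × ℕ)} {s : ℕ}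
    (hs : 1 ≤ s) (hQ : ∀ σ, σ ∈ Q ↔
      (∃ i ≤ s, ∃ τ ∈ A (s - i), ∃ ρ ∈ B i, σ = τ + ρ) ∨
        ∃ j < s, ∃ τ ∈ A (s - j), ∃ ρ ∈ B (j + 1), σ = τ + ρ + (1, 0))
    (f : ℕ × ℕ →+ ℝ) (hA : ∀ τ ∈ A 0, ∃ τ' ∈ A 1, f τ ≤ f τ' + f (1, 0))
    (hB : ∀ ρ ∈ B 0, ∃ ρ' ∈ B 1, f ρ ≤ f ρ' + f (1, 0)) {p : Set ℝ} (hp : IsLowerSet p) :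
    (∀ σ ∈ Q, f σ ∈ p) ↔
      (∀ i ∈ Finset.Icc 1 (s - 1), ∀ τ ∈ A (s - i), ∀ ρ ∈ B i, f τ + f ρ ∈ p) ∧
        ∀ j ∈ Finset.Icc 1 s, ∀ τ ∈ A (s - j + 1), ∀ ρ ∈ B j, f τ + f ρ + f (1, 0) ∈ p := by
  simp only [Finset.mem_Icc]
  constructor
  · refine fun h => ⟨fun i hi τ hτ ρ hρ => ?_, fun j hj τ hτ ρ hρ => ?_⟩
    · rw [← map_add]
      exact h _ ((hQ _).2 (Or.inl ⟨i, by omega, τ, hτ, ρ, hρ, rfl⟩))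
    · obtain ⟨j, rfl⟩ := Nat.exists_eq_add_of_le' hj.1
      rw [← map_add, ← map_add]
      rw [show s - (j + 1) + 1 = s - j by omega] at hτ
      exact h _ ((hQ _).2 (Or.inr ⟨j, by omega, τ, hτ, ρ, hρ, rfl⟩))
  · rintro ⟨h1, h2⟩ σ hσ
    rcases (hQ σ).1 hσ with ⟨i, hi, τ, hτ, ρ, hρ, rfl⟩ | ⟨j, hj, τ, hτ, ρ, hρ, rfl⟩
    · rw [map_add]
      rcases Nat.eq_zero_or_pos i with rfl | hi0
      -- The term `i = 0` is absorbed by the cone term `j = 1`: `τ` stays, and `ρ` is replaced by a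
      -- basis degree of the first power.
      · obtain ⟨ρ', hρ', h⟩ := hB ρ hρ
        rw [Nat.sub_zero, ← Nat.sub_add_cancel hs] at hτ
        exact hp (by linarith) (h2 1 ⟨le_rfl, hs⟩ τ hτ ρ' hρ')
      · rcases Nat.lt_or_eq_of_le hi with hi | rfl
        · exact h1 i (by omega) τ hτ ρ hρ
        · rw [Nat.sub_self] at hτ
          -- Symmetrically, the term `i = s` is absorbed by the cone term `j = s`.
          obtain ⟨τ', hτ', h⟩ := hA τ hτ
          exact hp (by linarith) (h2 i ⟨hs, le_rfl⟩ τ' (by rwa [Nat.sub_self]) ρ hρ)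
    · rw [map_add, map_add]
      refine h2 (j + 1) (by omega) τ ?_ ρ hρ
      rwa [show s - (j + 1) + 1 = s - j by omega]

/-! ### Bounds for sums of invariants and the main theorem -/

section Shape

variable {k : Type u} [Field k] {R : Type v} [CommRing R] [Algebra k R]
  {S : Type w} [CommRing S] [Algebra k S] {𝒜 : ℕ → Submodule k R} {ℬ : ℕ → Submodule k S}
  [GradedAlgebra 𝒜] [GradedAlgebra ℬ] {I : Ideal R} {J : Ideal S} [Nontrivial R] [Nontrivial S]

namespace TotalResolution

variable (X : TotalResolution 𝒜 I) (Y : TotalResolution ℬ J)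

theorem idealProjDim_add_add_le_iff (hI : I ≠ ⊥) (hJ : J ≠ ⊥) (c n : ℕ) :
    idealProjDim I + idealProjDim J + c ≤ n ↔
      ∀ τ ∈ X.shape, ∀ ρ ∈ Y.shape, τ.1 + ρ.1 + c ≤ n := by
  rw [WithBot.add_add_natCast_le_iff (idealProjDim_nonneg hI) (idealProjDim_nonneg hJ)]
  simp only [X.natCast_le_idealProjDim_iff hI, Y.natCast_le_idealProjDim_iff hJ]
  constructor
  · exact fun h τ hτ ρ hρ => h _ _ ⟨τ, hτ, le_rfl⟩ ⟨ρ, hρ, le_rfl⟩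
  · rintro h a b ⟨τ, hτ, h1⟩ ⟨ρ, hρ, h2⟩
    have := h τ hτ ρ hρ
    omega

theorem idealReg_add_add_le_iff (c : ℝ) (z : EReal) :
    idealReg 𝒜 I + idealReg ℬ J + c ≤ z ↔ ∀ τ ∈ X.shape, ∀ ρ ∈ Y.shape,
      ((((τ.2 : ℝ) - τ.1) + ((ρ.2 : ℝ) - ρ.1) + c : ℝ) : EReal) ≤ z := by
  rw [X.idealReg_eq, Y.idealReg_eq, EReal.sSup_add_sSup_add_coe_le_iff]
  simp only [Set.forall_mem_image, EReal.coe_add]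

end TotalResolution

end Shape

theorem mixedSum_pow_ne_bot {k : Type u} [Field k] {R : Type v} [CommRing R] [Algebra k R]
    {S : Type w} [CommRing S] [Algebra k S] [Nontrivial S] {I : Ideal R} (J : Ideal S) {s : ℕ}
    (hI : I ^ s ≠ ⊥) : mixedSum k I J ^ s ≠ ⊥ := by
  intro h
  have h1 : (I ^ s).map (Algebra.TensorProduct.includeLeft : R →ₐ[k] R ⊗[k] S) = ⊥ := by
    rw [eq_bot_iff, ← h, Ideal.map_pow]
    exact Ideal.pow_right_mono le_sup_left s
  refine hI ((Ideal.map_eq_bot_iff_of_injective ?_).1 h1)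
  exact Algebra.TensorProduct.includeLeft_injective (S := k) (algebraMap k S).injective

theorem mainTheorem5 {k : Type u} [Field k]
    {R : Type v} [CommRing R] [Algebra k R] (𝒜 : ℕ → Submodule k R) [GradedAlgebra 𝒜]
    {S : Type w} [CommRing S] [Algebra k S] (ℬ : ℕ → Submodule k S) [GradedAlgebra ℬ]
    (hR : IsStandardGraded 𝒜) (hS : IsStandardGraded ℬ)
    (I : Ideal R) (J : Ideal S)
    (hI : I.IsHomogeneous 𝒜) (hJ : J.IsHomogeneous ℬ)
    (hI_proper : I ≠ ⊤) (hJ_proper : J ≠ ⊤)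
    (hI_small : IsSmallType 𝒜 I) (hJ_small : IsSmallType ℬ J)
    (hI_pow : ∀ i : ℕ, 1 ≤ i → I ^ i ≠ ⊥) (hJ_pow : ∀ i : ℕ, 1 ≤ i → J ^ i ≠ ⊥)
    (s : ℕ) (hs : 1 ≤ s) :
    idealProjDim (mixedSum k I J ^ s) =
      max
        ((Finset.Icc 1 (s - 1)).sup fun i => idealProjDim (I ^ (s - i)) + idealProjDim (J ^ i))
        ((Finset.Icc 1 s).sup fun j =>
          idealProjDim (I ^ (s - j + 1)) + idealProjDim (J ^ j) + 1) ∧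
    idealReg (tensorGrading 𝒜 ℬ) (mixedSum k I J ^ s) =
      max
        ((Finset.Icc 1 (s - 1)).sup fun i => idealReg 𝒜 (I ^ (s - i)) + idealReg ℬ (J ^ i))
        ((Finset.Icc 1 s).sup fun j =>
          idealReg 𝒜 (I ^ (s - j + 1)) + idealReg ℬ (J ^ j) - 1) := by
  have := hR.nontrivial
  have := hS.nontrivial
  obtain ⟨X, hX, hφ⟩ := exists_totalResolution_pow hR.degree_zero hI hI_small
  obtain ⟨Y, hY, hψ⟩ := exists_totalResolution_pow hS.degree_zero hJ hJ_small
  obtain ⟨Q, -, hQ⟩ := TotalResolution.exists_resolution_powerFiltration X Y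
    (fun a => (hX a).some) (fun b => (hY b).some) hφ hψ s s le_rfl
  have hP := mixedSum_pow_ne_bot (k := k) J (hI_pow s hs)
  rw [mixedSum_pow] at hP ⊢
  have hX0 := fun {σ} => (X 0).mem_shape_of_eq_top (σ := σ) (by rw [pow_zero, Ideal.one_eq_top])
  have hY0 := fun {σ} => (Y 0).mem_shape_of_eq_top (σ := σ) (by rw [pow_zero, Ideal.one_eq_top])
  obtain ⟨σ, hσ, hσ'⟩ := (X 1).exists_mem_shape_one_le hR.degree_zero (hI_pow 1 le_rfl)
    (by rwa [pow_one])
  obtain ⟨ρ, hρ, hρ'⟩ := (Y 1).exists_mem_shape_one_le hS.degree_zero (hJ_pow 1 le_rfl)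
    (by rwa [pow_one])
  -- The functional is `fst` for projective dimension and `snd - fst` for regularity. On the cone
  -- shift `(1, 0)` they take the values `1` and `-1`, the constants in the two formulas.
  let fst : ℕ × ℕ →+ ℝ := (Nat.castAddMonoidHom ℝ).comp (AddMonoidHom.fst ℕ ℕ)
  let snd : ℕ × ℕ →+ ℝ := (Nat.castAddMonoidHom ℝ).comp (AddMonoidHom.snd ℕ ℕ)
  constructor
  · have key := fun n : ℕ => forall_shape_powerFiltration_iff
      (A := fun a => (X a).shape) (B := fun b => (Y b).shape) hs hQ fst
      (fun τ hτ => ⟨σ, hσ, by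
        simp [fst, (hX0 hτ).1]
        positivity⟩)
      (fun τ hτ => ⟨ρ, hρ, by
        simp [fst, (hY0 hτ).1]
        positivity⟩) (isLowerSet_Iic (n : ℝ))
    -- Both sides are compared through their natural upper bounds. For `s = 1` the first supremum is
    -- `⊥` and imposes no condition; the term `j = 1` keeps the right side nonnegative.
    refine WithBot.eq_of_forall_le_natCast_iff (idealProjDim_nonneg hP) ?_ fun n => ?_
    · refine le_max_of_le_right (le_trans ?_ (Finset.le_sup (Finset.mem_Icc.2 ⟨le_rfl, hs⟩)))
      exact add_nonneg (add_nonneg (idealProjDim_nonneg (hI_pow _ (by omega)))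
        (idealProjDim_nonneg (hJ_pow _ le_rfl))) zero_le_one
    · rw [Q.idealProjDim_le_iff, max_le_iff, Finset.sup_le_iff, Finset.sup_le_iff]
      refine Iff.trans ?_ ((key n).trans (and_congr (forall₂_congr fun i hi => ?_)
        (forall₂_congr fun j hj => ?_)))
      · simp [fst]
      · rw [Finset.mem_Icc] at hi
        have := (X (s - i)).idealProjDim_add_add_le_iff (Y i) (hI_pow _ (by omega))
          (hJ_pow _ hi.1) 0 n
        rw [Nat.cast_zero, add_zero] at this
        rw [this]
        simp only [fst, Set.mem_Iic, AddMonoidHom.comp_apply, Nat.coe_castAddMonoidHom,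
          AddMonoidHom.coe_fst]
        norm_cast
      · rw [Finset.mem_Icc] at hj
        have := (X (s - j + 1)).idealProjDim_add_add_le_iff (Y j) (hI_pow _ (by omega))
          (hJ_pow _ hj.1) 1 n
        rw [Nat.cast_one] at this
        rw [this]
        simp only [fst, Set.mem_Iic, AddMonoidHom.comp_apply, Nat.coe_castAddMonoidHom,
          AddMonoidHom.coe_fst]
        norm_cast
  · have key := fun z : EReal => forall_shape_powerFiltration_iff
      (A := fun a => (X a).shape) (B := fun b => (Y b).shape) hs hQ (snd - fst)
      (fun τ hτ => ⟨σ, hσ, by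
        have := (hX0 hτ).2
        simp only [fst, snd, AddMonoidHom.sub_apply, AddMonoidHom.comp_apply,
          AddMonoidHom.coe_fst, AddMonoidHom.coe_snd, Nat.coe_castAddMonoidHom, Nat.cast_zero,
          Nat.cast_one]
        linarith⟩)
      (fun τ hτ => ⟨ρ, hρ, by
        have := (hY0 hτ).2
        simp only [fst, snd, AddMonoidHom.sub_apply, AddMonoidHom.comp_apply,
          AddMonoidHom.coe_fst, AddMonoidHom.coe_snd, Nat.coe_castAddMonoidHom, Nat.cast_zero,
          Nat.cast_one]
        linarith⟩) (p := {x | (x : EReal) ≤ z}) (fun a b h hb => le_trans (EReal.coe_le_coe h) hb)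
    -- Regularity may be infinite, so upper bounds range over all extended reals; real values below
    -- `z` form a lower set, as the absorption argument requires.
    refine eq_of_forall_ge_iff fun z => ?_
    rw [Q.idealReg_eq, max_le_iff, Finset.sup_le_iff, Finset.sup_le_iff, sSup_le_iff,
      Set.forall_mem_image]
    refine (key z).trans (and_congr (forall₂_congr fun i hi => ?_) (forall₂_congr fun j hj => ?_))
    · have := (X (s - i)).idealReg_add_add_le_iff (Y i) 0 z
      rw [EReal.coe_zero, add_zero] at this
      rw [this]
      simp [fst, snd]
    · have := (X (s - j + 1)).idealReg_add_add_le_iff (Y j) (-1) z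
      rw [EReal.coe_neg, EReal.coe_one, ← sub_eq_add_neg] at this
      rw [this]
      simp [fst, snd]
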